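/- **Setting.** Let $I_v$ be a finite set of variable-node (VN) types. A type-$t$ VN is an injective binary linear encoder $\mathbb F_2^{k_t}\to\mathbb F_2^{q_t}$, $k_t\ge 1$; let $B^{(t)}_{u,v}$ be the number of inputs of weight $u$ whose output has weight $v$, and $B^{(t)}(x,y)=\sum_{u,v}B^{(t)}_{u,v}x^uy^v$, the same for all VNs of type $t$. All check nodes (CNs) are nonzero binary linear codes of the same length $s\ge1$ with the same weight enumerator $A(z)=\sum_u A_uz^u$. Let $\lambda_t>0$ be rational with $\sum_t\lambda_t=1$ (fractions of edges), $\int\lambda=\int_0^1\sum_t\lambda_tx^{q_t-1}\,dx$, $\int\rho=\int_0^1x^{s-1}\,dx=1/s$, $\delta_t=\lambda_t/(q_t\int\lambda)$. For those $n\ge1$ for which all $\delta_tn$ and $m=n\int\rho/\int\lambda$ are integers, the ensemble $\mathcal M_n$ has $\delta_tn$ VNs of type $t$ for each $t$, $m$ CNs, and a uniformly random permutation matching the $E=n/\int\lambda$ VN sockets with the $E$ CN sockets. A word consists of the local inputs of all VNs; it is a codeword if the VN output bits, carried along the edges, form a local codeword at every CN; its weight is the number of ones in the word. Let $N_w$ be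 the number of codewords of weight $w$. The growth rate is $G(\alpha)=\lim\frac1n\log\mathbb E_{\mathcal M_n}[N_w]$ as $n\to\infty$ and $w/n\to\alpha$ (in particular along $w=\alpha n$), over the pairs $(n,w)$ for which $\mathcal M_n$ exists and $\mathbb E_{\mathcal M_n}[N_w]>0$. Let $U^{(t)}_i$ and $V^{(t)}_i$ be the minimum and maximum output weight over the inputs of weight $i$ of a type-$t$ VN. For $0\le a\le k_t$ let $m^{(t)}(a)=\min_\omega\sum_{i=1}^{k_t}U^{(t)}_i\omega_i$ and $M^{(t)}(a)=\max_\omega\sum_{i=1}^{k_t}V^{(t)}_i\omega_i$, both over $\omega_i\ge0$, $\sum_i\omega_i\le1$, $\sum_ii\omega_i=a$. Let $\beta_{\max}=\frac{\int\rho}{\int\lambda}\max\{u:A_u>0\}$. **Proposition.** (1) For $0<\beta<\beta_{\max}$ the equation $\frac{A'(z_0)}{A(z_0)}z_0=\beta\frac{\int\lambda}{\int\rho}$ has a unique solution $z_0>0$. (2) For $t\in I_v$, $0<\alpha_t<\delta_tk_t$ and $\delta_tm^{(t)}(\alpha_t/\delta_t)<\beta_t<\delta_tM^{(t)}(\alpha_t/\delta_t)$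 the equations $$\frac{\partial B^{(t)}}{\partial x}(x_0,y_0)\frac{x_0}{B^{(t)}(x_0,y_0)}=\frac{\alpha_t}{\delta_t},\qquad \frac{\partial B^{(t)}}{\partial y}(x_0,y_0)\frac{y_0}{B^{(t)}(x_0,y_0)}=\frac{\beta_t}{\delta_t}$$ have a unique solution with $x_0,y_0>0$. If instead $\delta_tm^{(t)}(\alpha_t/\delta_t)=\beta_t=\delta_tM^{(t)}(\alpha_t/\delta_t)$ (as for repetition codes), a positive solution exists, not necessarily unique. (3) There are continuous functions $X_t^{(\delta_t)}$ on $\{(\alpha_t,\beta_t):0\le\alpha_t\le\delta_tk_t,\ \delta_tm^{(t)}(\alpha_t/\delta_t)\le\beta_t\le\delta_tM^{(t)}(\alpha_t/\delta_t)\}$ and $Y$ on $[0,\beta_{\max}]$ such that, with $h$ the binary entropy function in nats, $$X_t^{(\delta_t)}(\alpha_t,\beta_t)=\log\frac{B^{(t)}(x_0,y_0)^{\delta_t}}{x_0^{\alpha_t}y_0^{\beta_t}},\qquad Y(\beta)=\log\frac{A(z_0)^{\int\rho/\int\lambda}}{z_0^{\beta}}-\frac{h(\beta\int\lambda)}{\int\lambda}$$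 for every positive solution $(x_0,y_0)$, resp. $z_0$, of the equations above (for whichever $(\alpha_t,\beta_t)$, resp. $\beta$, one exists), and such that for every real $\alpha$ whose constraint set below is nonempty the growth rate exists (pairs $(n,w)$ as above exist with $n\to\infty$, $w/n\to\alpha$) and $$G(\alpha)=\max_{(\alpha_t),(\beta_t)}\Big(\sum_{t\in I_v}X_t^{(\delta_t)}(\alpha_t,\beta_t)+Y(\beta)\Big),\qquad \beta=\sum_{t\in I_v}\beta_t,$$ the maximum, which is attained, being over all $(\alpha_t),(\beta_t)$ with $0\le\alpha_t\le\delta_tk_t$ and $\delta_tm^{(t)}(\alpha_t/\delta_t)\le\beta_t\le\delta_tM^{(t)}(\alpha_t/\delta_t)$ for all $t$, $\sum_t\alpha_t=\alpha$ and $\beta\le\beta_{\max}$. -/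

import Mathlib

open Filter Topology

noncomputable section

/-- A sequence `(M_n)` of doubly-generalized LDPC ensembles with a uniform check-node (CN) set.
Variable-node (VN) types are indexed by `ι`.  The type of a CN is its weight enumerator and the
type of a VN is its input-output weight enumerator, so two nodes of one type may carry different
local codes: `cn n j` is the code of the `j`-th CN of `M_n`, and `vn n t i` is the encoder
(generator matrix) of the `i`-th VN of type `t` of `M_n`. -/
structure DGLDPC (ι : Type*) [Fintype ι] where
  /-- CN length -/
  s : ℕ
  /-- VN lengths -/
  q : ι → ℕ
  /-- VN dimensions -/
  k : ι → ℕ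
  /-- fraction of the edges connected to VNs of a given type; rational, since numbers of nodes are
  integers -/
  lam : ι → ℚ
  /-- `A u`: number of weight-`u` local codewords of each CN -/
  A : ℕ → ℕ
  /-- `B t u v`: number of weight-`u` local inputs of a type-`t` VN with a weight-`v` codeword -/
  B : ι → ℕ → ℕ → ℕ
  cn : ℕ → ℕ → Submodule (ZMod 2) (Fin s → ZMod 2)
  vn : ℕ → (t : ι) → ℕ → ((Fin (k t) → ZMod 2) →ₗ[ZMod 2] (Fin (q t) → ZMod 2))
  s_pos : 0 < s
  k_pos : ∀ t, 0 < k t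
  lam_pos : ∀ t, 0 < lam t
  lam_sum : ∑ t, lam t = 1
  cn_ne_bot : ∀ n j, cn n j ≠ ⊥
  vn_injective : ∀ n t i, Function.Injective (vn n t i)
  cn_wef : ∀ n j u, Nat.card {c : Fin s → ZMod 2 // c ∈ cn n j ∧ hammingNorm c = u} = A u
  vn_iowef : ∀ n t i u v,
    Nat.card {x : Fin (k t) → ZMod 2 // hammingNorm x = u ∧ hammingNorm (vn n t i x) = v} = B t u v

namespace DGLDPC

variable {ι : Type*} [Fintype ι] (D : DGLDPC ι)

/-- `∫ λ`, the integral over `[0, 1]` of `λ(x) = ∑ t, λ_t x ^ (q_t - 1)`. -/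
def lamInt : ℝ := ∫ x in (0 : ℝ)..1, ∑ t, (D.lam t : ℝ) * x ^ (D.q t - 1)

/-- `∫ ρ`, the integral over `[0, 1]` of `ρ(x) = x ^ (s - 1)`. -/
def rhoInt : ℝ := ∫ x in (0 : ℝ)..1, x ^ (D.s - 1)

/-- The fraction of VNs that have type `t`. -/
def delta (t : ι) : ℝ := D.lam t / (D.q t * D.lamInt)

/-! ### The ensemble and its expected weight distribution -/

/-- The number of type-`t` VNs when there are `n` VNs (meaningful for admissible `n`). -/
def numVN (n : ℕ) (t : ι) : ℕ := ⌊(n : ℝ) * D.delta t⌋₊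

/-- The number of CNs when there are `n` VNs (meaningful for admissible `n`). -/
def numCN (n : ℕ) : ℕ := ⌊(n : ℝ) * (D.rhoInt / D.lamInt)⌋₊

/-- `M_n` exists: the prescribed numbers of nodes are integers. -/
def Admissible (n : ℕ) : Prop :=
  0 < n ∧ (∀ t, (D.numVN n t : ℝ) = n * D.delta t) ∧
    (D.numCN n : ℝ) = n * (D.rhoInt / D.lamInt)

/-- The VNs of a member of `M_n`. -/
abbrev VNode (n : ℕ) : Type _ := Σ t : ι, Fin (D.numVN n t)

/-- The edge ends at the VNs. -/
abbrev VSocket (n : ℕ) : Type _ := Σ p : D.VNode n, Fin (D.q p.1)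

/-- The edge ends at the CNs. -/
abbrev CSocket (n : ℕ) : Type := Fin (D.numCN n) × Fin D.s

/-- A word of a code in `M_n`: its bits are the local input bits of the VNs. -/
abbrev Word (n : ℕ) : Type _ := (p : D.VNode n) → Fin (D.k p.1) → ZMod 2

/-- The bit that a word puts on an edge. -/
def edgeBit (n : ℕ) (u : D.Word n) (e : D.VSocket n) : ZMod 2 :=
  D.vn n e.1.1 e.1.2 (u e.1) e.2

/-- `u` is a codeword of the member of `M_n` given by the edge permutation `π`. -/
def IsCodeword (n : ℕ) (π : D.VSocket n ≃ D.CSocket n) (u : D.Word n) : Prop :=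
  ∀ j : Fin (D.numCN n), (fun l : Fin D.s => D.edgeBit n u (π.symm (j, l))) ∈ D.cn n j

/-- `N_w`, the number of codewords of Hamming weight `w` of one member of `M_n`. -/
def numCodewords (n : ℕ) (π : D.VSocket n ≃ D.CSocket n) (w : ℕ) : ℕ :=
  Nat.card {u : D.Word n // D.IsCodeword n π u ∧ ∑ p, hammingNorm (u p) = w}

open Classical in
/-- The expectation of `N_w` over `M_n`, all edge permutations being equally likely. -/
def expNum (n w : ℕ) : ℝ :=
  (∑ π : D.VSocket n ≃ D.CSocket n, (D.numCodewords n π w : ℝ)) /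
    Fintype.card (D.VSocket n ≃ D.CSocket n)

/-- Pairs `(n, w)` with `M_n` defined, `n → ∞`, `w / n → α` and a positive expected number of
codewords of weight `w`.  The pairs with `w = α n` are among them; for general `w` irrational `α`
are covered as well.  Positivity leaves out the `w` that are impossible for divisibility reasons
(such as an odd number of ones on edges that meet even-weight check codes), where the
logarithm is `-∞`. -/
def growthFilter (α : ℝ) : Filter (ℕ × ℕ) :=
  comap Prod.fst atTop ⊓ comap (fun p : ℕ × ℕ => (p.2 : ℝ) / p.1) (𝓝 α) ⊓
    𝓟 {p | D.Admissible p.1 ∧ 0 < D.expNum p.1 p.2}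

/-- `g` is the growth rate of the weight distribution at `α`. -/
def IsGrowthRate (α g : ℝ) : Prop :=
  (D.growthFilter α).NeBot ∧
    Tendsto (fun p : ℕ × ℕ => 1 / (p.1 : ℝ) * Real.log (D.expNum p.1 p.2))
      (D.growthFilter α) (𝓝 g)

/-! ### Weight enumerators and saddle points -/

/-- The weight enumerating function `A(z)` of each CN. -/
def wef (z : ℝ) : ℝ := ∑ u ∈ Finset.range (D.s + 1), (D.A u : ℝ) * z ^ u

/-- The input-output weight enumerating function `B⁽ᵗ⁾(x, y)` of type-`t` VNs. -/
def iowef (t : ι) (x y : ℝ) : ℝ :=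
  ∑ u ∈ Finset.range (D.k t + 1), ∑ v ∈ Finset.range (D.q t + 1), (D.B t u v : ℝ) * x ^ u * y ^ v

/-- `z` is a positive solution `z₀` of the CN saddle-point equation at `β`. -/
def IsSaddleCN (β z : ℝ) : Prop :=
  0 < z ∧ deriv D.wef z / D.wef z * z = β * (D.lamInt / D.rhoInt)

/-- `p = (x, y)` is a positive solution `(x₀, y₀)` of the pair of type-`t` VN saddle-point
equations at `(a, b)`. -/
def IsSaddleVN (t : ι) (a b : ℝ) (p : ℝ × ℝ) : Prop :=
  0 < p.1 ∧ 0 < p.2 ∧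
    deriv (fun x => D.iowef t x p.2) p.1 * (p.1 / D.iowef t p.1 p.2) = a / D.delta t ∧
    deriv (fun y => D.iowef t p.1 y) p.2 * (p.2 / D.iowef t p.1 p.2) = b / D.delta t

/-- The expression for `Y(β)` in terms of the saddle point `z`. -/
def valY (β z : ℝ) : ℝ :=
  Real.log (D.wef z ^ (D.rhoInt / D.lamInt) / z ^ β) -
    Real.binEntropy (β * D.lamInt) / D.lamInt

/-- The expression for `X_t(a, b)` in terms of the saddle point `p = (x, y)`. -/
def valX (t : ι) (a b : ℝ) (p : ℝ × ℝ) : ℝ :=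
  Real.log (D.iowef t p.1 p.2 ^ D.delta t / (p.1 ^ a * p.2 ^ b))

/-! ### The constraint set -/

/-- Minimum codeword weight over the local inputs of weight `i`. -/
def U (t : ι) (i : ℕ) : ℕ := sInf {j | 0 < D.B t i j}

/-- Maximum codeword weight over the local inputs of weight `i`. -/
def V (t : ι) (i : ℕ) : ℕ := sSup {j | 0 < D.B t i j}

/-- The feasible points `ω` of the two linear programs at `a` (nonempty iff `0 ≤ a ≤ k_t`). -/
def lpSet (t : ι) (a : ℝ) : Set (ℕ → ℝ) :=
  {ω | (∀ i ∈ Finset.Icc 1 (D.k t), 0 ≤ ω i) ∧ ∑ i ∈ Finset.Icc 1 (D.k t), ω i ≤ 1 ∧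
    ∑ i ∈ Finset.Icc 1 (D.k t), (i : ℝ) * ω i = a}

/-- The minimum of the linear program with the weights `U`. -/
def lpMin (t : ι) (a : ℝ) : ℝ :=
  sInf ((fun ω : ℕ → ℝ => ∑ i ∈ Finset.Icc 1 (D.k t), (D.U t i : ℝ) * ω i) '' D.lpSet t a)

/-- The maximum of the linear program with the weights `V`. -/
def lpMax (t : ι) (a : ℝ) : ℝ :=
  sSup ((fun ω : ℕ → ℝ => ∑ i ∈ Finset.Icc 1 (D.k t), (D.V t i : ℝ) * ω i) '' D.lpSet t a)

/-- Lower bound on `β_t`: there are `δ_t n` VNs of type `t`, each with average local input weight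
`α_t / δ_t`. -/
def lower (t : ι) (a : ℝ) : ℝ := D.delta t * D.lpMin t (a / D.delta t)

/-- Upper bound on `β_t`. -/
def upper (t : ι) (a : ℝ) : ℝ := D.delta t * D.lpMax t (a / D.delta t)

/-- The pairs `(α_t, β_t)` allowed for type `t`; the bound `α_t ≤ δ_t k_t` says that the linear
programs are feasible. -/
def vnRegion (t : ι) : Set (ℝ × ℝ) :=
  {p | 0 ≤ p.1 ∧ p.1 ≤ D.delta t * D.k t ∧ D.lower t p.1 ≤ p.2 ∧ p.2 ≤ D.upper t p.1}

/-- The largest value of `β` that the CNs allow: `∫ρ / ∫λ` times the maximum weight of a local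
codeword of a CN. -/
def betaMax : ℝ := D.rhoInt / D.lamInt * (sSup {u | 0 < D.A u} : ℕ)

/-- The constraint set of the maximization: pairs of vectors `(α_t)`, `(β_t)`. -/
def feasible (α : ℝ) : Set ((ι → ℝ) × (ι → ℝ)) :=
  {p | (∀ t, (p.1 t, p.2 t) ∈ D.vnRegion t) ∧ ∑ t, p.1 t = α ∧ ∑ t, p.2 t ≤ D.betaMax}

end DGLDPC

end

/-!
Distribute the nodes over the symbols (type, input weight, output weight) of their local words. The
expected number of codewords of weight `w` is a sum, over the polynomially many profiles of symbol
counts, of multinomial coefficients divided by the binomial coefficient of the edge bits. By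
Stirling's formula each term is `exp (n F(N / n) + o(n))` for one continuous exponent `F`, so that
the growth rate is the maximum of `F` over a polyhedron. The Hoffman bound for linear systems makes
this maximum continuous in `α` and puts an integer profile near every real point of the polyhedron,
which gives the matching lower bound.

Maximizing first with all `α_t` and `β_t` fixed decouples the node types: `X_t` and `Y` are entropy
maxima over the distributions with given mean weights. By the Gibbs inequality a member of the
exponential family generated by the weight enumerator attains such a maximum, and the equations for
`(x₀, y₀)` and `z₀` say that the member with parameters `log x₀`, `log y₀`, `log z₀` has the
prescribed means. Conversely the maximizer is positive in the interior, hence stationary, hence a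
member of the family.
-/

section Conformal

theorem mem_uIcc_pi {J α : Type*} [Lattice α] {u v w : J → α} :
    w ∈ Set.uIcc u v ↔ ∀ j, w j ∈ Set.uIcc (u j) (v j) := by
  rw [← Set.pi_univ_uIcc, Set.mem_univ_pi]

open Matrix

variable {J 𝕜 : Type*} [Field 𝕜] [LinearOrder 𝕜]

/-- `g` picks, for every sign pattern that occurs in `W`, a vector of `W` with that pattern. -/
structure IsSignRepresentative (W : Submodule 𝕜 (J → 𝕜)) (g : (J → SignType) → J → 𝕜) : Prop where
  mem : ∀ σ, g σ ∈ W
  sign_eq : ∀ v ∈ W, ∀ j, SignType.sign (g (fun i => SignType.sign (v i)) j) = SignType.sign (v j)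

theorem exists_isSignRepresentative (W : Submodule 𝕜 (J → 𝕜)) : ∃ g, IsSignRepresentative W g := by
  have h (σ : J → SignType) :
      ∃ u ∈ W, ∀ v ∈ W, (fun i => SignType.sign (v i)) = σ → ∀ j, SignType.sign (u j) = σ j := by
    by_cases hσ : ∃ u ∈ W, (fun i => SignType.sign (u i)) = σ
    · obtain ⟨u, hu, rfl⟩ := hσ
      exact ⟨u, hu, fun _ _ _ _ => rfl⟩
    · exact ⟨0, W.zero_mem, fun v hv hvσ => absurd ⟨v, hv, hvσ⟩ hσ⟩
  choose g hg hsign using h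
  exact ⟨g, hg, fun v hv j => hsign _ v hv rfl j⟩

variable [IsStrictOrderedRing 𝕜]

theorem add_sub_mem_uIcc {a b w : 𝕜} (hw : w ∈ Set.uIcc 0 b) (hb : b ∈ Set.uIcc 0 a) :
    w + (a - b) ∈ Set.uIcc 0 a := by
  rw [Set.mem_uIcc] at *
  grind

/-- The largest multiple of `u` that can be taken off `v` without changing a sign makes a further
coordinate vanish. -/
theorem exists_sub_smul_mem_uIcc [Finite J] {u v : J → 𝕜}
    (hsign : ∀ j, SignType.sign (u j) = SignType.sign (v j)) (hv : v ≠ 0) :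
    ∃ c : 𝕜, 0 ≤ c ∧ v - c • u ∈ Set.uIcc 0 v ∧ ∃ i, v i ≠ 0 ∧ (v - c • u) i = 0 := by
  have hdiv : ∀ j, v j ≠ 0 → u j ≠ 0 ∧ 0 < v j / u j := by
    intro j hj
    rcases hj.lt_or_gt with hneg | hpos
    · have huj : u j < 0 := sign_eq_neg_one_iff.1 ((hsign j).trans (sign_neg hneg))
      exact ⟨huj.ne, div_pos_of_neg_of_neg hneg huj⟩
    · have huj : 0 < u j := sign_eq_one_iff.1 ((hsign j).trans (sign_pos hpos))
      exact ⟨huj.ne', div_pos hpos huj⟩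
  obtain ⟨i, hi, hmin⟩ := Set.exists_min_image {j | v j ≠ 0} (fun j => v j / u j)
    (Set.toFinite _) (Function.ne_iff.1 hv)
  refine ⟨v i / u i, (hdiv i hi).2.le, mem_uIcc_pi.2 fun j => ?_, i, hi, ?_⟩
  · by_cases hj : v j = 0
    · have huj : u j = 0 := by simpa [hj, sign_eq_zero_iff] using hsign j
      simp [hj, huj]
    · obtain ⟨_, hvuj⟩ := hdiv j hj
      set θ := v i / u i / (v j / u j) with hθ
      have hθ0 : 0 ≤ θ := div_nonneg (hdiv i hi).2.le hvuj.le
      have hθ1 : θ ≤ 1 := (div_le_one hvuj).2 (hmin j hj)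
      have hscale : (v - (v i / u i) • u) j = (1 - θ) * v j := by
        simp only [hθ, Pi.sub_apply, Pi.smul_apply, smul_eq_mul]
        have hvj : v j ≠ 0 := hj
        have hui := (hdiv i hi).1
        field_simp
      rw [hscale, Pi.zero_apply, Set.mem_uIcc]
      rcases le_total 0 (v j) with h | h
      · exact .inl ⟨mul_nonneg (by linarith) h, by nlinarith⟩
      · exact .inr ⟨by nlinarith, mul_nonpos_of_nonneg_of_nonpos (by linarith) h⟩
  · simp [div_mul_cancel₀ _ (hdiv i hi).1]

/-- Subtract a multiple of the sign representative of `v` as above and induct on the support. -/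
theorem IsSignRepresentative.exists_conformal_sum [Finite J] {W : Submodule 𝕜 (J → 𝕜)}
    {g : (J → SignType) → J → 𝕜} (hg : IsSignRepresentative W g) [Fintype (J → SignType)]
    {v : J → 𝕜} (hv : v ∈ W) :
    ∃ μ : (J → SignType) → 𝕜, (∀ σ, 0 ≤ μ σ) ∧ v = ∑ σ, μ σ • g σ ∧
      ∀ σ, μ σ • g σ ∈ Set.uIcc 0 v := by
  classical
  have := Fintype.ofFinite J
  induction hcard : (Finset.univ.filter fun j => v j ≠ 0).card using Nat.strong_induction_on
    generalizing v with
  | _ n ih =>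
  by_cases hv0 : v = 0
  · exact ⟨0, by simp, by simp [hv0], by simp⟩
  set σ₀ : J → SignType := fun j => SignType.sign (v j)
  obtain ⟨c, hc, hmem, i, hvi, hi⟩ := exists_sub_smul_mem_uIcc (hg.sign_eq v hv) hv0
  set w := v - c • g σ₀ with hw
  have hsupport : (Finset.univ.filter fun j => w j ≠ 0) ⊂ Finset.univ.filter fun j => v j ≠ 0 := by
    refine (Finset.ssubset_iff_of_subset fun j => ?_).2 ⟨i, by simp [hvi], by simp [hi]⟩
    simp only [Finset.mem_filter_univ]
    rintro hwj hvj
    exact hwj (by simpa [hvj] using mem_uIcc_pi.1 hmem j)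
  obtain ⟨μ, hμ, hsum, hconf⟩ := ih _ (hcard ▸ Finset.card_lt_card hsupport)
    (W.sub_mem hv (W.smul_mem c (hg.mem σ₀))) rfl
  refine ⟨μ + Pi.single σ₀ c, fun σ => ?_, ?_, fun σ => ?_⟩
  · have hsingle : 0 ≤ (Pi.single σ₀ c : (J → SignType) → 𝕜) := Pi.single_nonneg.2 hc
    exact add_nonneg (hμ σ) (hsingle σ)
  · simp only [Pi.add_apply, add_smul, Finset.sum_add_distrib, ← hsum, Pi.single_apply, ite_smul,
      zero_smul, Finset.sum_ite_eq', Finset.mem_univ, if_true, sub_add_cancel]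
  · have hw_sub : c • g σ₀ = v - w := by rw [hw, sub_sub_cancel]
    refine mem_uIcc_pi.2 fun j => ?_
    have hσj := mem_uIcc_pi.1 (hconf σ) j
    have hwj := mem_uIcc_pi.1 hmem j
    rw [Pi.add_apply, add_smul]
    by_cases hσ : σ = σ₀
    · rw [hσ, Pi.single_eq_same, hw_sub]
      exact add_sub_mem_uIcc (hσ ▸ hσj) hwj
    · rw [Pi.single_eq_of_ne hσ, zero_smul, add_zero]
      exact Set.uIcc_subset_uIcc Set.left_mem_uIcc hwj hσj

end Conformal

section IntegerKernel

open Matrix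

variable {J R : Type*}

theorem exists_linearIndependent_rat_combination [Finite J] (v : J → ℝ) :
    ∃ (n : ℕ) (e : Fin n → ℝ) (q : Fin n → J → ℚ), LinearIndependent ℚ e ∧
      ∀ j, v j = ∑ i, q i j • e i := by
  let W : Submodule ℚ ℝ := Submodule.span ℚ (Set.range v)
  have : FiniteDimensional ℚ W := FiniteDimensional.span_of_finite ℚ (Set.finite_range v)
  let e := Module.finBasis ℚ W
  let vW (j : J) : W := ⟨v j, Submodule.subset_span ⟨j, rfl⟩⟩
  refine ⟨_, fun i => e i, fun i j => e.repr (vW j) i,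
    e.linearIndependent.map' W.subtype W.ker_subtype, fun j => ?_⟩
  have hj := congrArg Subtype.val (e.sum_repr (vW j))
  rw [AddSubmonoidClass.coe_finsetSum] at hj
  exact hj.symm

theorem eventually_sign_eq {X : Type*} [TopologicalSpace X] {f : X → ℝ} {x : X}
    (hf : ContinuousAt f x) (hx : f x ≠ 0) :
    ∀ᶠ y in 𝓝 x, SignType.sign (f y) = SignType.sign (f x) := by
  rcases hx.lt_or_gt with h | h
  · filter_upwards [hf.eventually (gt_mem_nhds h)] with y hy
    rw [sign_neg h, sign_neg hy]
  · filter_upwards [hf.eventually (lt_mem_nhds h)] with y hy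
    rw [sign_pos h, sign_pos hy]

/-- Expand the entries of `v` in a `ℚ`-basis of their span and replace that basis by a close
rational vector: rational relations between the entries, and their signs, are preserved. -/
theorem exists_rat_kernel_sign_eq [Fintype J] {T : Matrix R J ℚ} {v : J → ℝ}
    (hv : T.map ((↑) : ℚ → ℝ) *ᵥ v = 0) :
    ∃ u : J → ℚ, T *ᵥ u = 0 ∧ ∀ j, SignType.sign (u j) = SignType.sign (v j) := by
  obtain ⟨n, e, q, he, hve⟩ := exists_linearIndependent_rat_combination v
  rw [Fintype.linearIndependent_iff] at he
  have hq_zero : ∀ j, v j = 0 → ∀ i, q i j = 0 := fun j hj => he _ (by rw [← hve, hj])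
  have hq_ker : ∀ i, T *ᵥ q i = 0 := by
    intro i
    ext r
    refine he (fun i => (T *ᵥ q i) r) ?_ i
    calc ∑ i, (T *ᵥ q i) r • e i = ∑ j, T r j • ∑ i, q i j • e i := by
          simp only [mulVec, dotProduct, Finset.sum_smul, Finset.smul_sum, mul_smul]
          exact Finset.sum_comm
      _ = (T.map ((↑) : ℚ → ℝ) *ᵥ v) r := by
          simp_rw [← hve]
          simp only [Rat.smul_def, mulVec, dotProduct, map_apply]
      _ = 0 := congrFun hv r
  have hsign : ∀ᶠ a : Fin n → ℝ in 𝓝 e, ∀ j,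
      SignType.sign (∑ i, q i j • a i) = SignType.sign (v j) := by
    refine eventually_all.2 fun j => ?_
    by_cases hj : v j = 0
    · simp [hq_zero j hj, hj]
    · rw [hve j] at hj ⊢
      exact eventually_sign_eq (f := fun a : Fin n → ℝ => ∑ i, q i j • a i)
        (Continuous.continuousAt (by simp only [Rat.smul_def]; fun_prop)) hj
  have hdense : DenseRange fun (a : Fin n → ℚ) i => (a i : ℝ) :=
    DenseRange.piMap fun _ => Rat.denseRange_cast
  obtain ⟨a, ha⟩ := hdense.exists_mem_open isOpen_interior
    ⟨e, mem_interior_iff_mem_nhds.2 hsign⟩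
  refine ⟨∑ i, a i • q i, by simp [mulVec_sum, mulVec_smul, hq_ker], fun j => ?_⟩
  rw [← interior_subset ha j]
  have hcast : ∑ i, q i j • (a i : ℝ) = ((∑ i, a i • q i) j : ℚ) := by
    simp [Finset.sum_apply, Rat.smul_def, mul_comm]
  rw [hcast]
  rcases lt_trichotomy ((∑ i, a i • q i) j) 0 with h | h | h
  · rw [sign_neg h, sign_neg (by exact_mod_cast h)]
  · simp [h]
  · rw [sign_pos h, sign_pos (by exact_mod_cast h)]

theorem exists_common_denominator [Finite J] (q : J → ℚ) :
    ∃ N : ℕ, 0 < N ∧ ∃ z : J → ℤ, ∀ j, (z j : ℚ) = N * q j := by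
  have := Fintype.ofFinite J
  have hz (j : J) : ∃ z : ℤ, (z : ℚ) = (∏ i, (q i).den : ℕ) * q j := by
    obtain ⟨m, hm⟩ := Finset.dvd_prod_of_mem (fun i => (q i).den) (Finset.mem_univ j)
    refine ⟨m * (q j).num, ?_⟩
    rw [hm]
    push_cast
    linear_combination -(m : ℚ) * Rat.mul_den_eq_num (q j)
  choose z hz using hz
  exact ⟨_, Finset.prod_pos fun i _ => (q i).den_pos, z, hz⟩

theorem exists_int_kernel_sign_eq [Fintype J] {T : Matrix R J ℤ} {v : J → ℝ}
    (hv : T.map ((↑) : ℤ → ℝ) *ᵥ v = 0) :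
    ∃ u : J → ℤ, T *ᵥ u = 0 ∧ ∀ j, SignType.sign (u j) = SignType.sign (v j) := by
  obtain ⟨u, hu, hsign⟩ := exists_rat_kernel_sign_eq (T := T.map ((↑) : ℤ → ℚ)) (v := v)
    (by simpa [Matrix.map_map, Function.comp_def] using hv)
  obtain ⟨N, hN, z, hz⟩ := exists_common_denominator u
  refine ⟨z, ?_, fun j => ?_⟩
  · have hz' : (fun j => (z j : ℚ)) = (N : ℚ) • u := funext hz
    have hTz : T.map ((↑) : ℤ → ℚ) *ᵥ (fun j => (z j : ℚ)) = 0 := by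
      rw [hz', mulVec_smul, hu, smul_zero]
    ext r
    have hr := congrFun hTz r
    simp only [mulVec, dotProduct, map_apply, Pi.zero_apply] at hr ⊢
    exact_mod_cast hr
  · rw [← hsign j, ← sign_intCast (α := ℚ), hz j, sign_mul, sign_pos (by exact_mod_cast hN),
      one_mul]

theorem exists_int_isSignRepresentative [Fintype J] (T : Matrix R J ℤ) :
    ∃ g : (J → SignType) → J → ℤ, IsSignRepresentative
      (LinearMap.ker (T.map ((↑) : ℤ → ℝ)).mulVecLin) fun σ j => (g σ j : ℝ) := by
  obtain ⟨g, hg⟩ := exists_isSignRepresentative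
    (LinearMap.ker (T.map ((↑) : ℤ → ℝ)).mulVecLin)
  choose u hu hsign using fun σ => exists_int_kernel_sign_eq (hg.mem σ)
  refine ⟨u, fun σ => ?_, fun v hv j => ?_⟩
  · ext r
    have hr := congrFun (hu σ) r
    simp only [mulVecLin_apply, mulVec, dotProduct, map_apply, Pi.zero_apply] at hr ⊢
    exact_mod_cast hr
  · rw [sign_intCast, hsign, hg.sign_eq v hv]

end IntegerKernel

section Hoffman

open Matrix

variable {J R κ : Type*}

theorem mul_mem_uIcc_zero_mul {μ ν a : ℝ} (hν : 0 ≤ ν) (hνμ : ν ≤ μ) :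
    ν * a ∈ Set.uIcc 0 (μ * a) := by
  rcases le_total 0 a with ha | ha
  · exact Set.mem_uIcc.2 (.inl ⟨mul_nonneg hν ha, mul_le_mul_of_nonneg_right hνμ ha⟩)
  · exact Set.mem_uIcc.2 (.inr ⟨mul_le_mul_of_nonpos_right hνμ ha,
      mul_nonpos_of_nonneg_of_nonpos hν ha⟩)

theorem abs_le_abs_of_mem_uIcc_zero {a b : ℝ} (h : a ∈ Set.uIcc 0 b) : |a| ≤ |b| := by
  simpa using Set.abs_sub_left_of_mem_uIcc h

/-- Lowering the coefficients of a conformal sum moves each coordinate at most as far, and in the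
same direction, as the full sum. -/
theorem add_sum_smul_nonneg [Fintype κ] {μ ν : κ → ℝ} {u : κ → J → ℝ} {z v : J → ℝ}
    (hv : v = ∑ k, μ k • u k) (hconf : ∀ k, μ k • u k ∈ Set.uIcc 0 v)
    (hν : ∀ k, 0 ≤ ν k) (hνμ : ∀ k, ν k ≤ μ k) (hz : 0 ≤ z) (hzv : 0 ≤ z + v) :
    0 ≤ z + ∑ k, ν k • u k := by
  intro j
  have hνu (k) : ν k * u k j ∈ Set.uIcc 0 (μ k * u k j) := mul_mem_uIcc_zero_mul (hν k) (hνμ k)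
  have hμu (k) : μ k * u k j ∈ Set.uIcc 0 (v j) := mem_uIcc_pi.1 (hconf k) j
  have hvj : v j = ∑ k, μ k * u k j := by simp [congrFun hv j]
  have hzj : 0 ≤ z j := hz j
  have hzvj : 0 ≤ z j + v j := hzv j
  simp only [Pi.add_apply, Finset.sum_apply, Pi.smul_apply, smul_eq_mul, Pi.zero_apply]
  simp only [Set.mem_uIcc] at hνu hμu
  rcases le_total 0 (v j) with h | h
  · exact add_nonneg hzj (Finset.sum_nonneg fun k _ => by grind)
  · have hsum : ∑ k, μ k * u k j ≤ ∑ k, ν k * u k j := Finset.sum_le_sum fun k _ => by grind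
    linarith

variable [Fintype R]

theorem le_sum_inv_mul_norm {μ : ℝ} {u Δ : R → ℝ} (hμ : 0 ≤ μ) (hconf : μ • u ∈ Set.uIcc 0 Δ)
    (hu : u ≠ 0) : μ ≤ (∑ r, |u r|⁻¹) * ‖Δ‖ := by
  obtain ⟨r, hr⟩ := Function.ne_iff.1 hu
  have hur : 0 < |u r| := abs_pos.2 hr
  have hle : |μ * u r| ≤ |Δ r| := abs_le_abs_of_mem_uIcc_zero (mem_uIcc_pi.1 hconf r)
  rw [abs_mul, abs_of_nonneg hμ] at hle
  calc μ ≤ |u r|⁻¹ * |Δ r| := by rwa [← div_eq_inv_mul, le_div_iff₀ hur]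
    _ ≤ (∑ r, |u r|⁻¹) * ‖Δ‖ := by
        gcongr
        · exact Finset.single_le_sum (f := fun r => |u r|⁻¹) (by simp) (Finset.mem_univ r)
        · exact norm_le_pi_norm Δ r

/-- Round a coefficient down along a kernel vector (`u = 0`), drop it otherwise. -/
theorem exists_rounded_coefficient {ρ : ℝ → ℝ} {ε μ : ℝ} {u Δ : R → ℝ}
    (hρ : ∀ t, 0 ≤ t → 0 ≤ ρ t ∧ ρ t ≤ t ∧ t - ρ t ≤ ε) (hμ : 0 ≤ μ)
    (hconf : μ • u ∈ Set.uIcc 0 Δ) :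
    ∃ ν ∈ Set.range ρ, 0 ≤ ν ∧ ν ≤ μ ∧ ν • u = 0 ∧
      μ - ν ≤ (1 + ∑ r, |u r|⁻¹) * (ε + ‖Δ‖) := by
  have hρ0 : ρ 0 = 0 := le_antisymm (hρ 0 le_rfl).2.1 (hρ 0 le_rfl).1
  have hε : 0 ≤ ε := by linarith [hρ 0 le_rfl]
  have hC : 0 ≤ ∑ r, |u r|⁻¹ := by positivity
  have hΔ := norm_nonneg Δ
  by_cases hu : u = 0
  · obtain ⟨h0, hle, hsub⟩ := hρ μ hμ
    refine ⟨ρ μ, ⟨μ, rfl⟩, h0, hle, by simp [hu], ?_⟩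
    nlinarith
  · refine ⟨0, ⟨0, hρ0⟩, le_rfl, hμ, by simp, ?_⟩
    nlinarith [le_sum_inv_mul_norm hμ hconf hu]

variable [Fintype J]

/-- The Hoffman error bound for `T x = T z`, `0 ≤ x`, with the coefficients of the correction
rounded down by `ρ`: `y - z` and `T (y - z)` together decompose conformally over the kernel of
`[T | -1]`, and only the terms along the kernel of `T` are kept. -/
theorem IsSignRepresentative.exists_rounded_hoffman_bound [DecidableEq R]
    [Fintype (J ⊕ R → SignType)] {T : Matrix R J ℝ} {g : (J ⊕ R → SignType) → J ⊕ R → ℝ}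
    (hg : IsSignRepresentative (LinearMap.ker (fromCols T (-1)).mulVecLin) g) :
    ∃ K, ∀ (ρ : ℝ → ℝ) (ε : ℝ), (∀ t, 0 ≤ t → 0 ≤ ρ t ∧ ρ t ≤ t ∧ t - ρ t ≤ ε) →
      ∀ y z : J → ℝ, 0 ≤ y → 0 ≤ z → ∃ ν : (J ⊕ R → SignType) → ℝ,
        (∀ k, ν k ∈ Set.range ρ) ∧ 0 ≤ z + ∑ k, ν k • (g k ∘ Sum.inl) ∧
        T *ᵥ (z + ∑ k, ν k • (g k ∘ Sum.inl)) = T *ᵥ z ∧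
        ‖z + ∑ k, ν k • (g k ∘ Sum.inl) - y‖ ≤ K * (ε + ‖T *ᵥ y - T *ᵥ z‖) := by
  classical
  have hTg (k) : T *ᵥ (g k ∘ Sum.inl) = g k ∘ Sum.inr := by
    have hk : fromCols T (-1) *ᵥ g k = 0 := hg.mem k
    rwa [fromCols_mulVec, neg_mulVec, one_mulVec, ← sub_eq_add_neg, sub_eq_zero] at hk
  refine ⟨∑ k, (1 + ∑ r, |(g k ∘ Sum.inr) r|⁻¹) * ‖g k ∘ Sum.inl‖, fun ρ ε hρ y z hy hz => ?_⟩
  have hker : Sum.elim (y - z) (T *ᵥ y - T *ᵥ z) ∈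
      LinearMap.ker (fromCols T (-1)).mulVecLin := by
    simp [fromCols_mulVec, neg_mulVec, mulVec_sub]
  obtain ⟨μ, hμ, hsum, hconf⟩ := hg.exists_conformal_sum hker
  have hyz : y - z = ∑ k, μ k • (g k ∘ Sum.inl) := by
    ext j
    simpa using congrFun hsum (.inl j)
  choose ν hν_range hν hνμ hν_inr hν_sub using fun k =>
    exists_rounded_coefficient (u := g k ∘ Sum.inr) hρ (hμ k)
      (mem_uIcc_pi.2 fun r => mem_uIcc_pi.1 (hconf k) (.inr r))
  refine ⟨ν, hν_range, ?_, ?_, ?_⟩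
  · exact add_sum_smul_nonneg hyz
      (fun k => mem_uIcc_pi.2 fun j => mem_uIcc_pi.1 (hconf k) (.inl j)) hν hνμ hz
      (by simpa using hy)
  · simp [mulVec_add, mulVec_sum, mulVec_smul, hTg, hν_inr]
  · have hdiff : z + ∑ k, ν k • (g k ∘ Sum.inl) - y =
        ∑ k, (ν k - μ k) • (g k ∘ Sum.inl) := by
      simp only [sub_smul, Finset.sum_sub_distrib, ← hyz]
      abel
    rw [hdiff, Finset.sum_mul]
    refine (norm_sum_le _ _).trans (Finset.sum_le_sum fun k _ => ?_)
    rw [norm_smul, norm_sub_rev, Real.norm_of_nonneg (sub_nonneg.2 (hνμ k)), mul_right_comm]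
    exact mul_le_mul_of_nonneg_right (hν_sub k) (norm_nonneg _)

theorem exists_hoffman_bound (T : Matrix R J ℝ) :
    ∃ K, ∀ y z : J → ℝ, 0 ≤ y → 0 ≤ z →
      ∃ x, 0 ≤ x ∧ T *ᵥ x = T *ᵥ z ∧ ‖x - y‖ ≤ K * ‖T *ᵥ y - T *ᵥ z‖ := by
  classical
  obtain ⟨g, hg⟩ := exists_isSignRepresentative
    (LinearMap.ker (fromCols T (-1 : Matrix R R ℝ)).mulVecLin)
  obtain ⟨K, hK⟩ := hg.exists_rounded_hoffman_bound
  refine ⟨K, fun y z hy hz => ?_⟩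
  obtain ⟨ν, -, hx, hTx, hxy⟩ := hK id 0 (fun t ht => by simp [ht]) y z hy hz
  exact ⟨_, hx, hTx, by simpa using hxy⟩

theorem exists_nat_hoffman_bound (T : Matrix R J ℤ) :
    ∃ K, ∀ (y : J → ℝ) (z : J → ℕ), 0 ≤ y →
      ∃ x : J → ℕ, T.map ((↑) : ℤ → ℝ) *ᵥ (fun j => (x j : ℝ)) =
          T.map ((↑) : ℤ → ℝ) *ᵥ (fun j => (z j : ℝ)) ∧
        ‖(fun j => (x j : ℝ)) - y‖ ≤
          K * (1 + ‖T.map ((↑) : ℤ → ℝ) *ᵥ y - T.map ((↑) : ℤ → ℝ) *ᵥ fun j => (z j : ℝ)‖) := by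
  classical
  obtain ⟨g, hg⟩ := exists_int_isSignRepresentative (fromCols T (-1 : Matrix R R ℤ))
  have hmap : (fromCols T (-1 : Matrix R R ℤ)).map ((↑) : ℤ → ℝ) =
      fromCols (T.map ((↑) : ℤ → ℝ)) (-1) := by
    ext r (j | r')
    · simp
    · by_cases h : r = r' <;> simp [h]
  rw [hmap] at hg
  obtain ⟨K, hK⟩ := hg.exists_rounded_hoffman_bound
  refine ⟨K, fun y z hy => ?_⟩
  obtain ⟨ν, hν, hx, hTx, hxy⟩ := hK (fun t => (⌊t⌋ : ℝ)) 1
    (fun t ht => ⟨by exact_mod_cast Int.floor_nonneg.2 ht, Int.floor_le t,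
      by linarith [Int.lt_floor_add_one t]⟩) y (fun j => z j) hy (fun j => Nat.cast_nonneg _)
  choose t ht using hν
  have hinteger (j) : ∃ m : ℕ, (m : ℝ) = z j + ∑ k, ν k * g k (.inl j) := by
    have hj : 0 ≤ (z j : ℝ) + ∑ k, ν k * g k (.inl j) := by simpa using hx j
    simp only [← ht] at hj ⊢
    obtain ⟨m, hm⟩ := Int.eq_ofNat_of_zero_le
      (show (0 : ℤ) ≤ (z j : ℤ) + ∑ k, ⌊t k⌋ * g k (.inl j) by exact_mod_cast hj)
    exact ⟨m, by exact_mod_cast hm.symm⟩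
  choose x hx using hinteger
  have hxz : (fun j => (x j : ℝ)) =
      (fun j => (z j : ℝ)) + ∑ k, ν k • ((fun j => (g k j : ℝ)) ∘ Sum.inl) := by
    ext j
    simp [hx]
  exact ⟨x, hxz ▸ hTx, hxz ▸ hxy⟩

end Hoffman

noncomputable section OptimalValue

open Matrix

variable {J R : Type*} [Fintype J]

/-- The polyhedron of the nonnegative solutions `x` of `T x = c`. -/
def stdPolyhedron (T : Matrix R J ℝ) (c : R → ℝ) : Set (J → ℝ) :=
  {x | 0 ≤ x ∧ T *ᵥ x = c}

/-- The optimal value of the objective `F` over the polyhedron `T x = c`, `0 ≤ x`, as a function of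
the right-hand side `c`. -/
def optimalValue (T : Matrix R J ℝ) (F : (J → ℝ) → ℝ) (c : R → ℝ) : ℝ :=
  sSup (F '' stdPolyhedron T c)

theorem isClosed_stdPolyhedron (T : Matrix R J ℝ) (c : R → ℝ) : IsClosed (stdPolyhedron T c) :=
  isClosed_Ici.inter (isClosed_eq (by fun_prop) continuous_const)

variable {T : Matrix R J ℝ} {F : (J → ℝ) → ℝ} {c c' : R → ℝ} {M x : J → ℝ}

theorem isCompact_stdPolyhedron (hM : stdPolyhedron T c ⊆ Set.Iic M) :
    IsCompact (stdPolyhedron T c) :=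
  isCompact_Icc.of_isClosed_subset (isClosed_stdPolyhedron T c) fun _ hx => ⟨hx.1, hM hx⟩

theorem le_optimalValue (hF : Continuous F) (hM : stdPolyhedron T c ⊆ Set.Iic M)
    (hx : x ∈ stdPolyhedron T c) : F x ≤ optimalValue T F c :=
  le_csSup ((isCompact_stdPolyhedron hM).image hF).bddAbove ⟨x, hx, rfl⟩

theorem exists_eq_optimalValue (hF : Continuous F) (hM : stdPolyhedron T c ⊆ Set.Iic M)
    (hne : (stdPolyhedron T c).Nonempty) : ∃ x ∈ stdPolyhedron T c, F x = optimalValue T F c :=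
  ((isCompact_stdPolyhedron hM).image hF).sSup_mem (hne.image F)

theorem optimalValue_eq (hx : x ∈ stdPolyhedron T c) (hmax : IsMaxOn F (stdPolyhedron T c) x) :
    optimalValue T F c = F x :=
  IsGreatest.csSup_eq ⟨⟨x, hx, rfl⟩, Set.forall_mem_image.2 fun _ hy => hmax hy⟩

/-- By the Hoffman bound, a maximizer for `c` is close to a point of the polyhedron of `c'`. -/
theorem exists_forall_optimalValue_lt [Fintype R] (T : Matrix R J ℝ) (hF : Continuous F)
    (M : J → ℝ) {ε : ℝ} (hε : 0 < ε) :
    ∃ δ > 0, ∀ c c', stdPolyhedron T c ⊆ Set.Iic M → stdPolyhedron T c' ⊆ Set.Iic M →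
      (stdPolyhedron T c).Nonempty → (stdPolyhedron T c').Nonempty → dist c c' < δ →
        optimalValue T F c < optimalValue T F c' + ε := by
  obtain ⟨K, hK⟩ := exists_hoffman_bound T
  obtain ⟨η, hη, hFη⟩ := Metric.uniformContinuousOn_iff.1
    ((isCompact_Icc (a := 0) (b := M)).uniformContinuousOn_of_continuous hF.continuousOn) ε hε
  refine ⟨η / (|K| + 1), by positivity, fun c c' hM hM' hne ⟨z, hz⟩ hcc => ?_⟩
  obtain ⟨y, hy, hyv⟩ := exists_eq_optimalValue hF hM hne
  obtain ⟨x, hx, hTx, hxy⟩ := hK y z hy.1 hz.1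
  have hxc : x ∈ stdPolyhedron T c' := ⟨hx, hTx.trans hz.2⟩
  rw [hy.2, hz.2, ← dist_eq_norm, ← dist_eq_norm] at hxy
  have hyx : dist y x < η := by
    rw [dist_comm]
    calc dist x y ≤ (|K| + 1) * dist c c' :=
          hxy.trans (mul_le_mul_of_nonneg_right (by linarith [le_abs_self K]) dist_nonneg)
      _ < η := by rwa [mul_comm, ← lt_div_iff₀ (by positivity)]
  have hFyx := hFη y ⟨hy.1, hM hy⟩ x ⟨hx, hM' hxc⟩ hyx
  rw [Real.dist_eq] at hFyx
  linarith [(abs_lt.1 hFyx).2, le_optimalValue hF hM' hxc]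

theorem continuousOn_optimalValue [Finite R] (hF : Continuous F) {s : Set (R → ℝ)}
    (hM : ∀ c ∈ s, stdPolyhedron T c ⊆ Set.Iic M) (hne : ∀ c ∈ s, (stdPolyhedron T c).Nonempty) :
    ContinuousOn (optimalValue T F) s := by
  have := Fintype.ofFinite R
  refine Metric.continuousOn_iff.2 fun c hc ε hε => ?_
  obtain ⟨δ, hδ, h⟩ := exists_forall_optimalValue_lt T hF M hε
  refine ⟨δ, hδ, fun c' hc' hcc => ?_⟩
  rw [Real.dist_eq, abs_lt]
  constructor
  · linarith [h c c' (hM c hc) (hM c' hc') (hne c hc) (hne c' hc') (by rwa [dist_comm])]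
  · linarith [h c' c (hM c' hc') (hM c hc) (hne c' hc') (hne c hc) hcc]

theorem smul_add_smul_mem_stdPolyhedron {x' : J → ℝ} {a a' : ℝ} (hx : x ∈ stdPolyhedron T c)
    (hx' : x' ∈ stdPolyhedron T c') (ha : 0 ≤ a) (ha' : 0 ≤ a') :
    a • x + a' • x' ∈ stdPolyhedron T (a • c + a' • c') :=
  ⟨add_nonneg (smul_nonneg ha hx.1) (smul_nonneg ha' hx'.1), by
    rw [mulVec_add, mulVec_smul, mulVec_smul, hx.2, hx'.2]⟩

theorem convex_stdPolyhedron (T : Matrix R J ℝ) (c : R → ℝ) : Convex ℝ (stdPolyhedron T c) := by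
  intro x hx y hy a b ha hb hab
  simpa only [← add_smul, hab, one_smul] using smul_add_smul_mem_stdPolyhedron hx hy ha hb

theorem exists_pos_mem_stdPolyhedron_of_mem_openSegment {b : R → ℝ} (hx : x ∈ stdPolyhedron T c)
    (hx_pos : ∀ j, 0 < x j) (hne : (stdPolyhedron T c').Nonempty) (hb : b ∈ openSegment ℝ c c') :
    ∃ y ∈ stdPolyhedron T b, ∀ j, 0 < y j := by
  obtain ⟨x', hx'⟩ := hne
  obtain ⟨θ, θ', hθ, hθ', -, rfl⟩ := hb
  exact ⟨_, smul_add_smul_mem_stdPolyhedron hx hx' hθ.le hθ'.le, fun j =>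
    add_pos_of_pos_of_nonneg (mul_pos hθ (hx_pos j)) (mul_nonneg hθ'.le (hx'.1 j))⟩

theorem convex_setOf_stdPolyhedron_nonempty (T : Matrix R J ℝ) :
    Convex ℝ {c | (stdPolyhedron T c).Nonempty} := by
  rintro c ⟨x, hx⟩ c' ⟨x', hx'⟩ θ θ' hθ hθ' -
  exact ⟨_, smul_add_smul_mem_stdPolyhedron hx hx' hθ hθ'⟩

end OptimalValue

noncomputable section Entropy

open Matrix

variable {S R : Type*} [Fintype S]

/-- The exponential growth rate of the number of sequences whose type is proportional to `x`, each
symbol `s` being available in `c s` variants. -/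
def weightedEntropy (c x : S → ℝ) : ℝ :=
  ∑ s, (Real.negMulLog (x s) + x s * Real.log (c s)) - Real.negMulLog (∑ s, x s)

theorem continuous_weightedEntropy (c : S → ℝ) : Continuous (weightedEntropy c) := by
  have := Real.continuous_negMulLog
  unfold weightedEntropy
  fun_prop

theorem negMulLog_add_mul_log_le {x r : ℝ} (hx : 0 ≤ x) (hr : 0 < r) :
    Real.negMulLog x + x * Real.log r ≤ r - x := by
  rcases hx.eq_or_lt with rfl | hx
  · simpa using hr.le
  · have h := mul_le_mul_of_nonneg_left (Real.log_le_sub_one_of_pos (div_pos hr hx)) hx.le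
    rw [Real.log_div hr.ne' hx.ne', mul_sub_one, mul_div_cancel₀ _ hx.ne'] at h
    rw [Real.negMulLog]
    linarith

section Positivity

variable {c x y : S → ℝ}

/-- The growth is at least `-m ε log ε` because `-t log t` has infinite slope at `0`. -/
theorem weightedEntropy_add_le_convexCombination (hx : 0 ≤ x) (hy : ∀ s, 0 < y s)
    (hsum : ∑ s, x s = ∑ s, y s) {ε : ℝ} (hε : ε ∈ Set.Ioo (0 : ℝ) 1) :
    weightedEntropy c x + ε * (weightedEntropy c y - weightedEntropy c x -
        Real.log ε * ∑ s with x s = 0, y s) ≤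
      weightedEntropy c ((1 - ε) • x + ε • y) := by
  have hmass : ∑ s, ((1 - ε) * x s + ε * y s) = ∑ s, x s := by
    rw [Finset.sum_add_distrib, ← Finset.mul_sum, ← Finset.mul_sum, ← hsum]
    ring
  have hterm (s) : (1 - ε) * (Real.negMulLog (x s) + x s * Real.log (c s)) +
      ε * (Real.negMulLog (y s) + y s * Real.log (c s)) +
        -(ε * Real.log ε) * (if x s = 0 then y s else 0) ≤
      Real.negMulLog ((1 - ε) * x s + ε * y s) + ((1 - ε) * x s + ε * y s) * Real.log (c s) := by
    split_ifs with hxs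
    · rw [hxs, mul_zero, zero_add, Real.negMulLog_mul, Real.negMulLog_zero,
        Real.negMulLog_def]
      apply le_of_eq
      ring
    · have hconc := Real.concaveOn_negMulLog.2 (Set.mem_Ici.2 (hx s)) (Set.mem_Ici.2 (hy s).le)
        (sub_nonneg.2 hε.2.le) hε.1.le (by ring)
      simp only [smul_eq_mul] at hconc
      linarith
  have hsum_le := Finset.sum_le_sum fun s (_ : s ∈ Finset.univ) => hterm s
  rw [Finset.sum_add_distrib, Finset.sum_add_distrib, ← Finset.mul_sum, ← Finset.mul_sum,
    ← Finset.mul_sum, ← Finset.sum_filter] at hsum_le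
  simp only [weightedEntropy, Pi.add_apply, Pi.smul_apply, smul_eq_mul, hmass, ← hsum]
  linarith

theorem pos_of_isMaxOn_weightedEntropy {K : Set (S → ℝ)} (hK : Convex ℝ K)
    (hmax : IsMaxOn (weightedEntropy c) K x) (hxK : x ∈ K) (hyK : y ∈ K) (hx : 0 ≤ x)
    (hy : ∀ s, 0 < y s) (hsum : ∑ s, x s = ∑ s, y s) (s : S) : 0 < x s := by
  by_contra hs
  set m := ∑ s with x s = 0, y s
  have hm : 0 < m := Finset.sum_pos (fun i _ => hy i)
    ⟨s, by simpa using le_antisymm (not_lt.1 hs) (hx s)⟩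
  set C := |weightedEntropy c x - weightedEntropy c y|
  set ε := Real.exp (-((C + 1) / m)) with hε
  have hexp : 0 < (C + 1) / m := by positivity
  have hε01 : ε ∈ Set.Ioo (0 : ℝ) 1 :=
    ⟨Real.exp_pos _, Real.exp_lt_one_iff.2 (neg_lt_zero.2 hexp)⟩
  have hlog : Real.log ε * m = -(C + 1) := by
    rw [hε, Real.log_exp, neg_mul, div_mul_cancel₀ _ hm.ne']
  have hle := (weightedEntropy_add_le_convexCombination hx hy hsum hε01).trans
    (hmax (hK hxK hyK (sub_nonneg.2 hε01.2.le) hε01.1.le (by ring)))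
  rw [hlog] at hle
  have hpos : 0 < weightedEntropy c y - weightedEntropy c x - -(C + 1) := by
    linarith [le_abs_self (weightedEntropy c x - weightedEntropy c y)]
  linarith [mul_pos hε01.1 hpos]

end Positivity

section Stationarity

variable {c x v : S → ℝ}

theorem hasDerivAt_weightedEntropy_add_smul (hx : ∀ s, 0 < x s) (hv : ∑ s, v s = 0) :
    HasDerivAt (fun t : ℝ => weightedEntropy c (x + t • v))
      (∑ s, v s * (Real.log (c s) - Real.log (x s))) 0 := by
  have hmass (t : ℝ) : ∑ s, (x s + t * v s) = ∑ s, x s := by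
    rw [Finset.sum_add_distrib, ← Finset.mul_sum, hv, mul_zero, add_zero]
  have hderiv : HasDerivAt (fun t : ℝ => weightedEntropy c (x + t • v))
      (∑ s, ((-Real.log (x s) - 1) * v s + v s * Real.log (c s)) - 0) 0 := by
    simp only [weightedEntropy, Pi.add_apply, Pi.smul_apply, smul_eq_mul, hmass]
    refine (HasDerivAt.fun_sum fun s _ => ?_).sub (hasDerivAt_const _ _)
    have hline : HasDerivAt (fun t : ℝ => x s + t * v s) (v s) 0 := by
      simpa using ((hasDerivAt_id (0 : ℝ)).mul_const (v s)).const_add (x s)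
    have hlog : HasDerivAt Real.negMulLog (-Real.log (x s) - 1) (x s + 0 * v s) := by
      simpa using Real.hasDerivAt_negMulLog (hx s).ne'
    exact (hlog.comp (0 : ℝ) hline).add (hline.mul_const _)
  convert hderiv using 1
  rw [sub_zero, eq_comm, ← sub_eq_zero, ← Finset.sum_sub_distrib, ← neg_eq_zero.2 hv,
    ← Finset.sum_neg_distrib]
  exact Finset.sum_congr rfl fun s _ => by ring

theorem eventually_add_smul_pos {S : Type*} [Finite S] {x v : S → ℝ} (hx : ∀ s, 0 < x s) :
    ∀ᶠ t : ℝ in 𝓝 0, ∀ s, 0 < (x + t • v) s := by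
  refine eventually_all.2 fun s => ?_
  have hcont : Continuous fun t : ℝ => (x + t • v) s := by
    simp only [Pi.add_apply, Pi.smul_apply]
    fun_prop
  exact (hcont.tendsto' 0 (x s) (by simp)).eventually (lt_mem_nhds (hx s))

theorem exists_vecMul_eq_of_forall_ker [Fintype R] {T : Matrix R S ℝ} {w : S → ℝ}
    (hw : ∀ v, T *ᵥ v = 0 → w ⬝ᵥ v = 0) : ∃ g, g ᵥ* T = w := by
  let dot (w : S → ℝ) : (S → ℝ) →ₗ[ℝ] ℝ := dotProductBilin ℝ ℝ w
  have hspan : dot w ∈ Submodule.span ℝ (Set.range fun r => dot (T r)) :=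
    mem_span_of_iInf_ker_le_ker fun v hv => hw v (funext fun r => (Submodule.mem_iInf _).1 hv r)
  obtain ⟨g, hg⟩ := (Submodule.mem_span_range_iff_exists_fun ℝ).1 hspan
  classical
  refine ⟨g, funext fun s => ?_⟩
  have hs := congrArg (fun f : (S → ℝ) →ₗ[ℝ] ℝ => f (Pi.single s 1)) hg
  simpa [dot, vecMul, dotProduct, Pi.single_apply] using hs

end Stationarity

section ExponentialFamily

variable {c x : S → ℝ} {T : Matrix R S ℝ} {r₀ : R} {b : R → ℝ} {g g' : R → ℝ}

theorem sum_eq_of_mem_stdPolyhedron (hmass : ∀ s, T r₀ s = 1) (hx : x ∈ stdPolyhedron T b) :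
    ∑ s, x s = b r₀ := by
  simpa [mulVec, dotProduct, hmass] using congrFun hx.2 r₀

theorem stdPolyhedron_subset_Iic (hmass : ∀ s, T r₀ s = 1) :
    stdPolyhedron T b ⊆ Set.Iic fun _ => b r₀ := fun _ hx s =>
  sum_eq_of_mem_stdPolyhedron hmass hx ▸
    Finset.single_le_sum (fun s _ => hx.1 s) (Finset.mem_univ s)

variable [Fintype R]

/-- The member with natural parameter `g` of the exponential family with base weights `c` and
sufficient statistics the rows of `T`; it is not normalized, the total mass being one of the
statistics where this is used. -/
def exponentialPoint {S : Type*} (c : S → ℝ) (T : Matrix R S ℝ) (g : R → ℝ) (s : S) : ℝ :=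
  c s * Real.exp ((g ᵥ* T) s)

theorem exponentialPoint_pos {S : Type*} {c : S → ℝ} {T : Matrix R S ℝ} (hc : ∀ s, 0 < c s)
    (s : S) : 0 < exponentialPoint c T g s :=
  mul_pos (hc s) (Real.exp_pos _)

theorem weightedEntropy_eq_of_mem_stdPolyhedron (hc : ∀ s, 0 < c s) (hmass : ∀ s, T r₀ s = 1)
    (hx : x ∈ stdPolyhedron T b) (g : R → ℝ) :
    weightedEntropy c x =
      ∑ s, (Real.negMulLog (x s) + x s * Real.log (exponentialPoint c T g s)) -
        g ⬝ᵥ b - Real.negMulLog (b r₀) := by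
  have hgb : g ⬝ᵥ b = ∑ s, x s * (g ᵥ* T) s := by
    rw [← hx.2, dotProduct_mulVec, dotProduct_comm]
    rfl
  have hlog (s) : Real.log (exponentialPoint c T g s) = Real.log (c s) + (g ᵥ* T) s := by
    rw [exponentialPoint, Real.log_mul (hc s).ne' (Real.exp_ne_zero _), Real.log_exp]
  simp only [weightedEntropy, sum_eq_of_mem_stdPolyhedron hmass hx, hgb, hlog, mul_add,
    Finset.sum_add_distrib]
  ring

theorem weightedEntropy_exponentialPoint (hc : ∀ s, 0 < c s) (hmass : ∀ s, T r₀ s = 1)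
    (hg : exponentialPoint c T g ∈ stdPolyhedron T b) :
    weightedEntropy c (exponentialPoint c T g) = -(g ⬝ᵥ b) - Real.negMulLog (b r₀) := by
  rw [weightedEntropy_eq_of_mem_stdPolyhedron hc hmass hg g]
  simp [Real.negMulLog]

/-- The Gibbs inequality. -/
theorem isMaxOn_weightedEntropy_exponentialPoint (hc : ∀ s, 0 < c s) (hmass : ∀ s, T r₀ s = 1)
    (hg : exponentialPoint c T g ∈ stdPolyhedron T b) :
    IsMaxOn (weightedEntropy c) (stdPolyhedron T b) (exponentialPoint c T g) := by
  intro x hx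
  have hle : ∑ s, (Real.negMulLog (x s) + x s * Real.log (exponentialPoint c T g s)) ≤
      ∑ s, (exponentialPoint c T g s - x s) := Finset.sum_le_sum fun s _ =>
    negMulLog_add_mul_log_le (hx.1 s) (exponentialPoint_pos hc s)
  rw [Finset.sum_sub_distrib, sum_eq_of_mem_stdPolyhedron hmass hg,
    sum_eq_of_mem_stdPolyhedron hmass hx, sub_self] at hle
  simp only [Set.mem_ofPred_eq, weightedEntropy_exponentialPoint hc hmass hg,
    weightedEntropy_eq_of_mem_stdPolyhedron hc hmass hx g]
  linarith

theorem optimalValue_weightedEntropy (hc : ∀ s, 0 < c s) (hmass : ∀ s, T r₀ s = 1)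
    (hg : exponentialPoint c T g ∈ stdPolyhedron T b) :
    optimalValue T (weightedEntropy c) b = -(g ⬝ᵥ b) - Real.negMulLog (b r₀) := by
  rw [optimalValue_eq hg (isMaxOn_weightedEntropy_exponentialPoint hc hmass hg),
    weightedEntropy_exponentialPoint hc hmass hg]

/-- The entropy maximizer over the polyhedron is positive and stationary along the kernel of `T`. -/
theorem exists_exponentialPoint_mem_stdPolyhedron (hc : ∀ s, 0 < c s) (hmass : ∀ s, T r₀ s = 1)
    {y : S → ℝ} (hy : y ∈ stdPolyhedron T b) (hy_pos : ∀ s, 0 < y s) :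
    ∃ g, exponentialPoint c T g ∈ stdPolyhedron T b := by
  obtain ⟨x, hx, hmax⟩ :=
    (isCompact_stdPolyhedron (stdPolyhedron_subset_Iic hmass)).exists_isMaxOn ⟨y, hy⟩
      (continuous_weightedEntropy c).continuousOn
  have hx_pos : ∀ s, 0 < x s := pos_of_isMaxOn_weightedEntropy (convex_stdPolyhedron T b) hmax hx hy
    hx.1 hy_pos (by rw [sum_eq_of_mem_stdPolyhedron hmass hx, sum_eq_of_mem_stdPolyhedron hmass hy])
  have hstat (v) (hv : T *ᵥ v = 0) : (fun s => Real.log (x s) - Real.log (c s)) ⬝ᵥ v = 0 := by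
    have hv_sum : ∑ s, v s = 0 := by simpa [mulVec, dotProduct, hmass] using congrFun hv r₀
    have hloc : IsLocalMax (fun t : ℝ => weightedEntropy c (x + t • v)) 0 := by
      filter_upwards [eventually_add_smul_pos (v := v) hx_pos] with t ht
      rw [zero_smul, add_zero]
      exact hmax ⟨fun s => (ht s).le, by
        rw [mulVec_add, mulVec_smul, hv, hx.2, smul_zero, add_zero]⟩
    have hzero := hloc.hasDerivAt_eq_zero (hasDerivAt_weightedEntropy_add_smul hx_pos hv_sum)
    rw [dotProduct, ← neg_eq_zero, ← hzero, ← Finset.sum_neg_distrib]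
    exact Finset.sum_congr rfl fun s _ => by ring
  obtain ⟨g, hg⟩ := exists_vecMul_eq_of_forall_ker hstat
  have hgx : exponentialPoint c T g = x := by
    ext s
    rw [exponentialPoint, hg, Real.exp_sub, Real.exp_log (hx_pos s), Real.exp_log (hc s),
      mul_div_cancel₀ _ (hc s).ne']
  exact ⟨g, hgx ▸ hx⟩

theorem sub_mul_exp_sub_exp_nonneg (a b : ℝ) : 0 ≤ (a - b) * (Real.exp a - Real.exp b) := by
  rcases le_total a b with h | h
  · exact mul_nonneg_of_nonpos_of_nonpos (sub_nonpos.2 h) (sub_nonpos.2 (Real.exp_le_exp.2 h))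
  · exact mul_nonneg (sub_nonneg.2 h) (sub_nonneg.2 (Real.exp_le_exp.2 h))

/-- Pair the difference of the parameters with the (vanishing) difference of the statistics. -/
theorem vecMul_eq_of_mulVec_exponentialPoint_eq (hc : ∀ s, 0 < c s)
    (h : T *ᵥ exponentialPoint c T g = T *ᵥ exponentialPoint c T g') : g ᵥ* T = g' ᵥ* T := by
  set a := g ᵥ* T with ha
  set a' := g' ᵥ* T with ha'
  have hpair : ∑ s, (a s - a' s) * (exponentialPoint c T g s - exponentialPoint c T g' s) = 0 := by
    change (a - a') ⬝ᵥ (exponentialPoint c T g - exponentialPoint c T g') = 0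
    rw [ha, ha', ← sub_vecMul, ← dotProduct_mulVec, mulVec_sub, h, sub_self, dotProduct_zero]
  have hterm (s) : (a s - a' s) * (exponentialPoint c T g s - exponentialPoint c T g' s) =
      c s * ((a s - a' s) * (Real.exp (a s) - Real.exp (a' s))) := by
    simp only [exponentialPoint, ← ha, ← ha']
    ring
  simp only [hterm] at hpair
  ext s
  have hs := (Finset.sum_eq_zero_iff_of_nonneg fun s _ =>
    mul_nonneg (hc s).le (sub_mul_exp_sub_exp_nonneg (a s) (a' s))).1 hpair s (Finset.mem_univ s)
  rcases mul_eq_zero.1 ((mul_eq_zero.1 hs).resolve_left (hc s).ne') with h | h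
  · exact sub_eq_zero.1 h
  · exact Real.exp_injective (sub_eq_zero.1 h)

end ExponentialFamily

end Entropy

noncomputable section WeightDistribution

open Matrix

variable {S : Type*}

/-- The statistics of a distribution on `S`: its mass and its total weight with respect to `w`. -/
def weightStat (w : S → ℝ) : Matrix (Fin 2) S ℝ := Matrix.of ![1, w]

variable [Fintype S] {w x : S → ℝ} {d b : ℝ}

theorem mem_stdPolyhedron_weightStat :
    x ∈ stdPolyhedron (weightStat w) ![d, b] ↔ 0 ≤ x ∧ ∑ s, x s = d ∧ ∑ s, w s * x s = b := by
  simp [stdPolyhedron, weightStat, funext_iff, dotProduct]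

theorem mem_Icc_of_mem_stdPolyhedron_weightStat {s₀ s₁ : S} (hmin : ∀ s, w s₀ ≤ w s)
    (hmax : ∀ s, w s ≤ w s₁) (hx : x ∈ stdPolyhedron (weightStat w) ![d, b]) :
    b ∈ Set.Icc (w s₀ * d) (w s₁ * d) := by
  obtain ⟨hx0, rfl, rfl⟩ := mem_stdPolyhedron_weightStat.1 hx
  simp only [Finset.mul_sum]
  exact ⟨Finset.sum_le_sum fun s _ => mul_le_mul_of_nonneg_right (hmin s) (hx0 s),
    Finset.sum_le_sum fun s _ => mul_le_mul_of_nonneg_right (hmax s) (hx0 s)⟩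

theorem single_mem_stdPolyhedron_weightStat [DecidableEq S] (hd : 0 ≤ d) (s : S) :
    Pi.single s d ∈ stdPolyhedron (weightStat w) ![d, w s * d] :=
  mem_stdPolyhedron_weightStat.2 ⟨Pi.single_nonneg.2 hd, by simp, by simp [Pi.single_apply]⟩

theorem stdPolyhedron_weightStat_nonempty {s₀ s₁ : S} (hd : 0 ≤ d)
    (hb : b ∈ Set.Icc (w s₀ * d) (w s₁ * d)) :
    (stdPolyhedron (weightStat w) ![d, b]).Nonempty := by
  classical
  obtain ⟨θ, θ', hθ, hθ', hsum, rfl⟩ := Icc_subset_segment (𝕜 := ℝ) hb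
  have hstat : ![d, θ • (w s₀ * d) + θ' • (w s₁ * d)] =
      θ • ![d, w s₀ * d] + θ' • ![d, w s₁ * d] := by
    simp [← add_mul, hsum]
  exact hstat ▸ ⟨_, smul_add_smul_mem_stdPolyhedron
    (single_mem_stdPolyhedron_weightStat hd s₀) (single_mem_stdPolyhedron_weightStat hd s₁) hθ hθ'⟩

/-- Spread a small uniform mass over all points, and the remaining one over `s₀` and `s₁`. -/
theorem exists_pos_mem_stdPolyhedron_weightStat {s₀ s₁ : S} (hd : 0 < d)
    (hb : b ∈ Set.Ioo (w s₀ * d) (w s₁ * d)) :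
    ∃ x ∈ stdPolyhedron (weightStat w) ![d, b], ∀ s, 0 < x s := by
  have hsmall : ∀ᶠ ε : ℝ in 𝓝[>] 0, 0 < d - Fintype.card S * ε ∧
      b - (∑ s, w s) * ε ∈ Set.Ioo (w s₀ * (d - Fintype.card S * ε))
        (w s₁ * (d - Fintype.card S * ε)) := by
    refine nhdsWithin_le_nhds ((ContinuousAt.eventually_lt (by fun_prop) (by fun_prop) ?_).and
      ((ContinuousAt.eventually_lt (by fun_prop) (by fun_prop) ?_).and
        (ContinuousAt.eventually_lt (by fun_prop) (by fun_prop) ?_)))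
    · simpa using hd
    · simpa using hb.1
    · simpa using hb.2
  obtain ⟨ε, ⟨hd', hb'⟩, hε : 0 < ε⟩ := (hsmall.and self_mem_nhdsWithin).exists
  obtain ⟨y, hy⟩ := stdPolyhedron_weightStat_nonempty hd'.le (Set.Ioo_subset_Icc_self hb')
  obtain ⟨hy0, hyd, hyb⟩ := mem_stdPolyhedron_weightStat.1 hy
  refine ⟨fun s => ε + y s, mem_stdPolyhedron_weightStat.2
    ⟨fun s => add_nonneg hε.le (hy0 s), ?_, ?_⟩, fun s => add_pos_of_pos_of_nonneg hε (hy0 s)⟩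
  · simp [Finset.sum_add_distrib, hyd]
  · simp only [mul_add, Finset.sum_add_distrib, hyb, ← Finset.sum_mul]
    ring

theorem isCompact_stdPolyhedron_weightStat (w : S → ℝ) (d b : ℝ) :
    IsCompact (stdPolyhedron (weightStat w) ![d, b]) :=
  isCompact_stdPolyhedron (stdPolyhedron_subset_Iic (r₀ := 0) fun _ => rfl)

theorem deriv_sum_mul_pow_mul (c : S → ℝ) (m : S → ℕ) (x : ℝ) :
    deriv (fun x => ∑ s, c s * x ^ m s) x * x = ∑ s, m s * (c s * x ^ m s) := by
  have hderiv : HasDerivAt (fun x => ∑ s, c s * x ^ m s)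
      (∑ s, c s * (m s * x ^ (m s - 1))) x :=
    HasDerivAt.fun_sum fun s _ => (hasDerivAt_pow (m s) x).const_mul _
  rw [hderiv.deriv, Finset.sum_mul]
  refine Finset.sum_congr rfl fun s _ => ?_
  cases m s with
  | zero => simp
  | succ m => rw [Nat.add_sub_cancel, pow_succ]; ring

end WeightDistribution

noncomputable section

open Matrix

namespace DGLDPC

variable {ι : Type*} [Fintype ι] (D : DGLDPC ι)

/-! ### Parameters of the ensemble -/

theorem B_pos_iff (n : ℕ) (t : ι) (i u v : ℕ) : 0 < D.B t u v ↔
    ∃ x : Fin (D.k t) → ZMod 2, hammingNorm x = u ∧ hammingNorm (D.vn n t i x) = v := by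
  rw [← D.vn_iowef n t i u v, Nat.card_pos_iff, nonempty_subtype]
  exact and_iff_left inferInstance

theorem A_pos_iff (n j u : ℕ) : 0 < D.A u ↔
    ∃ c : Fin D.s → ZMod 2, c ∈ D.cn n j ∧ hammingNorm c = u := by
  rw [← D.cn_wef n j u, Nat.card_pos_iff, nonempty_subtype]
  exact and_iff_left inferInstance

theorem le_k_of_B_pos {t : ι} {u v : ℕ} (h : 0 < D.B t u v) : u ≤ D.k t := by
  obtain ⟨x, rfl, -⟩ := (D.B_pos_iff 0 t 0 u v).1 h
  simpa using hammingNorm_le_card_fintype (x := x)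

theorem le_q_of_B_pos {t : ι} {u v : ℕ} (h : 0 < D.B t u v) : v ≤ D.q t := by
  obtain ⟨x, -, rfl⟩ := (D.B_pos_iff 0 t 0 u v).1 h
  simpa using hammingNorm_le_card_fintype (x := D.vn 0 t 0 x)

theorem le_s_of_A_pos {u : ℕ} (h : 0 < D.A u) : u ≤ D.s := by
  obtain ⟨x, -, rfl⟩ := (D.A_pos_iff 0 0 u).1 h
  simpa using hammingNorm_le_card_fintype (x := x)

theorem B_zero_zero_pos (t : ι) : 0 < D.B t 0 0 :=
  (D.B_pos_iff 0 t 0 0 0).2 ⟨0, by simp, by simp⟩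

theorem A_zero_pos : 0 < D.A 0 := (D.A_pos_iff 0 0 0).2 ⟨0, Submodule.zero_mem _, by simp⟩

theorem eq_zero_of_B_zero_pos {t : ι} {v : ℕ} (h : 0 < D.B t 0 v) : v = 0 := by
  obtain ⟨x, hx, rfl⟩ := (D.B_pos_iff 0 t 0 0 v).1 h
  rw [hammingNorm_eq_zero] at hx
  simp [hx]

theorem exists_B_pos {t : ι} {u : ℕ} (hu : u ≤ D.k t) : ∃ v, 0 < D.B t u v := by
  let x : Fin (D.k t) → ZMod 2 := fun i => if (i : ℕ) < u then 1 else 0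
  have hx : hammingNorm x = u := by
    simp [hammingNorm, x, Fin.card_filter_val_lt, hu]
  exact ⟨_, (D.B_pos_iff 0 t 0 u _).2 ⟨x, hx, rfl⟩⟩

theorem exists_pos_A_pos : ∃ u, 0 < u ∧ 0 < D.A u := by
  obtain ⟨c, hc, hc0⟩ := Submodule.exists_mem_ne_zero_of_ne_bot (D.cn_ne_bot 0 0)
  exact ⟨hammingNorm c, hammingNorm_pos_iff.2 hc0, (D.A_pos_iff 0 0 _).2 ⟨c, hc, rfl⟩⟩

theorem q_pos (t : ι) : 0 < D.q t := by
  have : Nonempty (Fin (D.k t)) := ⟨⟨0, D.k_pos t⟩⟩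
  refine Nat.pos_of_ne_zero fun hq => ?_
  have : IsEmpty (Fin (D.q t)) := hq ▸ Fin.isEmpty
  exact zero_ne_one
    ((D.vn_injective 0 t 0).subsingleton.elim (0 : Fin (D.k t) → ZMod 2) 1)

theorem lamInt_eq : D.lamInt = ∑ t, (D.lam t : ℝ) / D.q t := by
  rw [lamInt, intervalIntegral.integral_finsetSum
    fun t _ => Continuous.intervalIntegrable (by fun_prop) _ _]
  refine Finset.sum_congr rfl fun t _ => ?_
  rw [intervalIntegral.integral_const_mul, integral_pow, ← Nat.cast_add_one,
    Nat.sub_add_cancel (D.q_pos t)]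
  simp [(D.q_pos t).ne', div_eq_mul_inv]

theorem rhoInt_eq : D.rhoInt = 1 / D.s := by
  rw [rhoInt, integral_pow, ← Nat.cast_add_one, Nat.sub_add_cancel D.s_pos]
  simp [D.s_pos.ne']

theorem nonempty_index {ι : Type*} [Fintype ι] (D : DGLDPC ι) : Nonempty ι := by
  by_contra h
  rw [not_nonempty_iff] at h
  simpa using D.lam_sum

theorem lamInt_pos : 0 < D.lamInt := by
  have := D.nonempty_index
  rw [lamInt_eq]
  exact Finset.sum_pos (fun t _ => div_pos (by exact_mod_cast D.lam_pos t)
    (by exact_mod_cast D.q_pos t)) Finset.univ_nonempty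

theorem rhoInt_pos : 0 < D.rhoInt := by
  rw [rhoInt_eq]
  exact one_div_pos.2 (by exact_mod_cast D.s_pos)

theorem delta_pos (t : ι) : 0 < D.delta t :=
  div_pos (by exact_mod_cast D.lam_pos t) (mul_pos (by exact_mod_cast D.q_pos t) D.lamInt_pos)

/-- The number of CNs per VN. -/
def cnRatio : ℝ := D.rhoInt / D.lamInt

theorem cnRatio_pos : 0 < D.cnRatio := div_pos D.rhoInt_pos D.lamInt_pos

/-! ### Symbols -/

/-- The symbols of a type-`t` VN: the pairs of an input and an output weight that occur. -/
abbrev VNSymbol (t : ι) : Type := {p : Fin (D.k t + 1) × Fin (D.q t + 1) // 0 < D.B t p.1 p.2}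

/-- The symbols of a CN: the weights that occur. -/
abbrev CNSymbol : Type := {u : Fin (D.s + 1) // 0 < D.A u}

variable {D} in
/-- The input weight of a VN symbol. -/
def VNSymbol.inWeight {t : ι} (s : D.VNSymbol t) : ℕ := s.1.1

variable {D} in
/-- The output weight of a VN symbol. -/
def VNSymbol.outWeight {t : ι} (s : D.VNSymbol t) : ℕ := s.1.2

variable {D} in
/-- The weight of a CN symbol. -/
def CNSymbol.weight (s : D.CNSymbol) : ℕ := s.1

/-- The number of local inputs of a VN with a given symbol, as a real number. -/
def vnMult (t : ι) (s : D.VNSymbol t) : ℝ := D.B t s.inWeight s.outWeight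

/-- The number of local codewords of a CN with a given symbol, as a real number. -/
def cnMult (s : D.CNSymbol) : ℝ := D.A s.weight

theorem vnMult_pos (t : ι) (s : D.VNSymbol t) : 0 < D.vnMult t s := Nat.cast_pos.2 s.2

theorem cnMult_pos (s : D.CNSymbol) : 0 < D.cnMult s := Nat.cast_pos.2 s.2

/-- The VN symbol with given weights. -/
def vnSymbol {t : ι} {u v : ℕ} (h : 0 < D.B t u v) : D.VNSymbol t :=
  ⟨(⟨u, Nat.lt_succ_of_le (D.le_k_of_B_pos h)⟩, ⟨v, Nat.lt_succ_of_le (D.le_q_of_B_pos h)⟩), h⟩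

/-- The CN symbol with given weight. -/
def cnSymbol {u : ℕ} (h : 0 < D.A u) : D.CNSymbol :=
  ⟨⟨u, Nat.lt_succ_of_le (D.le_s_of_A_pos h)⟩, h⟩

@[simp] theorem inWeight_vnSymbol {t : ι} {u v : ℕ} (h : 0 < D.B t u v) :
    (D.vnSymbol h).inWeight = u := rfl

@[simp] theorem outWeight_vnSymbol {t : ι} {u v : ℕ} (h : 0 < D.B t u v) :
    (D.vnSymbol h).outWeight = v := rfl

@[simp] theorem weight_cnSymbol {u : ℕ} (h : 0 < D.A u) : (D.cnSymbol h).weight = u := rfl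

theorem inWeight_le {t : ι} (s : D.VNSymbol t) : s.inWeight ≤ D.k t := Nat.le_of_lt_succ s.1.1.2

instance (t : ι) : Nonempty (D.VNSymbol t) := ⟨D.vnSymbol (D.B_zero_zero_pos t)⟩

instance : Nonempty D.CNSymbol := ⟨D.cnSymbol D.A_zero_pos⟩

/-- The statistics of type-`t` VNs: number, total input weight and total output weight. -/
def vnStat (t : ι) : Matrix (Fin 3) (D.VNSymbol t) ℝ :=
  Matrix.of ![1, fun s => s.inWeight, fun s => s.outWeight]

/-- The statistics of CNs: number and total weight. -/
def cnStat : Matrix (Fin 2) D.CNSymbol ℝ := weightStat fun s => s.weight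

variable {D} in
theorem mem_stdPolyhedron_vnStat {t : ι} {d a b : ℝ} {x : D.VNSymbol t → ℝ} :
    x ∈ stdPolyhedron (D.vnStat t) ![d, a, b] ↔ 0 ≤ x ∧ ∑ s, x s = d ∧
      ∑ s : D.VNSymbol t, (s.inWeight : ℝ) * x s = a ∧
        ∑ s : D.VNSymbol t, (s.outWeight : ℝ) * x s = b := by
  simp [stdPolyhedron, vnStat, funext_iff, Fin.forall_fin_succ, dotProduct]

variable {D} in
theorem mem_stdPolyhedron_cnStat {d b : ℝ} {x : D.CNSymbol → ℝ} :
    x ∈ stdPolyhedron D.cnStat ![d, b] ↔ 0 ≤ x ∧ ∑ s, x s = d ∧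
      ∑ s : D.CNSymbol, (s.weight : ℝ) * x s = b :=
  mem_stdPolyhedron_weightStat

theorem sum_vnMult_mul (t : ι) (f : ℕ → ℕ → ℝ) :
    ∑ s : D.VNSymbol t, D.vnMult t s * f s.inWeight s.outWeight =
      ∑ u ∈ Finset.range (D.k t + 1), ∑ v ∈ Finset.range (D.q t + 1), D.B t u v * f u v := by
  let F : Fin (D.k t + 1) × Fin (D.q t + 1) → ℝ := fun p => D.B t p.1 p.2 * f p.1 p.2
  calc ∑ s : D.VNSymbol t, F s = ∑ p with 0 < D.B t p.1 p.2, F p :=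
        (Finset.sum_subtype _ (by simp) F).symm
    _ = ∑ p, F p := Finset.sum_filter_of_ne fun p _ hp => Nat.pos_of_ne_zero fun h => by
        simp [F, h] at hp
    _ = _ := by simp only [F, Finset.sum_range, Fintype.sum_prod_type]

theorem sum_cnMult_mul (f : ℕ → ℝ) :
    ∑ s : D.CNSymbol, D.cnMult s * f s.weight = ∑ u ∈ Finset.range (D.s + 1), D.A u * f u := by
  let F : Fin (D.s + 1) → ℝ := fun u => D.A u * f u
  calc ∑ s : D.CNSymbol, F s = ∑ u ∈ {u : Fin (D.s + 1) | 0 < D.A u}, F u :=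
        (Finset.sum_subtype _ (by simp) F).symm
    _ = ∑ u, F u := Finset.sum_filter_of_ne fun u _ hu => Nat.pos_of_ne_zero fun h => by
        simp [F, h] at hu
    _ = _ := by simp only [F, Finset.sum_range]

end DGLDPC

end

/-! ### The linear programs -/

section Sums

theorem sum_fin_succ_eq_add_sum_Icc (k : ℕ) (g : ℕ → ℝ) :
    ∑ i : Fin (k + 1), g i = g 0 + ∑ i ∈ Finset.Icc 1 k, g i := by
  rw [← Finset.sum_range, Finset.sum_range_eq_add_Ico _ k.succ_pos]
  rfl

theorem sum_mul_funOnFinite_map {S S' : Type*} [Fintype S] [Fintype S'] (e : S → S')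
    (φ : S' → ℝ) (x : S → ℝ) : ∑ s', φ s' * FunOnFinite.map e x s' = ∑ s, φ (e s) * x s := by
  classical
  simp only [FunOnFinite.map_apply_apply, Finset.mul_sum]
  rw [← Finset.sum_fiberwise _ e]
  exact Finset.sum_congr rfl fun s' _ => Finset.sum_congr rfl fun s hs => by
    rw [(Finset.mem_filter.1 hs).2]

theorem funOnFinite_map_nonneg {S S' : Type*} [Finite S] [Finite S'] (e : S → S')
    {x : S → ℝ} (hx : 0 ≤ x) : 0 ≤ FunOnFinite.map e x := by
  classical
  have := Fintype.ofFinite S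
  intro s'
  rw [FunOnFinite.map_apply_apply]
  exact Finset.sum_nonneg fun s _ => hx s

end Sums

noncomputable section

open Matrix

namespace DGLDPC

variable {ι : Type*} [Fintype ι] (D : DGLDPC ι) {t : ι}

theorem bddAbove_setOf_B_pos (t : ι) (i : ℕ) : BddAbove {j | 0 < D.B t i j} :=
  ⟨D.q t, fun _ hj => D.le_q_of_B_pos hj⟩

theorem B_U_pos {i : ℕ} (hi : i ≤ D.k t) : 0 < D.B t i (D.U t i) :=
  Nat.sInf_mem (s := {j | 0 < D.B t i j}) (D.exists_B_pos hi)

theorem B_V_pos {i : ℕ} (hi : i ≤ D.k t) : 0 < D.B t i (D.V t i) :=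
  Nat.sSup_mem (s := {j | 0 < D.B t i j}) (D.exists_B_pos hi) (D.bddAbove_setOf_B_pos t i)

theorem U_le {i j : ℕ} (h : 0 < D.B t i j) : D.U t i ≤ j := Nat.sInf_le h

theorem le_V {i j : ℕ} (h : 0 < D.B t i j) : j ≤ D.V t i :=
  le_csSup (D.bddAbove_setOf_B_pos t i) h

theorem U_zero (t : ι) : D.U t 0 = 0 := D.eq_zero_of_B_zero_pos (D.B_U_pos (Nat.zero_le _))

theorem V_zero (t : ι) : D.V t 0 = 0 := D.eq_zero_of_B_zero_pos (D.B_V_pos (Nat.zero_le _))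

/-- The distributions of the input weight of a type-`t` VN with mean `a`: the feasible points `ω` of
the linear programs, completed by the probability of the input weight `0`. -/
def inputDistributions (t : ι) (a : ℝ) : Set (Fin (D.k t + 1) → ℝ) :=
  stdPolyhedron (weightStat fun i => (i : ℝ)) ![1, a]

theorem inputDistributions_nonempty {a : ℝ} (ha : 0 ≤ a) (hak : a ≤ D.k t) :
    (D.inputDistributions t a).Nonempty :=
  stdPolyhedron_weightStat_nonempty (s₀ := 0) (s₁ := Fin.last _) zero_le_one
    (by simpa using ⟨ha, hak⟩)

theorem image_lpSet {f : ℕ → ℝ} (hf : f 0 = 0) (a : ℝ) :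
    (fun ω : ℕ → ℝ => ∑ i ∈ Finset.Icc 1 (D.k t), f i * ω i) '' D.lpSet t a =
      (fun w : Fin (D.k t + 1) → ℝ => ∑ i : Fin (D.k t + 1), f i * w i) ''
        D.inputDistributions t a := by
  apply Set.Subset.antisymm
  · rintro _ ⟨ω, ⟨hω, hω_sum, hω_mean⟩, rfl⟩
    let w : ℕ → ℝ := Function.update ω 0 (1 - ∑ i ∈ Finset.Icc 1 (D.k t), ω i)
    have hw (i : ℕ) (hi : i ∈ Finset.Icc 1 (D.k t)) : w i = ω i :=
      Function.update_of_ne (by simp at hi; omega) _ _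
    have hsum (g : ℕ → ℝ) : ∑ i : Fin (D.k t + 1), g i * w i =
        g 0 * (1 - ∑ i ∈ Finset.Icc 1 (D.k t), ω i) + ∑ i ∈ Finset.Icc 1 (D.k t), g i * ω i := by
      rw [sum_fin_succ_eq_add_sum_Icc _ fun i => g i * w i,
        Finset.sum_congr rfl fun i hi => by rw [hw i hi]]
      simp [w]
    refine ⟨fun i => w i, mem_stdPolyhedron_weightStat.2 ⟨fun i => ?_, ?_, ?_⟩, ?_⟩
    · rcases Nat.eq_zero_or_pos i with hi | hi
      · simpa [w, hi] using hω_sum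
      · have hi' : (i : ℕ) ∈ Finset.Icc 1 (D.k t) :=
          Finset.mem_Icc.2 ⟨hi, Nat.le_of_lt_succ i.2⟩
        simpa [hw i hi'] using hω i hi'
    · simpa using hsum 1
    · simpa [hω_mean] using hsum (fun i => i)
    · simpa [hf] using hsum f
  · rintro _ ⟨w, hw, rfl⟩
    obtain ⟨hw0, hw_sum, hw_mean⟩ := mem_stdPolyhedron_weightStat.1 hw
    have hsum (g : ℕ → ℝ) : ∑ i : Fin (D.k t + 1), g i * w i =
        g 0 * w 0 + ∑ i ∈ Finset.Icc 1 (D.k t), g i * w (Fin.ofNat _ i) := by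
      simpa using sum_fin_succ_eq_add_sum_Icc (D.k t) fun i => g i * w (Fin.ofNat _ i)
    refine ⟨fun i => w (Fin.ofNat _ i), ⟨fun i _ => hw0 _, ?_, ?_⟩, ?_⟩
    · have h1 := hsum 1
      simp only [Pi.one_apply, one_mul, hw_sum] at h1
      have h0 : 0 ≤ w 0 := hw0 0
      change ∑ i ∈ Finset.Icc 1 (D.k t), w (Fin.ofNat _ i) ≤ 1
      linarith
    · simpa [hw_mean] using (hsum fun i => i).symm
    · simpa [hf] using (hsum f).symm

theorem isLeast_lpMin {a : ℝ} (hne : (D.inputDistributions t a).Nonempty) :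
    IsLeast ((fun w : Fin (D.k t + 1) → ℝ => ∑ i : Fin (D.k t + 1), (D.U t i : ℝ) * w i) ''
      D.inputDistributions t a) (D.lpMin t a) := by
  rw [lpMin, D.image_lpSet (f := fun i => (D.U t i : ℝ)) (by simp [U_zero])]
  exact ((isCompact_stdPolyhedron_weightStat _ _ _).image (by fun_prop)).isLeast_sInf
    (hne.image _)

theorem isGreatest_lpMax {a : ℝ} (hne : (D.inputDistributions t a).Nonempty) :
    IsGreatest ((fun w : Fin (D.k t + 1) → ℝ => ∑ i : Fin (D.k t + 1), (D.V t i : ℝ) * w i) ''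
      D.inputDistributions t a) (D.lpMax t a) := by
  rw [lpMax, D.image_lpSet (f := fun i => (D.V t i : ℝ)) (by simp [V_zero])]
  exact ((isCompact_stdPolyhedron_weightStat _ _ _).image (by fun_prop)).isGreatest_sSup
    (hne.image _)

/-! ### The statistics of the VNs and CNs -/

theorem stdPolyhedron_vnStat_nonempty_of_inputDistribution {a d : ℝ} (hd : 0 ≤ d)
    {w : Fin (D.k t + 1) → ℝ} (hw : w ∈ D.inputDistributions t a) {f : ℕ → ℕ}
    (hf : ∀ i ≤ D.k t, 0 < D.B t i (f i)) :
    (stdPolyhedron (D.vnStat t)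
      ![d, d * a, d * ∑ i : Fin (D.k t + 1), (f i : ℝ) * w i]).Nonempty := by
  obtain ⟨hw0, hw_sum, hw_mean⟩ := mem_stdPolyhedron_weightStat.1 hw
  let e : Fin (D.k t + 1) → D.VNSymbol t := fun i => D.vnSymbol (hf i (Nat.le_of_lt_succ i.2))
  have hsum (φ : D.VNSymbol t → ℝ) :
      ∑ s, φ s * FunOnFinite.map e (d • w) s = d * ∑ i, φ (e i) * w i := by
    rw [sum_mul_funOnFinite_map, Finset.mul_sum]
    exact Finset.sum_congr rfl fun i _ => mul_left_comm _ _ _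
  refine ⟨FunOnFinite.map e (d • w), mem_stdPolyhedron_vnStat.2
    ⟨funOnFinite_map_nonneg e (smul_nonneg hd hw0), ?_, ?_, ?_⟩⟩
  · simpa [hw_sum] using hsum 1
  · simpa [e, hw_mean] using hsum fun s => s.inWeight
  · simpa [e] using hsum fun s => s.outWeight

theorem exists_inputDistribution_of_mem_stdPolyhedron_vnStat {d a b : ℝ} (hd : 0 < d)
    {x : D.VNSymbol t → ℝ} (hx : x ∈ stdPolyhedron (D.vnStat t) ![d, a, b]) :
    ∃ w ∈ D.inputDistributions t (a / d), ∀ f : ℕ → ℝ,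
      d * ∑ i : Fin (D.k t + 1), f i * w i = ∑ s : D.VNSymbol t, f s.inWeight * x s := by
  obtain ⟨hx0, hx_sum, hx_in, -⟩ := mem_stdPolyhedron_vnStat.1 hx
  let e : D.VNSymbol t → Fin (D.k t + 1) := fun s => s.1.1
  have hsum (f : ℕ → ℝ) : ∑ i : Fin (D.k t + 1), f i * FunOnFinite.map e (d⁻¹ • x) i =
      d⁻¹ * ∑ s : D.VNSymbol t, f s.inWeight * x s := by
    rw [sum_mul_funOnFinite_map e fun i => f i, Finset.mul_sum]
    exact Finset.sum_congr rfl fun s _ => mul_left_comm _ _ _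
  refine ⟨FunOnFinite.map e (d⁻¹ • x), mem_stdPolyhedron_weightStat.2
    ⟨funOnFinite_map_nonneg e (smul_nonneg (inv_nonneg.2 hd.le) hx0), ?_, ?_⟩, fun f => ?_⟩
  · simpa [hx_sum, hd.ne'] using hsum 1
  · simpa [hx_in, div_eq_inv_mul] using hsum fun i => i
  · rw [hsum, mul_inv_cancel_left₀ hd.ne']

theorem inputDistributions_div_delta_nonempty {a : ℝ} (ha : 0 ≤ a)
    (hak : a ≤ D.delta t * D.k t) : (D.inputDistributions t (a / D.delta t)).Nonempty :=
  D.inputDistributions_nonempty (div_nonneg ha (D.delta_pos t).le)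
    ((div_le_iff₀' (D.delta_pos t)).2 hak)

theorem stdPolyhedron_vnStat_lower_nonempty {a : ℝ} (ha : 0 ≤ a) (hak : a ≤ D.delta t * D.k t) :
    (stdPolyhedron (D.vnStat t) ![D.delta t, a, D.lower t a]).Nonempty := by
  obtain ⟨w, hw, hmin⟩ := (D.isLeast_lpMin (D.inputDistributions_div_delta_nonempty ha hak)).1
  rw [lower, ← hmin]
  simpa only [mul_div_cancel₀ a (D.delta_pos t).ne'] using
    D.stdPolyhedron_vnStat_nonempty_of_inputDistribution (D.delta_pos t).le hw fun _ => D.B_U_pos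

theorem stdPolyhedron_vnStat_upper_nonempty {a : ℝ} (ha : 0 ≤ a) (hak : a ≤ D.delta t * D.k t) :
    (stdPolyhedron (D.vnStat t) ![D.delta t, a, D.upper t a]).Nonempty := by
  obtain ⟨w, hw, hmax⟩ := (D.isGreatest_lpMax (D.inputDistributions_div_delta_nonempty ha hak)).1
  rw [upper, ← hmax]
  simpa only [mul_div_cancel₀ a (D.delta_pos t).ne'] using
    D.stdPolyhedron_vnStat_nonempty_of_inputDistribution (D.delta_pos t).le hw fun _ => D.B_V_pos

theorem mem_vnRegion_of_mem_stdPolyhedron {a b : ℝ} {x : D.VNSymbol t → ℝ}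
    (hx : x ∈ stdPolyhedron (D.vnStat t) ![D.delta t, a, b]) : (a, b) ∈ D.vnRegion t := by
  have hd := D.delta_pos t
  obtain ⟨w, hw, hsum⟩ := D.exists_inputDistribution_of_mem_stdPolyhedron_vnStat hd hx
  have hne : (D.inputDistributions t (a / D.delta t)).Nonempty := ⟨w, hw⟩
  obtain ⟨hx0, hx_sum, hx_in, hx_out⟩ := mem_stdPolyhedron_vnStat.1 hx
  refine ⟨?_, ?_, ?_, ?_⟩
  · rw [← hx_in]
    exact Finset.sum_nonneg fun s _ => mul_nonneg (Nat.cast_nonneg _) (hx0 s)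
  · rw [← hx_in, ← hx_sum, Finset.sum_mul]
    refine Finset.sum_le_sum fun s _ => ?_
    rw [mul_comm]
    exact mul_le_mul_of_nonneg_left (Nat.cast_le.2 (D.inWeight_le s)) (hx0 s)
  · calc D.lower t a ≤ D.delta t * ∑ i : Fin (D.k t + 1), (D.U t i : ℝ) * w i :=
          mul_le_mul_of_nonneg_left ((D.isLeast_lpMin hne).2 ⟨w, hw, rfl⟩) hd.le
      _ ≤ b := by
          rw [hsum fun i => (D.U t i : ℝ), ← hx_out]
          exact Finset.sum_le_sum fun s _ =>
            mul_le_mul_of_nonneg_right (Nat.cast_le.2 (D.U_le s.2)) (hx0 s)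
  · calc b ≤ D.delta t * ∑ i : Fin (D.k t + 1), (D.V t i : ℝ) * w i := by
          rw [hsum fun i => (D.V t i : ℝ), ← hx_out]
          exact Finset.sum_le_sum fun s _ =>
            mul_le_mul_of_nonneg_right (Nat.cast_le.2 (D.le_V s.2)) (hx0 s)
      _ ≤ D.upper t a :=
          mul_le_mul_of_nonneg_left ((D.isGreatest_lpMax hne).2 ⟨w, hw, rfl⟩) hd.le

theorem mem_vnRegion_iff {a b : ℝ} :
    (a, b) ∈ D.vnRegion t ↔ (stdPolyhedron (D.vnStat t) ![D.delta t, a, b]).Nonempty := by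
  refine ⟨fun ⟨ha, hak, hl, hu⟩ => ?_, fun ⟨x, hx⟩ => D.mem_vnRegion_of_mem_stdPolyhedron hx⟩
  obtain ⟨θ, θ', hθ, hθ', hsum, hb⟩ := Icc_subset_segment (𝕜 := ℝ) ⟨hl, hu⟩
  have hvec : θ • ![D.delta t, a, D.lower t a] + θ' • ![D.delta t, a, D.upper t a] =
      ![D.delta t, a, b] := by simpa [← add_mul, hsum] using hb
  rw [← hvec]
  exact convex_setOf_stdPolyhedron_nonempty (D.vnStat t)
    (D.stdPolyhedron_vnStat_lower_nonempty ha hak) (D.stdPolyhedron_vnStat_upper_nonempty ha hak)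
    hθ hθ' hsum

theorem exists_pos_mem_stdPolyhedron_vnStat_of_mem_openSegment {a b b' c : ℝ} {x : D.VNSymbol t → ℝ}
    (hx : x ∈ stdPolyhedron (D.vnStat t) ![D.delta t, a, b']) (hx_pos : ∀ s, 0 < x s)
    (hc : (stdPolyhedron (D.vnStat t) ![D.delta t, a, c]).Nonempty)
    (hb : b ∈ openSegment ℝ b' c) :
    ∃ y ∈ stdPolyhedron (D.vnStat t) ![D.delta t, a, b], ∀ s, 0 < y s := by
  obtain ⟨θ, θ', hθ, hθ', hsum, rfl⟩ := hb
  refine exists_pos_mem_stdPolyhedron_of_mem_openSegment hx hx_pos hc ⟨θ, θ', hθ, hθ', hsum, ?_⟩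
  simp [← add_mul, hsum]

/-- A positive distribution with the right input weight exists; mix it with one on the lower or the
upper boundary to correct the output weight. -/
theorem exists_pos_mem_stdPolyhedron_vnStat {a b : ℝ} (ha : 0 < a) (hak : a < D.delta t * D.k t)
    (hb : (D.lower t a < b ∧ b < D.upper t a) ∨ (D.lower t a = b ∧ b = D.upper t a)) :
    ∃ x ∈ stdPolyhedron (D.vnStat t) ![D.delta t, a, b], ∀ s, 0 < x s := by
  obtain ⟨v, hv⟩ := D.exists_B_pos (le_refl (D.k t))
  obtain ⟨x, hx, hx_pos⟩ := exists_pos_mem_stdPolyhedron_weightStat (b := a)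
    (w := fun s : D.VNSymbol t => (s.inWeight : ℝ)) (s₀ := D.vnSymbol (D.B_zero_zero_pos t))
    (s₁ := D.vnSymbol hv) (D.delta_pos t) (by simpa [mul_comm] using ⟨ha, hak⟩)
  obtain ⟨hx0, hx_sum, hx_in⟩ := mem_stdPolyhedron_weightStat.1 hx
  have hx' := mem_stdPolyhedron_vnStat.2 ⟨hx0, hx_sum, hx_in, rfl⟩
  set b' := ∑ s : D.VNSymbol t, (s.outWeight : ℝ) * x s
  obtain ⟨-, -, hl : _ ≤ b', hu : b' ≤ _⟩ := D.mem_vnRegion_of_mem_stdPolyhedron hx'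
  rcases lt_trichotomy b' b with h | h | h
  · refine D.exists_pos_mem_stdPolyhedron_vnStat_of_mem_openSegment hx' hx_pos
      (D.stdPolyhedron_vnStat_upper_nonempty ha.le hak.le) ?_
    rw [openSegment_eq_Ioo (by grind)]
    exact ⟨h, by grind⟩
  · exact ⟨x, h ▸ hx', hx_pos⟩
  · refine D.exists_pos_mem_stdPolyhedron_vnStat_of_mem_openSegment hx' hx_pos
      (D.stdPolyhedron_vnStat_lower_nonempty ha.le hak.le) ?_
    rw [openSegment_symm, openSegment_eq_Ioo (by grind)]
    exact ⟨by grind, h⟩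

theorem bddAbove_setOf_A_pos : BddAbove {u | 0 < D.A u} := ⟨D.s, fun _ h => D.le_s_of_A_pos h⟩

/-- The maximum weight of a local codeword of a CN. -/
def maxCNWeight : ℕ := sSup {u | 0 < D.A u}

theorem A_maxCNWeight_pos : 0 < D.A D.maxCNWeight :=
  Nat.sSup_mem (s := {u | 0 < D.A u}) ⟨0, D.A_zero_pos⟩ D.bddAbove_setOf_A_pos

theorem le_maxCNWeight {u : ℕ} (h : 0 < D.A u) : u ≤ D.maxCNWeight :=
  le_csSup D.bddAbove_setOf_A_pos h

theorem maxCNWeight_pos : 0 < D.maxCNWeight := by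
  obtain ⟨u, hu, hA⟩ := D.exists_pos_A_pos
  exact hu.trans_le (D.le_maxCNWeight hA)

theorem betaMax_eq : D.betaMax = D.maxCNWeight * D.cnRatio := mul_comm _ _

theorem mem_Icc_betaMax_iff {b : ℝ} :
    b ∈ Set.Icc 0 D.betaMax ↔ (stdPolyhedron D.cnStat ![D.cnRatio, b]).Nonempty := by
  constructor
  · intro hb
    exact stdPolyhedron_weightStat_nonempty (s₀ := D.cnSymbol D.A_zero_pos)
      (s₁ := D.cnSymbol D.A_maxCNWeight_pos) D.cnRatio_pos.le (by simpa [betaMax_eq] using hb)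
  · rintro ⟨x, hx⟩
    simpa [betaMax_eq] using mem_Icc_of_mem_stdPolyhedron_weightStat
      (w := fun s : D.CNSymbol => (s.weight : ℝ)) (s₀ := D.cnSymbol D.A_zero_pos)
      (s₁ := D.cnSymbol D.A_maxCNWeight_pos) (fun s => by simp)
      (fun s => Nat.cast_le.2 (D.le_maxCNWeight s.2)) hx

theorem exists_pos_mem_stdPolyhedron_cnStat {b : ℝ} (hb : 0 < b) (hb' : b < D.betaMax) :
    ∃ x ∈ stdPolyhedron D.cnStat ![D.cnRatio, b], ∀ s, 0 < x s :=
  exists_pos_mem_stdPolyhedron_weightStat (s₀ := D.cnSymbol D.A_zero_pos)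
    (s₁ := D.cnSymbol D.A_maxCNWeight_pos) D.cnRatio_pos (by simpa [← betaMax_eq] using ⟨hb, hb'⟩)

end DGLDPC

end

noncomputable section

open Matrix

namespace DGLDPC

variable {ι : Type*} [Fintype ι] (D : DGLDPC ι) {t : ι}

/-! ### Saddle points as exponential families -/

theorem iowef_eq (t : ι) (x y : ℝ) : D.iowef t x y =
    ∑ s : D.VNSymbol t, D.vnMult t s * (x ^ s.inWeight * y ^ s.outWeight) := by
  rw [D.sum_vnMult_mul t fun u v => x ^ u * y ^ v]
  simp only [iowef, mul_assoc]

theorem wef_eq (z : ℝ) : D.wef z = ∑ s : D.CNSymbol, D.cnMult s * z ^ s.weight :=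
  (D.sum_cnMult_mul fun u => z ^ u).symm

theorem iowef_pos (t : ι) {x y : ℝ} (hx : 0 < x) (hy : 0 < y) : 0 < D.iowef t x y := by
  rw [iowef_eq]
  exact Finset.sum_pos (fun s _ => mul_pos (D.vnMult_pos t s) (by positivity))
    Finset.univ_nonempty

theorem wef_pos {z : ℝ} (hz : 0 < z) : 0 < D.wef z := by
  rw [wef_eq]
  exact Finset.sum_pos (fun s _ => mul_pos (D.cnMult_pos s) (by positivity)) Finset.univ_nonempty

theorem deriv_iowef_fst_mul (t : ι) (x y : ℝ) : deriv (fun x => D.iowef t x y) x * x =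
    ∑ s : D.VNSymbol t, s.inWeight * (D.vnMult t s * (x ^ s.inWeight * y ^ s.outWeight)) := by
  simpa only [iowef_eq, mul_right_comm, ← mul_assoc] using
    deriv_sum_mul_pow_mul (fun s : D.VNSymbol t => D.vnMult t s * y ^ s.outWeight)
      (fun s => s.inWeight) x

theorem deriv_iowef_snd_mul (t : ι) (x y : ℝ) : deriv (fun y => D.iowef t x y) y * y =
    ∑ s : D.VNSymbol t, s.outWeight * (D.vnMult t s * (x ^ s.inWeight * y ^ s.outWeight)) := by
  simpa only [iowef_eq, mul_assoc] using
    deriv_sum_mul_pow_mul (fun s : D.VNSymbol t => D.vnMult t s * x ^ s.inWeight)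
      (fun s => s.outWeight) y

theorem deriv_wef_mul (z : ℝ) : deriv D.wef z * z =
    ∑ s : D.CNSymbol, s.weight * (D.cnMult s * z ^ s.weight) := by
  rw [funext D.wef_eq]
  exact deriv_sum_mul_pow_mul D.cnMult (fun s => s.weight) z

theorem vecMul_vnStat (t : ι) (g : Fin 3 → ℝ) (s : D.VNSymbol t) :
    (g ᵥ* D.vnStat t) s = g 0 + g 1 * s.inWeight + g 2 * s.outWeight := by
  simp [vnStat, vecMul, dotProduct, Fin.sum_univ_three]

theorem vecMul_cnStat (g : Fin 2 → ℝ) (s : D.CNSymbol) :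
    (g ᵥ* D.cnStat) s = g 0 + g 1 * s.weight := by
  simp [cnStat, weightStat, vecMul, dotProduct, Fin.sum_univ_two]

theorem exponentialPoint_vnStat (t : ι) (g : Fin 3 → ℝ) (s : D.VNSymbol t) :
    exponentialPoint (D.vnMult t) (D.vnStat t) g s = Real.exp (g 0) *
      (D.vnMult t s * (Real.exp (g 1) ^ s.inWeight * Real.exp (g 2) ^ s.outWeight)) := by
  simp only [exponentialPoint, vecMul_vnStat, Real.exp_add, mul_comm (g _), Real.exp_nat_mul]
  ring

theorem exponentialPoint_cnStat (g : Fin 2 → ℝ) (s : D.CNSymbol) :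
    exponentialPoint D.cnMult D.cnStat g s =
      Real.exp (g 0) * (D.cnMult s * Real.exp (g 1) ^ s.weight) := by
  simp only [exponentialPoint, vecMul_cnStat, Real.exp_add, mul_comm (g _), Real.exp_nat_mul]
  ring

theorem exponentialPoint_mem_stdPolyhedron_vnStat {g : Fin 3 → ℝ} {d a b x y : ℝ}
    (hx : Real.exp (g 1) = x) (hy : Real.exp (g 2) = y) :
    exponentialPoint (D.vnMult t) (D.vnStat t) g ∈ stdPolyhedron (D.vnStat t) ![d, a, b] ↔
      Real.exp (g 0) * D.iowef t x y = d ∧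
        Real.exp (g 0) * (deriv (fun x => D.iowef t x y) x * x) = a ∧
          Real.exp (g 0) * (deriv (fun y => D.iowef t x y) y * y) = b := by
  have h_nonneg : 0 ≤ exponentialPoint (D.vnMult t) (D.vnStat t) g :=
    fun s => (exponentialPoint_pos (D.vnMult_pos t) s).le
  simp only [mem_stdPolyhedron_vnStat, h_nonneg, true_and, exponentialPoint_vnStat, hx, hy,
    deriv_iowef_fst_mul, deriv_iowef_snd_mul]
  simp only [iowef_eq, Finset.mul_sum, mul_left_comm]

theorem exponentialPoint_mem_stdPolyhedron_cnStat {g : Fin 2 → ℝ} {d b z : ℝ}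
    (hz : Real.exp (g 1) = z) :
    exponentialPoint D.cnMult D.cnStat g ∈ stdPolyhedron D.cnStat ![d, b] ↔
      Real.exp (g 0) * D.wef z = d ∧ Real.exp (g 0) * (deriv D.wef z * z) = b := by
  have h_nonneg : 0 ≤ exponentialPoint D.cnMult D.cnStat g :=
    fun s => (exponentialPoint_pos D.cnMult_pos s).le
  simp only [mem_stdPolyhedron_cnStat, h_nonneg, true_and, exponentialPoint_cnStat, hz,
    deriv_wef_mul]
  simp only [wef_eq, Finset.mul_sum, mul_left_comm]

theorem isSaddleVN_iff_exists_exponentialPoint {a b : ℝ} {p : ℝ × ℝ} :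
    D.IsSaddleVN t a b p ↔ ∃ g : Fin 3 → ℝ, p = (Real.exp (g 1), Real.exp (g 2)) ∧
      exponentialPoint (D.vnMult t) (D.vnStat t) g ∈
        stdPolyhedron (D.vnStat t) ![D.delta t, a, b] := by
  have hd := D.delta_pos t
  constructor
  · rintro ⟨hx, hy, hin, hout⟩
    have hB := D.iowef_pos t hx hy
    refine ⟨![Real.log (D.delta t / D.iowef t p.1 p.2), Real.log p.1, Real.log p.2], ?_,
      (D.exponentialPoint_mem_stdPolyhedron_vnStat (Real.exp_log hx) (Real.exp_log hy)).2 ?_⟩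
    · simp [Real.exp_log hx, Real.exp_log hy]
    · simp only [cons_val_zero, Real.exp_log (div_pos hd hB)]
      exact ⟨by field_simp, by rw [eq_div_iff hd.ne'] at hin; rw [← hin]; ring,
        by rw [eq_div_iff hd.ne'] at hout; rw [← hout]; ring⟩
  · rintro ⟨g, rfl, hg⟩
    obtain ⟨hmass, rfl, rfl⟩ := (D.exponentialPoint_mem_stdPolyhedron_vnStat rfl rfl).1 hg
    have hB := D.iowef_pos t (Real.exp_pos (g 1)) (Real.exp_pos (g 2))
    refine ⟨Real.exp_pos _, Real.exp_pos _, ?_, ?_⟩ <;>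
    · simp only [← hmass]
      field_simp

theorem isSaddleCN_iff_exists_exponentialPoint {b z : ℝ} :
    D.IsSaddleCN b z ↔ ∃ g : Fin 2 → ℝ, z = Real.exp (g 1) ∧
      exponentialPoint D.cnMult D.cnStat g ∈ stdPolyhedron D.cnStat ![D.cnRatio, b] := by
  have hd := D.cnRatio_pos
  have hratio : D.lamInt / D.rhoInt = D.cnRatio⁻¹ := (inv_div _ _).symm
  simp only [IsSaddleCN, hratio, ← div_eq_mul_inv, eq_div_iff hd.ne']
  constructor
  · rintro ⟨hz, h⟩
    have hA := D.wef_pos hz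
    refine ⟨![Real.log (D.cnRatio / D.wef z), Real.log z], by simp [Real.exp_log hz],
      (D.exponentialPoint_mem_stdPolyhedron_cnStat (Real.exp_log hz)).2 ?_⟩
    simp only [cons_val_zero, Real.exp_log (div_pos hd hA)]
    exact ⟨by field_simp, by rw [← h]; ring⟩
  · rintro ⟨g, rfl, hg⟩
    obtain ⟨hmass, rfl⟩ := (D.exponentialPoint_mem_stdPolyhedron_cnStat rfl).1 hg
    have hA := D.wef_pos (Real.exp_pos (g 1))
    refine ⟨Real.exp_pos _, ?_⟩
    rw [← hmass]
    field_simp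

theorem exists_isSaddleVN {a b : ℝ} (ha : 0 < a) (hak : a < D.delta t * D.k t)
    (hb : (D.lower t a < b ∧ b < D.upper t a) ∨ (D.lower t a = b ∧ b = D.upper t a)) :
    ∃ p : ℝ × ℝ, D.IsSaddleVN t a b p := by
  obtain ⟨y, hy, hy_pos⟩ := D.exists_pos_mem_stdPolyhedron_vnStat ha hak hb
  obtain ⟨g, hg⟩ := exists_exponentialPoint_mem_stdPolyhedron (r₀ := 0) (D.vnMult_pos t)
    (fun s => rfl) hy hy_pos
  exact ⟨_, D.isSaddleVN_iff_exists_exponentialPoint.2 ⟨g, rfl, hg⟩⟩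

theorem exists_isSaddleCN {b : ℝ} (hb : 0 < b) (hb' : b < D.betaMax) :
    ∃ z, D.IsSaddleCN b z := by
  obtain ⟨y, hy, hy_pos⟩ := D.exists_pos_mem_stdPolyhedron_cnStat hb hb'
  obtain ⟨g, hg⟩ := exists_exponentialPoint_mem_stdPolyhedron (r₀ := 0) D.cnMult_pos
    (fun s => rfl) hy hy_pos
  exact ⟨_, D.isSaddleCN_iff_exists_exponentialPoint.2 ⟨g, rfl, hg⟩⟩

/-- The rows of `vnStat` are independent as soon as the input weights do not determine the average
output weights. -/
theorem eq_zero_of_vecMul_vnStat_eq_zero {a b b' : ℝ} (hb : b ≠ b')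
    (hne : (stdPolyhedron (D.vnStat t) ![D.delta t, a, b]).Nonempty)
    (hne' : (stdPolyhedron (D.vnStat t) ![D.delta t, a, b']).Nonempty) {g : Fin 3 → ℝ}
    (hg : g ᵥ* D.vnStat t = 0) : g = 0 := by
  have hsymbol (s : D.VNSymbol t) : g 0 + g 1 * s.inWeight + g 2 * s.outWeight = 0 := by
    rw [← vecMul_vnStat, hg, Pi.zero_apply]
  have h0 : g 0 = 0 := by simpa using hsymbol (D.vnSymbol (D.B_zero_zero_pos t))
  have hdot {c : Fin 3 → ℝ} (hc : (stdPolyhedron (D.vnStat t) c).Nonempty) : g ⬝ᵥ c = 0 := by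
    obtain ⟨x, -, rfl⟩ := hc
    rw [dotProduct_mulVec, hg, zero_dotProduct]
  have h2 : g 2 = 0 := by
    have h := hdot hne
    have h' := hdot hne'
    simp only [dotProduct, Fin.sum_univ_three, cons_val] at h h'
    exact (mul_eq_zero.1 (by linarith : g 2 * (b - b') = 0)).resolve_right (sub_ne_zero.2 hb)
  obtain ⟨v, hv⟩ := D.exists_B_pos (le_refl (D.k t))
  have h1 : g 1 = 0 := by
    simpa [h0, h2, (D.k_pos t).ne'] using hsymbol (D.vnSymbol hv)
  ext r
  fin_cases r <;> assumption

theorem eq_zero_of_vecMul_cnStat_eq_zero {g : Fin 2 → ℝ} (hg : g ᵥ* D.cnStat = 0) : g = 0 := by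
  have hsymbol (s : D.CNSymbol) : g 0 + g 1 * s.weight = 0 := by
    rw [← vecMul_cnStat, hg, Pi.zero_apply]
  have h0 : g 0 = 0 := by simpa using hsymbol (D.cnSymbol D.A_zero_pos)
  have h1 : g 1 = 0 := by
    simpa [h0, D.maxCNWeight_pos.ne'] using hsymbol (D.cnSymbol D.A_maxCNWeight_pos)
  ext r
  fin_cases r <;> assumption

theorem isSaddleVN_unique {a b : ℝ} (hlt : D.lower t a < D.upper t a) {p p' : ℝ × ℝ}
    (hp : D.IsSaddleVN t a b p) (hp' : D.IsSaddleVN t a b p') : p = p' := by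
  obtain ⟨g, rfl, hg⟩ := D.isSaddleVN_iff_exists_exponentialPoint.1 hp
  obtain ⟨g', rfl, hg'⟩ := D.isSaddleVN_iff_exists_exponentialPoint.1 hp'
  obtain ⟨ha, hak, -, -⟩ := D.mem_vnRegion_of_mem_stdPolyhedron hg
  have hvec := vecMul_eq_of_mulVec_exponentialPoint_eq (D.vnMult_pos t) (hg.2.trans hg'.2.symm)
  have hgg' : g - g' = 0 := D.eq_zero_of_vecMul_vnStat_eq_zero hlt.ne
    (D.stdPolyhedron_vnStat_lower_nonempty ha hak) (D.stdPolyhedron_vnStat_upper_nonempty ha hak)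
    (by rw [sub_vecMul, hvec, sub_self])
  rw [sub_eq_zero.1 hgg']

theorem isSaddleCN_unique {b z z' : ℝ} (hz : D.IsSaddleCN b z) (hz' : D.IsSaddleCN b z') :
    z = z' := by
  obtain ⟨g, rfl, hg⟩ := D.isSaddleCN_iff_exists_exponentialPoint.1 hz
  obtain ⟨g', rfl, hg'⟩ := D.isSaddleCN_iff_exists_exponentialPoint.1 hz'
  have hvec := vecMul_eq_of_mulVec_exponentialPoint_eq D.cnMult_pos (hg.2.trans hg'.2.symm)
  have hgg' : g - g' = 0 := D.eq_zero_of_vecMul_cnStat_eq_zero (by rw [sub_vecMul, hvec, sub_self])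
  rw [sub_eq_zero.1 hgg']

end DGLDPC

end

noncomputable section

open Matrix

namespace DGLDPC

variable {ι : Type*} [Fintype ι] (D : DGLDPC ι) {t : ι}

/-! ### The functions `X` and `Y` -/

/-- The function `X_t`: the growth rate of the number of joint local inputs of the type-`t` VNs with
given total input and output weights. -/
def rateX (t : ι) (p : ℝ × ℝ) : ℝ :=
  optimalValue (D.vnStat t) (weightedEntropy (D.vnMult t)) ![D.delta t, p.1, p.2]

/-- The growth rate of the number of joint local codewords of the CNs with given total weight. -/
def rateCN (b : ℝ) : ℝ := optimalValue D.cnStat (weightedEntropy D.cnMult) ![D.cnRatio, b]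

/-- The function `Y`: the growth rate of the probability that a random arrangement of edge bits of
given total weight satisfies all CNs. -/
def rateY (b : ℝ) : ℝ := D.rateCN b - Real.binEntropy (b * D.lamInt) / D.lamInt

theorem stdPolyhedron_vnStat_subset_Iic (a b : ℝ) :
    stdPolyhedron (D.vnStat t) ![D.delta t, a, b] ⊆ Set.Iic fun _ => D.delta t :=
  stdPolyhedron_subset_Iic (r₀ := 0) fun _ => rfl

theorem stdPolyhedron_cnStat_subset_Iic (b : ℝ) :
    stdPolyhedron D.cnStat ![D.cnRatio, b] ⊆ Set.Iic fun _ => D.cnRatio :=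
  stdPolyhedron_subset_Iic (r₀ := 0) fun _ => rfl

theorem continuousOn_rateX (t : ι) : ContinuousOn (D.rateX t) (D.vnRegion t) := by
  have h := continuousOn_optimalValue (T := D.vnStat t) (continuous_weightedEntropy (D.vnMult t))
    (s := (fun p : ℝ × ℝ => ![D.delta t, p.1, p.2]) '' D.vnRegion t) (M := fun _ => D.delta t)
    (Set.forall_mem_image.2 fun p _ => D.stdPolyhedron_vnStat_subset_Iic p.1 p.2)
    (Set.forall_mem_image.2 fun p hp => D.mem_vnRegion_iff.1 hp)
  exact h.comp (f := fun p : ℝ × ℝ => ![D.delta t, p.1, p.2])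
    (Continuous.continuousOn (by fun_prop)) (Set.mapsTo_image _ _)

theorem continuousOn_rateY : ContinuousOn D.rateY (Set.Icc 0 D.betaMax) := by
  have h := continuousOn_optimalValue (T := D.cnStat) (continuous_weightedEntropy D.cnMult)
    (s := (fun b : ℝ => ![D.cnRatio, b]) '' Set.Icc 0 D.betaMax) (M := fun _ => D.cnRatio)
    (Set.forall_mem_image.2 fun b _ => D.stdPolyhedron_cnStat_subset_Iic b)
    (Set.forall_mem_image.2 fun b hb => D.mem_Icc_betaMax_iff.1 hb)
  refine (h.comp (f := fun b : ℝ => ![D.cnRatio, b]) (Continuous.continuousOn (by fun_prop))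
    (Set.mapsTo_image _ _)).sub ?_
  exact ((Real.binEntropy_continuous.comp (continuous_mul_const _)).div_const _).continuousOn

theorem rateX_eq_valX {a b : ℝ} {p : ℝ × ℝ} (h : D.IsSaddleVN t a b p) :
    D.rateX t (a, b) = D.valX t a b p := by
  obtain ⟨g, rfl, hg⟩ := D.isSaddleVN_iff_exists_exponentialPoint.1 h
  obtain ⟨hmass, -, -⟩ := (D.exponentialPoint_mem_stdPolyhedron_vnStat rfl rfl).1 hg
  have hB := D.iowef_pos t (Real.exp_pos (g 1)) (Real.exp_pos (g 2))
  have hlog : Real.log (D.delta t) =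
      g 0 + Real.log (D.iowef t (Real.exp (g 1)) (Real.exp (g 2))) := by
    rw [← hmass, Real.log_mul (Real.exp_ne_zero _) hB.ne', Real.log_exp]
  rw [rateX, optimalValue_weightedEntropy (r₀ := 0) (D.vnMult_pos t) (fun _ => rfl) hg, valX,
    Real.log_div (by positivity) (by positivity), Real.log_mul (by positivity) (by positivity),
    Real.log_rpow hB, Real.log_rpow (Real.exp_pos _), Real.log_rpow (Real.exp_pos _),
    Real.log_exp, Real.log_exp]
  simp only [Real.negMulLog, dotProduct, Fin.sum_univ_three, cons_val, hlog]
  ring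

theorem rateY_eq_valY {b z : ℝ} (h : D.IsSaddleCN b z) : D.rateY b = D.valY b z := by
  obtain ⟨g, rfl, hg⟩ := D.isSaddleCN_iff_exists_exponentialPoint.1 h
  obtain ⟨hmass, -⟩ := (D.exponentialPoint_mem_stdPolyhedron_cnStat rfl).1 hg
  have hA := D.wef_pos (Real.exp_pos (g 1))
  have hlog : Real.log D.cnRatio = g 0 + Real.log (D.wef (Real.exp (g 1))) := by
    rw [← hmass, Real.log_mul (Real.exp_ne_zero _) hA.ne', Real.log_exp]
  rw [rateY, rateCN, optimalValue_weightedEntropy (r₀ := 0) D.cnMult_pos (fun _ => rfl) hg, valY,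
    ← cnRatio, Real.log_div (by positivity) (by positivity), Real.log_rpow hA,
    Real.log_rpow (Real.exp_pos _), Real.log_exp]
  simp only [Real.negMulLog, dotProduct, Fin.sum_univ_two, cons_val_zero, cons_val_one, hlog]
  ring

end DGLDPC

end

noncomputable section

/-! ### Counting by profiles -/

section Counting

open Nat

variable {I J K : Type*}

/-- The profile of a sequence: the number of occurrences of each symbol. -/
def profile (σ : I → J) (j : J) : ℕ := Nat.card {i // σ i = j}

theorem profile_comp_equiv {I' : Type*} (e : I' ≃ I) (σ : I → J) : profile (σ ∘ e) = profile σ :=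
  funext fun _ => Nat.card_congr (e.subtypeEquiv fun _ => Iff.rfl)

theorem profile_sigma_fst (N : J → ℕ) : profile (Sigma.fst : (Σ j, Fin (N j)) → J) = N :=
  funext fun j => by
    rw [profile, Nat.card_congr (Equiv.sigmaSubtype (β := fun j => Fin (N j)) j), Nat.card_fin]

theorem profile_eq_sum_ite [Fintype I] [DecidableEq J] (σ : I → J) (j : J) :
    profile σ j = ∑ i, if σ i = j then 1 else 0 := by
  rw [profile, Nat.card_eq_fintype_card, Fintype.card_subtype, Finset.card_filter]

theorem sum_comp_eq_sum_profile [Fintype I] [Fintype J] (σ : I → J) (f : J → ℕ) :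
    ∑ i, f (σ i) = ∑ j, profile σ j * f j := by
  classical
  simp_rw [← Finset.sum_fiberwise' Finset.univ σ f, Finset.sum_const, smul_eq_mul, profile,
    Nat.card_eq_fintype_card, Fintype.card_subtype]

theorem prod_comp_eq_prod_profile [Fintype I] [Fintype J] (σ : I → J) (f : J → ℕ) :
    ∏ i, f (σ i) = ∏ j, f j ^ profile σ j := by
  classical
  simp_rw [← Finset.prod_fiberwise' Finset.univ σ f, Finset.prod_const, profile,
    Nat.card_eq_fintype_card, Fintype.card_subtype]

theorem sum_profile [Fintype I] [Fintype J] (σ : I → J) : ∑ j, profile σ j = Fintype.card I := by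
  simpa using (sum_comp_eq_sum_profile σ fun _ => 1).symm

theorem funOnFinite_map_profile [Finite I] [Finite J] [Finite K] (c : J → K) (σ : I → J) :
    FunOnFinite.map c (profile σ) = profile (c ∘ σ) := by
  classical
  have := Fintype.ofFinite I
  have := Fintype.ofFinite J
  funext k
  have h := sum_comp_eq_sum_profile σ fun j => if c j = k then 1 else 0
  simp only [mul_ite, mul_one, mul_zero] at h
  rw [FunOnFinite.map_apply_apply, profile_eq_sum_ite, Finset.sum_filter, ← h]
  rfl

theorem card_equiv_comp_eq {A B : Type*} [Finite A] [Finite B] [Fintype K] {f : A → K} {g : B → K}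
    (h : profile f = profile g) :
    Nat.card {e : A ≃ B // g ∘ e = f} = ∏ k, (profile f k)! := by
  classical
  have := Fintype.ofFinite A
  have e₀ (k : K) : {a // f a = k} ≃ {b // g b = k} := (Finite.card_eq.1 (congrFun h k)).some
  let e := Equiv.ofFiberEquiv e₀
  have he : g ∘ e = f := funext (Equiv.ofFiberEquiv_map e₀)
  rw [Nat.card_congr ((Equiv.equivCongr (Equiv.refl A) e.symm).subtypeEquiv
    (q := fun p : Equiv.Perm A => f ∘ p = f) fun e' => ?_), Nat.card_eq_fintype_card,
    DomMulAct.stabilizer_card]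
  · simp only [profile, Nat.card_eq_fintype_card]
  · have : f ∘ Equiv.equivCongr (Equiv.refl A) e.symm e' = g ∘ e' := by
      rw [← he]
      exact funext fun a => congrArg g (e.apply_symm_apply (e' a))
    rw [this]

theorem card_subtype_comp_of_card_fiber {A B : Type*} [Finite A] [Finite B] (f : A → B)
    {p : B → Prop} {c : ℕ} (h : ∀ b, p b → Nat.card {a // f a = b} = c) :
    Nat.card {a // p (f a)} = Nat.card {b // p b} * c := by
  have := Fintype.ofFinite {b // p b}
  have hfiber (b : {b // p b}) : Nat.card {a // f a = b} = c := h b b.2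
  rw [← Nat.card_congr (Equiv.sigmaSubtypeFiberEquivSubtype f fun _ => Iff.rfl), Nat.card_sigma]
  simp only [hfiber, Finset.sum_const, Finset.card_univ, smul_eq_mul, Nat.card_eq_fintype_card]

theorem card_sequences_mul [Finite I] [Fintype J] [Fintype K] {cI : I → K} {cJ : J → K} {N : J → ℕ}
    (hN : profile cI = FunOnFinite.map cJ N) :
    Nat.card {σ : I → J // cJ ∘ σ = cI ∧ profile σ = N} * ∏ j, (N j)! = ∏ k, (profile cI k)! := by
  let fst : (Σ j, Fin (N j)) → J := Sigma.fst
  have hfst : profile fst = N := profile_sigma_fst N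
  have hcI : profile cI = profile (cJ ∘ fst) := by rw [hN, ← funOnFinite_map_profile, hfst]
  rw [← card_equiv_comp_eq hcI, ← card_subtype_comp_of_card_fiber
    (fun (e : I ≃ Σ j, Fin (N j)) => fst ∘ e) (p := fun σ => cJ ∘ σ = cI ∧ profile σ = N)]
  · refine Nat.card_congr (Equiv.subtypeEquivRight fun e => ?_)
    rw [profile_comp_equiv, hfst]
    exact and_iff_left rfl
  · rintro σ ⟨-, hσ⟩
    rw [card_equiv_comp_eq (hσ.trans hfst.symm), hσ]

theorem card_pi_profile_mul [Finite I] [Fintype J] [Fintype K] {X : I → Type*}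
    [∀ i, Finite (X i)] {sym : ∀ i, X i → J} {cI : I → K} {cJ : J → K}
    (hsym : ∀ i x, cJ (sym i x) = cI i) {c : J → ℕ}
    (hc : ∀ i j, cJ j = cI i → Nat.card {x : X i // sym i x = j} = c j) {N : J → ℕ}
    (hN : profile cI = FunOnFinite.map cJ N) :
    Nat.card {x : ∀ i, X i // (profile fun i => sym i (x i)) = N} * ∏ j, (N j)! =
      (∏ k, (profile cI k)!) * ∏ j, c j ^ N j := by
  have := Fintype.ofFinite I
  rw [← card_sequences_mul hN, Nat.card_congr (Equiv.subtypeEquivRight fun x => ?_),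
    card_subtype_comp_of_card_fiber (fun (x : ∀ i, X i) i => sym i (x i))
      (p := fun σ => cJ ∘ σ = cI ∧ profile σ = N) (c := ∏ j, c j ^ N j), mul_right_comm]
  · rintro σ ⟨hσ, rfl⟩
    rw [Nat.card_congr ((Equiv.subtypeEquivRight fun x => funext_iff).trans
      (Equiv.subtypePiEquivPi (p := fun i x => sym i x = σ i))), Nat.card_pi,
      Finset.prod_congr rfl fun i _ => hc i (σ i) (congrFun hσ i), prod_comp_eq_prod_profile]
  · exact (and_iff_right (funext fun i => hsym i _)).symm

theorem profile_zero_add_profile_one [Fintype I] (σ : I → ZMod 2) :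
    profile σ 0 + profile σ 1 = Fintype.card I :=
  (Fin.sum_univ_two (profile σ)).symm.trans (sum_profile σ)

theorem card_equiv_comp_eq_zmod_two {A B : Type*} [Fintype A] [Fintype B]
    (hAB : Fintype.card A = Fintype.card B) (f : A → ZMod 2) (g : B → ZMod 2) :
    Nat.card {e : A ≃ B // g ∘ e = f} = if profile f 1 = profile g 1 then
      (profile f 1)! * (Fintype.card A - profile f 1)! else 0 := by
  have hf := profile_zero_add_profile_one f
  have hg := profile_zero_add_profile_one g
  split_ifs with h
  · have hzero : profile f 0 = profile g 0 := by omega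
    have hfg : profile f = profile g := funext (Fin.forall_fin_two.2 ⟨hzero, h⟩)
    rw [card_equiv_comp_eq hfg, ← hf, Nat.add_sub_cancel, mul_comm]
    exact Fin.prod_univ_two fun k => (profile f k)!
  · have : IsEmpty {e : A ≃ B // g ∘ e = f} :=
      ⟨fun e => h (by rw [← e.2, profile_comp_equiv])⟩
    exact Nat.card_of_isEmpty

theorem sum_card_subtype_and_comm {A B : Type*} [Fintype A] [Fintype B] (P : B → Prop)
    [DecidablePred P] (Q : A → B → Prop) :
    ∑ a, Nat.card {b // P b ∧ Q a b} = ∑ b with P b, Nat.card {a // Q a b} := by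
  classical
  simp_rw [Nat.card_eq_fintype_card, Fintype.card_subtype, ← Finset.filter_filter]
  exact Finset.sum_card_bipartiteAbove_eq_sum_card_bipartiteBelow Q

end Counting

end

noncomputable section

namespace DGLDPC

variable {ι : Type*} [Fintype ι] (D : DGLDPC ι)

/-! ### The expected weight distribution as a sum over profiles -/

/-- The symbols of all nodes. -/
abbrev Symbol : Type _ := (Σ t : ι, D.VNSymbol t) ⊕ D.CNSymbol

/-- The class of nodes that a symbol belongs to: the type of the VNs, or `none` for the CNs. -/
def symbolClass : D.Symbol → Option ι := Sum.elim (fun s => some s.1) fun _ => none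

/-- The number of local configurations of a node with a given symbol. -/
def symbolMult : D.Symbol → ℕ :=
  Sum.elim (fun s => D.B s.1 s.2.inWeight s.2.outWeight) fun s => D.A s.weight

/-- The contribution of a symbol to the weight of the word. -/
def inWeight : D.Symbol → ℕ := Sum.elim (fun s => s.2.inWeight) fun _ => 0

/-- The contribution of a symbol to the number of ones on the VN sockets. -/
def outWeight : D.Symbol → ℕ := Sum.elim (fun s => s.2.outWeight) fun _ => 0

/-- The contribution of a symbol to the number of ones on the CN sockets. -/
def checkWeight : D.Symbol → ℕ := Sum.elim (fun _ => 0) fun s => s.weight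

theorem symbolMult_pos (j : D.Symbol) : 0 < D.symbolMult j := by
  rcases j with s | s
  exacts [s.2.2, s.2]

/-- The nodes of a member of `M_n`. -/
abbrev Node (n : ℕ) : Type _ := D.VNode n ⊕ Fin (D.numCN n)

/-- The class of a node: the type of a VN, or `none` for a CN. -/
def nodeClass (n : ℕ) : D.Node n → Option ι := Sum.elim (fun p => some p.1) fun _ => none

/-- The number of nodes of a class. -/
def classSize (n : ℕ) : Option ι → ℕ
  | some t => D.numVN n t
  | none => D.numCN n

theorem profile_nodeClass (n : ℕ) : profile (D.nodeClass n) = D.classSize n := by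
  classical
  funext k
  rw [profile_eq_sum_ite, Fintype.sum_sum_type, Fintype.sum_sigma]
  cases k <;> simp [nodeClass, classSize]

/-- The local configurations of a node: the inputs of a VN, the codewords of a CN. -/
def Local (n : ℕ) : D.Node n → Type
  | .inl p => Fin (D.k p.1) → ZMod 2
  | .inr j => D.cn n j

instance (n : ℕ) (i : D.Node n) : Fintype (D.Local n i) :=
  match i with
  | .inl p => inferInstanceAs (Fintype (Fin (D.k p.1) → ZMod 2))
  | .inr j => Fintype.ofFinite (D.cn n j)

/-- The symbol of a local configuration. -/
def localSymbol (n : ℕ) : ∀ i : D.Node n, D.Local n i → D.Symbol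
  | .inl p, x => .inl ⟨p.1, D.vnSymbol ((D.B_pos_iff n p.1 p.2 _ _).2 ⟨x, rfl, rfl⟩)⟩
  | .inr j, c => .inr (D.cnSymbol ((D.A_pos_iff n j _).2 ⟨c.1, c.2, rfl⟩))

theorem symbolClass_localSymbol (n : ℕ) (i : D.Node n) (x : D.Local n i) :
    D.symbolClass (D.localSymbol n i x) = D.nodeClass n i := by
  rcases i with p | j <;> rfl

theorem card_localSymbol_eq (n : ℕ) (i : D.Node n) (j : D.Symbol)
    (h : D.symbolClass j = D.nodeClass n i) :
    Nat.card {x : D.Local n i // D.localSymbol n i x = j} = D.symbolMult j := by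
  rcases i with p | i <;> rcases j with s | s
  · obtain ⟨t, s⟩ := s
    obtain rfl : t = p.1 := Option.some.inj h
    refine (Nat.card_congr (Equiv.subtypeEquivRight fun x => ?_)).trans
      (D.vn_iowef n p.1 p.2 s.inWeight s.outWeight)
    simp [localSymbol, vnSymbol, VNSymbol.inWeight, VNSymbol.outWeight, Subtype.ext_iff,
      Prod.ext_iff, Fin.ext_iff]
  · exact absurd h (by simp [symbolClass, nodeClass])
  · exact absurd h (by simp [symbolClass, nodeClass])
  · refine Eq.trans ?_ (D.cn_wef n i s.weight)
    refine (Nat.card_congr (Equiv.subtypeEquivRight (q := fun x : D.cn n i =>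
      hammingNorm x.1 = s.weight) fun x => ?_)).trans (Nat.card_congr
        (Equiv.subtypeSubtypeEquivSubtypeInter (fun c => c ∈ D.cn n i)
          fun c => hammingNorm c = s.weight))
    simp [localSymbol, cnSymbol, CNSymbol.weight, Subtype.ext_iff, Fin.ext_iff]

/-- A choice of local configurations of all nodes. -/
abbrev Config (n : ℕ) : Type _ := ∀ i : D.Node n, D.Local n i

/-- The bits that a choice of local configurations puts on the VN sockets. -/
def vnBits (n : ℕ) (x : D.Config n) : D.VSocket n → ZMod 2 := D.edgeBit n fun p => x (.inl p)

/-- The bits that a choice of local configurations puts on the CN sockets. -/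
def cnBits (n : ℕ) (x : D.Config n) (e : D.CSocket n) : ZMod 2 := (x (.inr e.1)).1 e.2

/-- The numbers of occurrences of the symbols in a choice of local configurations. -/
def configProfile (n : ℕ) (x : D.Config n) : D.Symbol → ℕ :=
  profile fun i => D.localSymbol n i (x i)

theorem map_symbolClass_configProfile (n : ℕ) (x : D.Config n) :
    FunOnFinite.map D.symbolClass (D.configProfile n x) = D.classSize n := by
  rw [configProfile, funOnFinite_map_profile, ← profile_nodeClass]
  exact congrArg profile (funext fun i => D.symbolClass_localSymbol n i (x i))

theorem sum_configProfile_mul (n : ℕ) (x : D.Config n) (f : D.Symbol → ℕ) :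
    ∑ j, D.configProfile n x j * f j = ∑ i, f (D.localSymbol n i (x i)) :=
  (sum_comp_eq_sum_profile (fun i => D.localSymbol n i (x i)) f).symm

theorem sum_configProfile_mul_inWeight (n : ℕ) (x : D.Config n) :
    ∑ j, D.configProfile n x j * D.inWeight j =
      ∑ p : D.VNode n, hammingNorm (show Fin (D.k p.1) → ZMod 2 from x (.inl p)) := by
  rw [sum_configProfile_mul, Fintype.sum_sum_type]
  simp [localSymbol, inWeight]

theorem hammingNorm_eq_profile_one {l : ℕ} (c : Fin l → ZMod 2) : hammingNorm c = profile c 1 := by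
  have ne_zero_iff : ∀ z : ZMod 2, z ≠ 0 ↔ z = 1 := by decide
  simp only [hammingNorm, ne_zero_iff, profile_eq_sum_ite, Finset.card_filter]

theorem profile_vnBits_one (n : ℕ) (x : D.Config n) :
    profile (D.vnBits n x) 1 = ∑ j, D.configProfile n x j * D.outWeight j := by
  rw [sum_configProfile_mul, Fintype.sum_sum_type, profile_eq_sum_ite, Fintype.sum_sigma]
  simp only [localSymbol, outWeight, Sum.elim_inl, Sum.elim_inr, outWeight_vnSymbol,
    Finset.sum_const_zero, add_zero, hammingNorm_eq_profile_one, profile_eq_sum_ite]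
  rfl

theorem profile_cnBits_one (n : ℕ) (x : D.Config n) :
    profile (D.cnBits n x) 1 = ∑ j, D.configProfile n x j * D.checkWeight j := by
  rw [sum_configProfile_mul, Fintype.sum_sum_type, profile_eq_sum_ite, Fintype.sum_prod_type]
  simp only [localSymbol, checkWeight, Sum.elim_inl, Sum.elim_inr, weight_cnSymbol,
    Finset.sum_const_zero, zero_add, hammingNorm_eq_profile_one, profile_eq_sum_ite]
  rfl

theorem numCodewords_eq (n : ℕ) (π : D.VSocket n ≃ D.CSocket n) (w : ℕ) :
    D.numCodewords n π w = Nat.card {x : D.Config n //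
      ∑ j, D.configProfile n x j * D.inWeight j = w ∧ D.cnBits n x ∘ π = D.vnBits n x} := by
  have eq_of_comp_eq {x : D.Config n} (hx : D.cnBits n x ∘ π = D.vnBits n x)
      (j : Fin (D.numCN n)) :
      (fun l => D.edgeBit n (fun p => x (.inl p)) (π.symm (j, l))) = (x (.inr j)).1 := by
    funext l
    have := congrFun hx (π.symm (j, l))
    rw [Function.comp_apply, Equiv.apply_symm_apply] at this
    exact this.symm
  simp_rw [sum_configProfile_mul_inWeight]
  refine Nat.card_congr ⟨fun u => ⟨fun i => match i with
      | .inl p => u.1 p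
      | .inr j => ⟨_, u.2.1 j⟩, u.2.2, ?_⟩,
    fun x => ⟨fun p => x.1 (.inl p), fun j => ?_, x.2.1⟩, fun u => rfl, fun x => ?_⟩
  · funext e
    simp [cnBits, vnBits]
  · rw [eq_of_comp_eq x.2.2]
    exact (x.1 (.inr j)).2
  · ext1
    funext i
    rcases i with p | j
    · rfl
    · exact Subtype.ext (eq_of_comp_eq x.2.2 j)

/-- The number of edges. -/
def numEdges (n : ℕ) : ℕ := D.numCN n * D.s

theorem card_CSocket (n : ℕ) : Fintype.card (D.CSocket n) = D.numEdges n := by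
  simp [numEdges]

theorem card_VSocket {n : ℕ} (hn : D.Admissible n) : Fintype.card (D.VSocket n) = D.numEdges n := by
  have hl := D.lamInt_pos
  have hs : (0 : ℝ) < D.s := by exact_mod_cast D.s_pos
  have hlam : ∑ t, (D.lam t : ℝ) = 1 := by exact_mod_cast D.lam_sum
  have hvn (t : ι) : (D.numVN n t : ℝ) * D.q t = n / D.lamInt * D.lam t := by
    have hq : (0 : ℝ) < D.q t := by exact_mod_cast D.q_pos t
    rw [hn.2.1 t, delta]
    field_simp
  have hcard : Fintype.card (D.VSocket n) = ∑ t, D.numVN n t * D.q t := by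
    simp [Fintype.card_sigma, Fintype.sum_sigma]
  rw [hcard, numEdges, ← Nat.cast_inj (R := ℝ)]
  push_cast
  rw [hn.2.2, rhoInt_eq, Finset.sum_congr rfl fun t _ => hvn t, ← Finset.mul_sum, hlam]
  field_simp

/-- The profiles of the configurations that contribute to the codewords of weight `w`. -/
def profiles (n w : ℕ) : Set (D.Symbol → ℕ) :=
  {N | FunOnFinite.map D.symbolClass N = D.classSize n ∧ ∑ j, N j * D.inWeight j = w ∧
    ∑ j, N j * D.outWeight j = ∑ j, N j * D.checkWeight j}

theorem configProfile_mem_profiles_iff {n w : ℕ} {x : D.Config n} :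
    D.configProfile n x ∈ D.profiles n w ↔ ∑ j, D.configProfile n x j * D.inWeight j = w ∧
      ∑ j, D.configProfile n x j * D.outWeight j = ∑ j, D.configProfile n x j * D.checkWeight j :=
  and_iff_right (D.map_symbolClass_configProfile n x)

theorem le_classSize_of_mem_profiles {n w : ℕ} {N : D.Symbol → ℕ} (hN : N ∈ D.profiles n w)
    (j : D.Symbol) : N j ≤ D.classSize n (D.symbolClass j) := by
  classical
  rw [← hN.1, FunOnFinite.map_apply_apply]
  exact Finset.single_le_sum (fun _ _ => Nat.zero_le _) (by simp)

theorem finite_profiles (n w : ℕ) : (D.profiles n w).Finite := by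
  classical
  exact (Set.finite_Iic fun j => D.classSize n (D.symbolClass j)).subset
    fun _ hN => D.le_classSize_of_mem_profiles hN

open Nat

/-- The number of edge permutations that make a codeword of a configuration with a given profile. -/
def numMatchings (n : ℕ) (N : D.Symbol → ℕ) : ℕ :=
  (∑ j, N j * D.checkWeight j)! * (D.numEdges n - ∑ j, N j * D.checkWeight j)!

/-- The contribution of a profile to the expected number of codewords: the number of configurations
with this profile times the probability that such a configuration is a codeword. -/
def profileTerm (n : ℕ) (N : D.Symbol → ℕ) : ℝ :=
  ((∏ k, (D.classSize n k)! : ℕ) * (∏ j, D.symbolMult j ^ N j : ℕ) / (∏ j, (N j)! : ℕ)) *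
    (D.numMatchings n N / (D.numEdges n)! )

open Classical in
theorem sum_numCodewords {n : ℕ} (hn : D.Admissible n) (w : ℕ) :
    ∑ π : D.VSocket n ≃ D.CSocket n, D.numCodewords n π w =
      ∑ x : D.Config n with D.configProfile n x ∈ D.profiles n w,
        D.numMatchings n (D.configProfile n x) := by
  have hE : Fintype.card (D.VSocket n) = Fintype.card (D.CSocket n) := by
    rw [D.card_VSocket hn, D.card_CSocket]
  simp_rw [numCodewords_eq, configProfile_mem_profiles_iff, ← Finset.filter_filter]
  rw [sum_card_subtype_and_comm, Finset.sum_filter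
    (fun x => ∑ j, D.configProfile n x j * D.outWeight j = _)]
  refine Finset.sum_congr rfl fun x _ => ?_
  rw [card_equiv_comp_eq_zmod_two hE, profile_vnBits_one, profile_cnBits_one, D.card_VSocket hn]
  split_ifs with h
  · rw [h, numMatchings]
  · rfl

theorem card_configProfile_eq {n w : ℕ} {N : D.Symbol → ℕ} (hN : N ∈ D.profiles n w) :
    (Nat.card {x : D.Config n // D.configProfile n x = N} : ℝ) =
      (∏ k, (D.classSize n k)! : ℕ) * (∏ j, D.symbolMult j ^ N j : ℕ) / (∏ j, (N j)! : ℕ) := by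
  have h := card_pi_profile_mul (D.symbolClass_localSymbol n) (D.card_localSymbol_eq n)
    ((D.profile_nodeClass n).trans hN.1.symm)
  rw [profile_nodeClass] at h
  have hpos : (0 : ℝ) < (∏ j, (N j)! : ℕ) :=
    Nat.cast_pos.2 (Finset.prod_pos fun j _ => Nat.factorial_pos _)
  rw [eq_div_iff hpos.ne']
  exact_mod_cast h

theorem expNum_eq {n : ℕ} (hn : D.Admissible n) (w : ℕ) :
    D.expNum n w = ∑ N ∈ (D.finite_profiles n w).toFinset, D.profileTerm n N := by
  classical
  have hE : Fintype.card (D.VSocket n) = Fintype.card (D.CSocket n) := by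
    rw [D.card_VSocket hn, D.card_CSocket]
  have hcard : Fintype.card (D.VSocket n ≃ D.CSocket n) = (D.numEdges n)! := by
    rw [Fintype.card_equiv (Fintype.equivOfCardEq hE), D.card_VSocket hn]
  have hexp : D.expNum n w =
      (∑ π : D.VSocket n ≃ D.CSocket n, D.numCodewords n π w : ℕ) / ((D.numEdges n)! : ℝ) := by
    rw [← hcard, Nat.cast_sum, expNum]
  rw [hexp, D.sum_numCodewords hn, ← Finset.sum_fiberwise_of_maps_to
    (t := (D.finite_profiles n w).toFinset) (g := D.configProfile n) fun x hx => by simpa using hx,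
    Nat.cast_sum, Finset.sum_div]
  refine Finset.sum_congr rfl fun N hN => ?_
  rw [Set.Finite.mem_toFinset] at hN
  have hfilter (x : D.Config n) : D.configProfile n x ∈ D.profiles n w ∧
      D.configProfile n x = N ↔ D.configProfile n x = N := and_iff_right_of_imp fun h => h ▸ hN
  rw [Finset.filter_filter, Finset.filter_congr fun x _ => hfilter x,
    Finset.sum_congr rfl fun x hx => by rw [(Finset.mem_filter.1 hx).2], Finset.sum_const,
    smul_eq_mul, Nat.cast_mul, ← Fintype.card_subtype, ← Nat.card_eq_fintype_card,
    D.card_configProfile_eq hN, profileTerm, mul_div_assoc]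

end DGLDPC

end

noncomputable section

/-! ### Exponential approximation of the contribution of a profile -/

open Matrix Nat

/-- The error in the approximation `n log n - n` of `log n!`. -/
def factorialRemainder (n : ℕ) : ℝ := Real.log n ! + Real.negMulLog n + n

theorem factorialRemainder_eq {n : ℕ} (hn : n ≠ 0) :
    factorialRemainder n = Real.log (Stirling.stirlingSeq n) + Real.log (2 * n) / 2 := by
  have hn0 : (n : ℝ) ≠ 0 := Nat.cast_ne_zero.2 hn
  rw [Stirling.log_stirlingSeq_formula, Real.log_div hn0 (Real.exp_ne_zero 1), Real.log_exp,
    factorialRemainder, Real.negMulLog]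
  ring

theorem factorialRemainder_nonneg (n : ℕ) : 0 ≤ factorialRemainder n := by
  rcases eq_or_ne n 0 with rfl | hn
  · simp [factorialRemainder]
  · have h := Stirling.le_log_factorial_stirling hn
    have hlog : 0 ≤ Real.log n := Real.log_natCast_nonneg n
    have hpi : 0 ≤ Real.log (2 * Real.pi) := Real.log_nonneg (by linarith [Real.pi_gt_three])
    rw [factorialRemainder, Real.negMulLog]
    linarith

theorem factorialRemainder_le_log_add_one (n : ℕ) : factorialRemainder n ≤ Real.log n + 1 := by
  rcases n with _ | n
  · simp [factorialRemainder]
  · have hanti : Real.log (Stirling.stirlingSeq (n + 1)) ≤ Real.log (Stirling.stirlingSeq 1) :=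
      Stirling.log_stirlingSeq'_antitone (Nat.zero_le n)
    have hlog : 0 ≤ Real.log (n + 1 : ℕ) := Real.log_natCast_nonneg _
    rw [Stirling.stirlingSeq_one, Real.log_div (Real.exp_ne_zero 1) (by positivity), Real.log_exp,
      Real.log_sqrt two_pos.le] at hanti
    rw [factorialRemainder_eq n.succ_ne_zero,
      Real.log_mul two_ne_zero (Nat.cast_ne_zero.2 n.succ_ne_zero)]
    linarith

theorem abs_factorialRemainder_le {n : ℕ} {b : ℝ} (hn : (n : ℝ) ≤ b) :
    |factorialRemainder n| ≤ Real.log (b + 1) + 1 := by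
  rw [abs_of_nonneg (factorialRemainder_nonneg n)]
  refine (factorialRemainder_le_log_add_one n).trans (add_le_add_left ?_ 1)
  rcases n.eq_zero_or_pos with rfl | hpos
  · simpa using Real.log_nonneg (by simpa using hn)
  · exact Real.log_le_log (Nat.cast_pos.2 hpos) (by linarith)

theorem abs_sum_factorialRemainder_le {K : Type*} [Fintype K] {m : K → ℕ} {b : ℝ}
    (hm : ∀ k, (m k : ℝ) ≤ b) :
    |∑ k, factorialRemainder (m k)| ≤ Fintype.card K * (Real.log (b + 1) + 1) := by
  refine (Finset.abs_sum_le_sum_abs _ _).trans ?_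
  refine (Finset.sum_le_card_nsmul _ _ _ fun k _ => abs_factorialRemainder_le (hm k)).trans ?_
  rw [nsmul_eq_mul, Finset.card_univ]

namespace DGLDPC

variable {ι : Type*} [Fintype ι] (D : DGLDPC ι)

/-- The number of nodes of each class per VN. -/
def density : Option ι → ℝ
  | some t => D.delta t
  | none => D.cnRatio

/-- The total mass that a vector indexed by the symbols puts on each class. -/
def mass (x : D.Symbol → ℝ) : Option ι → ℝ := FunOnFinite.map D.symbolClass x

/-- The total number of ones on the CN sockets. -/
def checkSum (x : D.Symbol → ℝ) : ℝ := ∑ j, x j * D.checkWeight j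

/-- The exponent of the contribution of a profile to the expected number of codewords. It is
homogeneous of degree one, so that it applies to profiles and to normalized profiles alike. -/
def exponent (x : D.Symbol → ℝ) : ℝ :=
  ∑ j, (Real.negMulLog (x j) + x j * Real.log (D.symbolMult j)) -
      ∑ k, Real.negMulLog (D.mass x k) +
    (Real.negMulLog (D.mass x none * D.s) - Real.negMulLog (D.checkSum x) -
      Real.negMulLog (D.mass x none * D.s - D.checkSum x))

theorem mass_smul (c : ℝ) (x : D.Symbol → ℝ) : D.mass (c • x) = c • D.mass x :=
  map_smul (FunOnFinite.linearMap ℝ ℝ D.symbolClass) c x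

theorem continuous_mass : Continuous D.mass :=
  FunOnFinite.continuous_map ℝ D.symbolClass

theorem sum_mass (x : D.Symbol → ℝ) : ∑ k, D.mass x k = ∑ j, x j := by
  simpa only [Pi.one_apply, one_mul, mass] using sum_mul_funOnFinite_map D.symbolClass 1 x

theorem le_mass {x : D.Symbol → ℝ} (hx : 0 ≤ x) (j : D.Symbol) :
    x j ≤ D.mass x (D.symbolClass j) := by
  classical
  rw [mass, FunOnFinite.map_apply_apply]
  exact Finset.single_le_sum (fun i _ => hx i) (by simp)

theorem mass_natCast (N : D.Symbol → ℕ) (k : Option ι) :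
    D.mass (fun j => (N j : ℝ)) k = (FunOnFinite.map D.symbolClass N k : ℕ) := by
  classical
  simp [mass, FunOnFinite.map_apply_apply]

theorem checkSum_smul (c : ℝ) (x : D.Symbol → ℝ) : D.checkSum (c • x) = c * D.checkSum x := by
  simp only [checkSum, Finset.mul_sum, Pi.smul_apply, smul_eq_mul, mul_assoc]

theorem checkSum_natCast (N : D.Symbol → ℕ) :
    D.checkSum (fun j => (N j : ℝ)) = (∑ j, N j * D.checkWeight j : ℕ) := by
  simp [checkSum]

theorem continuous_checkSum : Continuous D.checkSum := by
  unfold checkSum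
  fun_prop

theorem continuous_exponent : Continuous D.exponent := by
  have hmass (k : Option ι) : Continuous fun x => D.mass x k :=
    (continuous_apply k).comp D.continuous_mass
  have hcheck := D.continuous_checkSum
  unfold exponent
  fun_prop

theorem exponent_smul (c : ℝ) (x : D.Symbol → ℝ) : D.exponent (c • x) = c * D.exponent x := by
  simp only [exponent, mass_smul, checkSum_smul, Pi.smul_apply, smul_eq_mul, mul_assoc, ← mul_sub,
    Real.negMulLog_mul c, Finset.sum_add_distrib, ← Finset.sum_mul, ← Finset.mul_sum, sum_mass]
  ring

theorem density_pos (k : Option ι) : 0 < D.density k := by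
  rcases k with _ | t
  exacts [D.cnRatio_pos, D.delta_pos t]

/-- A bound on the number of nodes of each class and on the number of edges, per VN. -/
def sizeBound : ℝ := ∑ k, D.density k + D.cnRatio * D.s

theorem density_le_sizeBound (k : Option ι) : D.density k ≤ D.sizeBound :=
  (Finset.single_le_sum (fun k _ => (D.density_pos k).le) (Finset.mem_univ k)).trans
    (le_add_of_nonneg_right (mul_nonneg D.cnRatio_pos.le (Nat.cast_nonneg _)))

theorem sizeBound_pos : 0 < D.sizeBound :=
  (D.density_pos none).trans_le (D.density_le_sizeBound none)

variable {D} {n w : ℕ} {N : D.Symbol → ℕ}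

theorem Admissible.classSize_eq (hn : D.Admissible n) (k : Option ι) :
    (D.classSize n k : ℝ) = n * D.density k := by
  rcases k with _ | t
  exacts [hn.2.2, hn.2.1 t]

theorem Admissible.classSize_le (hn : D.Admissible n) (k : Option ι) :
    (D.classSize n k : ℝ) ≤ D.sizeBound * n := by
  rw [hn.classSize_eq, mul_comm]
  exact mul_le_mul_of_nonneg_right (D.density_le_sizeBound k) (Nat.cast_nonneg n)

theorem Admissible.numEdges_le (hn : D.Admissible n) : (D.numEdges n : ℝ) ≤ D.sizeBound * n := by
  have hm : (D.numCN n : ℝ) = n * D.cnRatio := hn.classSize_eq none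
  have hd : 0 ≤ ∑ k, D.density k := Finset.sum_nonneg fun k _ => (D.density_pos k).le
  calc (D.numEdges n : ℝ) = D.cnRatio * D.s * n := by rw [numEdges, Nat.cast_mul, hm]; ring
    _ ≤ D.sizeBound * n :=
      mul_le_mul_of_nonneg_right (le_add_of_nonneg_left hd) (Nat.cast_nonneg n)

theorem mass_of_mem_profiles (hN : N ∈ D.profiles n w) (k : Option ι) :
    D.mass (fun j => (N j : ℝ)) k = D.classSize n k := by
  rw [mass_natCast, hN.1]

theorem sum_checkWeight_le_numEdges (hN : N ∈ D.profiles n w) :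
    ∑ j, N j * D.checkWeight j ≤ D.numEdges n := by
  classical
  have hcn : D.numCN n = ∑ s : D.CNSymbol, N (.inr s) := by
    rw [show D.numCN n = FunOnFinite.map D.symbolClass N none by rw [hN.1, classSize],
      FunOnFinite.map_apply_apply, Finset.sum_filter, Fintype.sum_sum_type]
    simp [symbolClass]
  rw [Fintype.sum_sum_type, numEdges, hcn, Finset.sum_mul]
  simpa [checkWeight, CNSymbol.weight] using Finset.sum_le_sum fun s _ =>
    Nat.mul_le_mul_left (N (.inr s)) (le_s_of_A_pos D s.2)

theorem profileTerm_pos (n : ℕ) (N : D.Symbol → ℕ) : 0 < D.profileTerm n N := by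
  have hmult : 0 < ∏ j, D.symbolMult j ^ N j :=
    Finset.prod_pos fun j _ => pow_pos (D.symbolMult_pos j) _
  have hmatch : 0 < D.numMatchings n N := mul_pos (factorial_pos _) (factorial_pos _)
  unfold profileTerm
  positivity

theorem log_profileTerm (n : ℕ) (N : D.Symbol → ℕ) :
    Real.log (D.profileTerm n N) = ∑ k, Real.log (D.classSize n k)! +
      ∑ j, N j * Real.log (D.symbolMult j) - ∑ j, Real.log (N j)! +
        (Real.log (∑ j, N j * D.checkWeight j)! +
          Real.log (D.numEdges n - ∑ j, N j * D.checkWeight j)! - Real.log (D.numEdges n)!) := by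
  have hfact (m : ℕ) : (m ! : ℝ) ≠ 0 := Nat.cast_ne_zero.2 m.factorial_ne_zero
  have hpow (j : D.Symbol) : (D.symbolMult j : ℝ) ^ N j ≠ 0 :=
    pow_ne_zero _ (Nat.cast_ne_zero.2 (D.symbolMult_pos j).ne')
  have hclass : ∏ k, ((D.classSize n k)! : ℝ) ≠ 0 := Finset.prod_ne_zero_iff.2 fun k _ => hfact _
  have hmult : ∏ j, (D.symbolMult j : ℝ) ^ N j ≠ 0 := Finset.prod_ne_zero_iff.2 fun j _ => hpow j
  have hprofile : ∏ j, ((N j)! : ℝ) ≠ 0 := Finset.prod_ne_zero_iff.2 fun j _ => hfact _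
  rw [profileTerm, numMatchings]
  push_cast
  rw [Real.log_mul (div_ne_zero (mul_ne_zero hclass hmult) hprofile)
      (div_ne_zero (mul_ne_zero (hfact _) (hfact _)) (hfact _)),
    Real.log_div (mul_ne_zero hclass hmult) hprofile, Real.log_mul hclass hmult,
    Real.log_div (mul_ne_zero (hfact _) (hfact _)) (hfact _), Real.log_mul (hfact _) (hfact _),
    Real.log_prod fun k _ => hfact _, Real.log_prod fun j _ => hpow j,
    Real.log_prod fun j _ => hfact _]
  simp only [Real.log_pow]

theorem log_profileTerm_sub_exponent (hN : N ∈ D.profiles n w) :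
    Real.log (D.profileTerm n N) - D.exponent (fun j => (N j : ℝ)) =
      ∑ k, factorialRemainder (D.classSize n k) - ∑ j, factorialRemainder (N j) +
        (factorialRemainder (∑ j, N j * D.checkWeight j) +
          factorialRemainder (D.numEdges n - ∑ j, N j * D.checkWeight j) -
            factorialRemainder (D.numEdges n)) := by
  have hmass := mass_of_mem_profiles hN
  have hsum : ∑ k, (D.classSize n k : ℝ) = ∑ j, (N j : ℝ) := by simp_rw [← hmass, sum_mass]
  have hedges : D.mass (fun j => (N j : ℝ)) none * D.s = D.numEdges n := by
    rw [hmass, numEdges, Nat.cast_mul, classSize]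
  rw [log_profileTerm, exponent, hedges, checkSum_natCast]
  simp only [hmass, factorialRemainder, Finset.sum_add_distrib, hsum]
  rw [Nat.cast_sub (sum_checkWeight_le_numEdges hN)]
  ring

variable (D) in
/-- A bound, of logarithmic size, on the error of the exponent. -/
def termError (n : ℕ) : ℝ :=
  (Fintype.card (Option ι) + Fintype.card D.Symbol + 3) * (Real.log (D.sizeBound * n + 1) + 1)

theorem abs_log_profileTerm_sub_le (hn : D.Admissible n) (hN : N ∈ D.profiles n w) :
    |Real.log (D.profileTerm n N) - D.exponent (fun j => (N j : ℝ))| ≤ D.termError n := by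
  have hedges := hn.numEdges_le
  have hcheck : ((∑ j, N j * D.checkWeight j : ℕ) : ℝ) ≤ D.sizeBound * n :=
    (Nat.cast_le.2 (sum_checkWeight_le_numEdges hN)).trans hedges
  have hsub : ((D.numEdges n - ∑ j, N j * D.checkWeight j : ℕ) : ℝ) ≤ D.sizeBound * n :=
    (Nat.cast_le.2 (Nat.sub_le _ _)).trans hedges
  have hsymbol (j : D.Symbol) : (N j : ℝ) ≤ D.sizeBound * n :=
    (Nat.cast_le.2 (D.le_classSize_of_mem_profiles hN j)).trans (hn.classSize_le _)
  rw [log_profileTerm_sub_exponent hN, termError]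
  refine (abs_add_le _ _).trans ?_
  linarith [abs_sub (∑ k, factorialRemainder (D.classSize n k)) (∑ j, factorialRemainder (N j)),
    abs_sub (factorialRemainder (∑ j, N j * D.checkWeight j) +
      factorialRemainder (D.numEdges n - ∑ j, N j * D.checkWeight j))
        (factorialRemainder (D.numEdges n)),
    abs_add_le (factorialRemainder (∑ j, N j * D.checkWeight j))
      (factorialRemainder (D.numEdges n - ∑ j, N j * D.checkWeight j)),
    abs_sum_factorialRemainder_le hn.classSize_le, abs_sum_factorialRemainder_le hsymbol,
    abs_factorialRemainder_le hcheck, abs_factorialRemainder_le hsub,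
    abs_factorialRemainder_le hedges]

end DGLDPC

end

noncomputable section

/-! ### The growth rate as the maximal exponent -/

open Matrix

theorem tendsto_log_mul_natCast_add_one_div {c : ℝ} (hc : 0 < c) :
    Tendsto (fun n : ℕ => Real.log (c * n + 1) / n) atTop (𝓝 0) := by
  have hlin : Tendsto (fun n : ℕ => c * (n : ℝ) + 1) atTop atTop :=
    tendsto_atTop_add_const_right _ _ (tendsto_natCast_atTop_atTop.const_mul_atTop hc)
  have hO : (fun n : ℕ => c * (n : ℝ) + 1) =O[atTop] fun n : ℕ => (n : ℝ) :=
    ((Asymptotics.isBigO_refl _ _).const_mul_left c).add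
      (Asymptotics.isLittleO_const_left.2 <| .inr <|
        tendsto_norm_atTop_atTop.comp tendsto_natCast_atTop_atTop).isBigO
  exact ((Real.isLittleO_log_id_atTop.comp_tendsto hlin).trans_isBigO hO).tendsto_div_nhds_zero

namespace DGLDPC

variable {ι : Type*} [Fintype ι] (D : DGLDPC ι)

open Classical in
/-- The linear statistics of a profile: the sizes of the classes, the weight of the word, and the
difference between the numbers of ones on the VN sockets and on the CN sockets. -/
def profileStat : Matrix (Option ι ⊕ Fin 2) D.Symbol ℤ :=
  Sum.elim (fun k j => if D.symbolClass j = k then 1 else 0)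
    ![fun j => D.inWeight j, fun j => D.outWeight j - D.checkWeight j]

/-- The statistics of the normalized profiles of the configurations of weight `α n`. -/
def target (α : ℝ) : Option ι ⊕ Fin 2 → ℝ := Sum.elim D.density ![α, 0]

/-- The polyhedron that contains the normalized profiles of the configurations of weight `α n`. -/
def profilePolyhedron (α : ℝ) : Set (D.Symbol → ℝ) :=
  stdPolyhedron (D.profileStat.map (↑)) (D.target α)

/-- The maximal exponent of the profiles of weight `α n`. -/
def maxExponent (α : ℝ) : ℝ := optimalValue (D.profileStat.map (↑)) D.exponent (D.target α)

/-- The profile `N` per VN. -/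
def frequency (n : ℕ) (N : D.Symbol → ℕ) : D.Symbol → ℝ := (n : ℝ)⁻¹ • fun j => (N j : ℝ)

theorem profileStat_mulVec (x : D.Symbol → ℝ) :
    D.profileStat.map (↑) *ᵥ x = Sum.elim (D.mass x)
      ![∑ j, x j * D.inWeight j, ∑ j, x j * D.outWeight j - D.checkSum x] := by
  classical
  funext r
  simp only [mulVec, dotProduct, Matrix.map_apply]
  rcases r with k | i
  · simp [profileStat, mass, FunOnFinite.map_apply_apply, Finset.sum_filter,
      -Fintype.sum_sum_type]
  · fin_cases i
    · simp [profileStat, mul_comm, -Fintype.sum_sum_type]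
    · simp [profileStat, checkSum, ← Finset.sum_sub_distrib, ← mul_sub, mul_comm,
        -Fintype.sum_sum_type]

theorem profileStat_mulVec_eq_iff {x : D.Symbol → ℝ} {c : Option ι → ℝ} {a b : ℝ} :
    D.profileStat.map (↑) *ᵥ x = Sum.elim c ![a, b] ↔ D.mass x = c ∧
      ∑ j, x j * D.inWeight j = a ∧ ∑ j, x j * D.outWeight j - D.checkSum x = b := by
  rw [profileStat_mulVec, Sum.elim_eq_iff]
  simp

theorem mem_profilePolyhedron_iff {α : ℝ} {x : D.Symbol → ℝ} :
    x ∈ D.profilePolyhedron α ↔ 0 ≤ x ∧ D.mass x = D.density ∧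
      ∑ j, x j * D.inWeight j = α ∧ ∑ j, x j * D.outWeight j - D.checkSum x = 0 :=
  and_congr_right fun _ => D.profileStat_mulVec_eq_iff

theorem profileStat_mulVec_natCast_eq_iff {n w : ℕ} {N : D.Symbol → ℕ} :
    D.profileStat.map (↑) *ᵥ (fun j => (N j : ℝ)) =
      Sum.elim (fun k => (D.classSize n k : ℝ)) ![(w : ℝ), 0] ↔ N ∈ D.profiles n w := by
  rw [profileStat_mulVec_eq_iff, checkSum, sub_eq_zero, funext_iff]
  simp_rw [mass_natCast]
  rw [profiles, Set.mem_ofPred_eq, funext_iff]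
  norm_cast

theorem profilePolyhedron_subset_Iic (α : ℝ) :
    D.profilePolyhedron α ⊆ Set.Iic fun j => D.density (D.symbolClass j) := by
  intro x hx j
  obtain ⟨hx0, hmass, -⟩ := D.mem_profilePolyhedron_iff.1 hx
  exact hmass ▸ D.le_mass hx0 j

theorem exponent_le_maxExponent {α : ℝ} {x : D.Symbol → ℝ} (hx : x ∈ D.profilePolyhedron α) :
    D.exponent x ≤ D.maxExponent α :=
  le_optimalValue D.continuous_exponent (D.profilePolyhedron_subset_Iic α) hx

theorem exists_exponent_eq_maxExponent {α : ℝ} (hα : (D.profilePolyhedron α).Nonempty) :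
    ∃ x ∈ D.profilePolyhedron α, D.exponent x = D.maxExponent α :=
  exists_eq_optimalValue D.continuous_exponent (D.profilePolyhedron_subset_Iic α) hα

theorem continuousOn_maxExponent :
    ContinuousOn D.maxExponent {α | (D.profilePolyhedron α).Nonempty} := by
  have htarget : Continuous D.target := by
    refine continuous_pi fun r => ?_
    rcases r with k | i
    · exact continuous_const
    · fin_cases i
      exacts [continuous_id, continuous_const]
  exact (continuousOn_optimalValue D.continuous_exponent
    (Set.forall_mem_image.2 fun α _ => D.profilePolyhedron_subset_Iic α)
    (Set.forall_mem_image.2 fun _ hα => hα)).comp htarget.continuousOn (Set.mapsTo_image _ _)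

variable {D} {n w : ℕ} {N : D.Symbol → ℕ}

theorem frequency_mem_profilePolyhedron (hn : D.Admissible n) (hN : N ∈ D.profiles n w) :
    D.frequency n N ∈ D.profilePolyhedron ((w : ℝ) / n) := by
  have hn0 : (n : ℝ) ≠ 0 := Nat.cast_ne_zero.2 hn.1.ne'
  refine ⟨smul_nonneg (by positivity) fun j => Nat.cast_nonneg _, ?_⟩
  rw [frequency, mulVec_smul, D.profileStat_mulVec_natCast_eq_iff.2 hN, target]
  funext r
  rcases r with k | i
  · simp [hn.classSize_eq, hn0]
  · fin_cases i <;> simp [div_eq_inv_mul]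

theorem exponent_natCast_eq (hn : D.Admissible n) (N : D.Symbol → ℕ) :
    D.exponent (fun j => (N j : ℝ)) = n * D.exponent (D.frequency n N) := by
  rw [frequency, exponent_smul, mul_inv_cancel_left₀ (Nat.cast_ne_zero.2 hn.1.ne')]

theorem dist_frequency (hn : 0 < n) (N : D.Symbol → ℕ) (x : D.Symbol → ℝ) :
    dist (D.frequency n N) x = ‖(fun j => (N j : ℝ)) - (n : ℝ) • x‖ / n := by
  have hn0 : (0 : ℝ) < n := Nat.cast_pos.2 hn
  have hscale : D.frequency n N - x = (n : ℝ)⁻¹ • ((fun j => (N j : ℝ)) - (n : ℝ) • x) := by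
    rw [smul_sub, inv_smul_smul₀ hn0.ne', frequency]
  rw [dist_eq_norm, hscale, norm_smul, Real.norm_eq_abs, abs_of_pos (inv_pos.2 hn0),
    div_eq_inv_mul]

theorem expNum_pos_iff (hn : D.Admissible n) :
    0 < D.expNum n w ↔ (D.profiles n w).Nonempty := by
  rw [D.expNum_eq hn, Finset.sum_pos_iff_of_nonneg fun N _ => (profileTerm_pos n N).le]
  simp [profileTerm_pos, Set.Nonempty]

theorem card_profiles_le (hn : D.Admissible n) (w : ℕ) :
    ((D.finite_profiles n w).toFinset.card : ℝ) ≤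
      (D.sizeBound * n + 1) ^ Fintype.card D.Symbol := by
  classical
  have hsub : (D.finite_profiles n w).toFinset ⊆
      Fintype.piFinset fun j => Finset.range (D.classSize n (D.symbolClass j) + 1) :=
    fun N hN => Fintype.mem_piFinset.2 fun j => Finset.mem_range_succ_iff.2 <|
      D.le_classSize_of_mem_profiles ((Set.Finite.mem_toFinset _).1 hN) j
  calc ((D.finite_profiles n w).toFinset.card : ℝ)
      ≤ ∏ j, ((D.classSize n (D.symbolClass j) : ℝ) + 1) := by
        exact_mod_cast (Finset.card_le_card hsub).trans_eq (by simp)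
    _ ≤ ∏ _j : D.Symbol, (D.sizeBound * n + 1) := Finset.prod_le_prod (fun j _ => by positivity)
        fun j _ => add_le_add_left (hn.classSize_le _) 1
    _ = (D.sizeBound * n + 1) ^ Fintype.card D.Symbol := by
        rw [Finset.prod_const, Finset.card_univ]

theorem profileTerm_le_exp (hn : D.Admissible n) (hN : N ∈ D.profiles n w) :
    D.profileTerm n N ≤ Real.exp (n * D.maxExponent ((w : ℝ) / n) + D.termError n) := by
  have happrox := (abs_le.1 (abs_log_profileTerm_sub_le hn hN)).2
  have hmax := mul_le_mul_of_nonneg_left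
    (D.exponent_le_maxExponent (frequency_mem_profilePolyhedron hn hN)) (Nat.cast_nonneg n)
  rw [← Real.log_le_iff_le_exp (profileTerm_pos n N)]
  rw [exponent_natCast_eq hn] at happrox
  linarith

theorem log_expNum_div_le (hn : D.Admissible n) (hpos : 0 < D.expNum n w) :
    1 / (n : ℝ) * Real.log (D.expNum n w) ≤ D.maxExponent ((w : ℝ) / n) +
      (D.termError n / n + Fintype.card D.Symbol * (Real.log (D.sizeBound * n + 1) / n)) := by
  have hn0 : (0 : ℝ) < n := Nat.cast_pos.2 hn.1
  have hbound : 0 < D.sizeBound * n + 1 := by have := D.sizeBound_pos; positivity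
  have hle : D.expNum n w ≤ (D.sizeBound * n + 1) ^ Fintype.card D.Symbol *
      Real.exp (n * D.maxExponent ((w : ℝ) / n) + D.termError n) := by
    rw [D.expNum_eq hn]
    refine (Finset.sum_le_card_nsmul _ _ _ fun N hN =>
      profileTerm_le_exp hn ((Set.Finite.mem_toFinset _).1 hN)).trans ?_
    rw [nsmul_eq_mul]
    exact mul_le_mul_of_nonneg_right (card_profiles_le hn w) (Real.exp_pos _).le
  have hlog := Real.log_le_log hpos hle
  rw [Real.log_mul (pow_pos hbound _).ne' (Real.exp_ne_zero _), Real.log_exp, Real.log_pow] at hlog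
  rw [one_div, inv_mul_le_iff₀ hn0]
  refine hlog.trans_eq ?_
  field_simp
  ring

theorem le_log_expNum_div (hn : D.Admissible n) (hN : N ∈ D.profiles n w) :
    D.exponent (D.frequency n N) - D.termError n / n ≤
      1 / (n : ℝ) * Real.log (D.expNum n w) := by
  have hn0 : (0 : ℝ) < n := Nat.cast_pos.2 hn.1
  have hle : D.profileTerm n N ≤ D.expNum n w := by
    rw [D.expNum_eq hn]
    exact Finset.single_le_sum (fun N _ => (profileTerm_pos n N).le) (by simpa using hN)
  have hlog := Real.log_le_log (profileTerm_pos n N) hle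
  have happrox := (abs_le.1 (abs_log_profileTerm_sub_le hn hN)).1
  rw [exponent_natCast_eq hn] at happrox
  rw [one_div, ← div_eq_inv_mul, le_div_iff₀ hn0, sub_mul, div_mul_cancel₀ _ hn0.ne']
  linarith

theorem tendsto_termError_div (D : DGLDPC ι) :
    Tendsto (fun n : ℕ => D.termError n / n) atTop (𝓝 0) := by
  have h := ((tendsto_log_mul_natCast_add_one_div D.sizeBound_pos).add
    tendsto_one_div_atTop_nhds_zero_nat).const_mul
      ((Fintype.card (Option ι) : ℝ) + Fintype.card D.Symbol + 3)
  rw [add_zero, mul_zero] at h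
  refine h.congr fun n => ?_
  rw [termError]
  ring

variable (D)

theorem eventually_growthFilter (α : ℝ) :
    ∀ᶠ p in D.growthFilter α, D.Admissible p.1 ∧ 0 < D.expNum p.1 p.2 :=
  eventually_inf_principal.2 (Eventually.of_forall fun _ hp => hp)

theorem tendsto_fst_growthFilter (α : ℝ) : Tendsto Prod.fst (D.growthFilter α) atTop :=
  tendsto_comap.mono_left (inf_le_left.trans inf_le_left)

theorem tendsto_div_growthFilter (α : ℝ) :
    Tendsto (fun p : ℕ × ℕ => (p.2 : ℝ) / p.1) (D.growthFilter α) (𝓝 α) :=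
  tendsto_comap.mono_left (inf_le_left.trans inf_le_right)

/-- The Hoffman bound rounds `n • x` to a profile, because the required statistics are those of some
profile. -/
theorem exists_forall_exists_profile_near :
    ∃ K : ℝ, ∀ {α : ℝ} {x : D.Symbol → ℝ} {n w : ℕ}, x ∈ D.profilePolyhedron α →
      D.Admissible n → (D.profiles n w).Nonempty → ∃ N ∈ D.profiles n w,
        dist (D.frequency n N) x ≤ K * (1 / (n : ℝ) + |α - (w : ℝ) / n|) := by
  obtain ⟨K, hK⟩ := exists_nat_hoffman_bound D.profileStat
  refine ⟨|K|, fun {α x n w} hx hn ⟨M, hM⟩ => ?_⟩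
  have hn0 : (0 : ℝ) < n := Nat.cast_pos.2 hn.1
  obtain ⟨N, hNM, hdist⟩ := hK ((n : ℝ) • x) M (smul_nonneg hn0.le hx.1)
  rw [D.profileStat_mulVec_natCast_eq_iff.2 hM] at hNM hdist
  have hdefect : ‖D.profileStat.map (↑) *ᵥ ((n : ℝ) • x) -
      Sum.elim (fun k => (D.classSize n k : ℝ)) ![(w : ℝ), 0]‖ ≤ n * |α - (w : ℝ) / n| := by
    rw [mulVec_smul, hx.2, pi_norm_le_iff_of_nonneg (by positivity), target]
    rintro (k | i)
    · simpa [hn.classSize_eq] using by positivity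
    · fin_cases i
      · rw [← abs_of_pos hn0, ← abs_mul, mul_sub, abs_of_pos hn0, mul_div_cancel₀ _ hn0.ne']
        simp
      · simpa using by positivity
  refine ⟨N, D.profileStat_mulVec_natCast_eq_iff.1 hNM, ?_⟩
  calc dist (D.frequency n N) x ≤ |K| * (1 + n * |α - (w : ℝ) / n|) / n := by
        rw [dist_frequency hn.1]
        gcongr
        exact hdist.trans (by gcongr; exact le_abs_self K)
    _ = |K| * (1 / (n : ℝ) + |α - (w : ℝ) / n|) := by field_simp

theorem exists_profile_frequency_tendsto {α : ℝ} {x : D.Symbol → ℝ}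
    (hx : x ∈ D.profilePolyhedron α) : ∃ N : ℕ × ℕ → D.Symbol → ℕ,
      (∀ᶠ p in D.growthFilter α, N p ∈ D.profiles p.1 p.2) ∧
        Tendsto (fun p => D.frequency p.1 (N p)) (D.growthFilter α) (𝓝 x) := by
  obtain ⟨K, hK⟩ := D.exists_forall_exists_profile_near
  have hnear (p : ℕ × ℕ) : ∃ N, D.Admissible p.1 ∧ 0 < D.expNum p.1 p.2 →
      N ∈ D.profiles p.1 p.2 ∧
        dist (D.frequency p.1 N) x ≤ K * (1 / (p.1 : ℝ) + |α - (p.2 : ℝ) / p.1|) := by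
    by_cases hp : D.Admissible p.1 ∧ 0 < D.expNum p.1 p.2
    · obtain ⟨N, hN⟩ := hK hx hp.1 ((expNum_pos_iff hp.1).1 hp.2)
      exact ⟨N, fun _ => hN⟩
    · exact ⟨0, fun h => absurd h hp⟩
  choose N hN using hnear
  have hev := (D.eventually_growthFilter α).mono hN
  refine ⟨N, hev.mono fun _ h => h.1, ?_⟩
  have hbound : Tendsto (fun p : ℕ × ℕ => K * (1 / (p.1 : ℝ) + |α - (p.2 : ℝ) / p.1|))
      (D.growthFilter α) (𝓝 0) := by
    have hinv := (tendsto_one_div_atTop_nhds_zero_nat (𝕜 := ℝ)).comp (D.tendsto_fst_growthFilter α)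
    have hdiv := ((D.tendsto_div_growthFilter α).const_sub α).abs
    simpa using (hinv.add hdiv).const_mul K
  exact tendsto_iff_dist_tendsto_zero.2
    (squeeze_zero' (Eventually.of_forall fun _ => dist_nonneg) (hev.mono fun _ h => h.2) hbound)

theorem tendsto_log_expNum_div {α : ℝ} (hα : (D.profilePolyhedron α).Nonempty) :
    Tendsto (fun p : ℕ × ℕ => 1 / (p.1 : ℝ) * Real.log (D.expNum p.1 p.2)) (D.growthFilter α)
      (𝓝 (D.maxExponent α)) := by
  have hfst := D.tendsto_fst_growthFilter α
  have hev := D.eventually_growthFilter α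
  have herror := D.tendsto_termError_div.comp hfst
  obtain ⟨x, hx, hmax⟩ := D.exists_exponent_eq_maxExponent hα
  obtain ⟨N, hN, hNx⟩ := D.exists_profile_frequency_tendsto hx
  have hlower := ((D.continuous_exponent.tendsto x).comp hNx).sub herror
  rw [hmax, sub_zero] at hlower
  have hvalue : Tendsto (fun p : ℕ × ℕ => D.maxExponent ((p.2 : ℝ) / p.1)) (D.growthFilter α)
      (𝓝 (D.maxExponent α)) := by
    refine (D.continuousOn_maxExponent α hα).tendsto.comp
      (tendsto_nhdsWithin_iff.2 ⟨D.tendsto_div_growthFilter α, ?_⟩)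
    filter_upwards [hev, hN] with p hp hNp
    exact ⟨_, frequency_mem_profilePolyhedron hp.1 hNp⟩
  have hupper := hvalue.add (herror.add (((tendsto_log_mul_natCast_add_one_div
    D.sizeBound_pos).comp hfst).const_mul (Fintype.card D.Symbol : ℝ)))
  rw [mul_zero, add_zero, add_zero] at hupper
  refine tendsto_of_tendsto_of_tendsto_of_le_of_le' hlower hupper ?_ ?_
  · filter_upwards [hev, hN] with p hp hNp
    exact le_log_expNum_div hp.1 hNp
  · filter_upwards [hev] with p hp
    exact log_expNum_div_le hp.1 hp.2

end DGLDPC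

end

noncomputable section

/-! ### Existence of codewords of all feasible weights -/

open Matrix

namespace DGLDPC

variable {ι : Type*} [Fintype ι] (D : DGLDPC ι)

theorem exists_rat_density (k : Option ι) : ∃ r : ℚ, (r : ℝ) = D.density k := by
  rcases k with _ | t
  · refine ⟨1 / D.s / ∑ t, D.lam t / D.q t, ?_⟩
    rw [density, cnRatio, rhoInt_eq, lamInt_eq]
    push_cast
    rfl
  · refine ⟨D.lam t / (D.q t * ∑ t, D.lam t / D.q t), ?_⟩
    rw [density, delta, lamInt_eq]
    push_cast
    rfl

theorem exists_forall_admissible_mul : ∃ N, ∀ i, 0 < i → D.Admissible (N * i) := by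
  choose r hr using D.exists_rat_density
  obtain ⟨N, hN, z, hz⟩ := exists_common_denominator r
  refine ⟨N, fun i hi => ?_⟩
  have hfloor (k : Option ι) : (⌊((N * i : ℕ) : ℝ) * D.density k⌋₊ : ℝ) =
      (N * i : ℕ) * D.density k := by
    have hinteger : ((z k * i : ℤ) : ℝ) = (N * i : ℕ) * D.density k := by
      have hzr : (z k : ℝ) = N * D.density k := by rw [← hr]; exact_mod_cast hz k
      push_cast
      rw [hzr]
      ring
    have hnonneg : (0 : ℤ) ≤ z k * i := by
      have := mul_nonneg (Nat.cast_nonneg (α := ℝ) (N * i)) (D.density_pos k).le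
      rw [← hinteger] at this
      exact_mod_cast this
    obtain ⟨m, hm⟩ := Int.eq_ofNat_of_zero_le hnonneg
    rw [← hinteger, hm, Int.cast_natCast, Nat.floor_natCast]
  exact ⟨Nat.mul_pos hN hi, fun t => hfloor (some t), hfloor none⟩

theorem profiles_zero_nonempty (n : ℕ) : (D.profiles n 0).Nonempty := by
  let x : D.Config n
    | .inl p => (0 : Fin (D.k p.1) → ZMod 2)
    | .inr j => (0 : D.cn n j)
  have hvn : D.vnBits n x = 0 := funext fun e => congrFun (map_zero (D.vn n e.1.1 e.1.2)) e.2
  have hcn : D.cnBits n x = 0 := rfl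
  refine ⟨D.configProfile n x, D.configProfile_mem_profiles_iff.2 ⟨?_, ?_⟩⟩
  · exact (D.sum_configProfile_mul_inWeight n x).trans
      (Finset.sum_eq_zero fun p _ => hammingNorm_zero)
  · rw [← D.profile_vnBits_one n x, ← D.profile_cnBits_one n x, hvn, hcn]
    simp [profile_eq_sum_ite]

/-- The weight is left free, so that only the homogeneous statistics of the zero codeword have to be
matched. -/
theorem exists_forall_exists_weight_profile_near :
    ∃ K : ℝ, ∀ {α : ℝ} {x : D.Symbol → ℝ} {n : ℕ}, x ∈ D.profilePolyhedron α →
      D.Admissible n → ∃ w, ∃ N ∈ D.profiles n w, dist (D.frequency n N) x ≤ K / n := by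
  classical
  let rows : {r : Option ι ⊕ Fin 2 // r ≠ .inr 0} → Option ι ⊕ Fin 2 := Subtype.val
  obtain ⟨K, hK⟩ := exists_nat_hoffman_bound (D.profileStat.submatrix rows id)
  refine ⟨K, fun {α x n} hx hn => ?_⟩
  obtain ⟨M, hM⟩ := D.profiles_zero_nonempty n
  have hrows (y : D.Symbol → ℝ) : (D.profileStat.submatrix rows id).map (↑) *ᵥ y =
      (D.profileStat.map (↑) *ᵥ y) ∘ rows := rfl
  have hdefect : (D.profileStat.submatrix rows id).map ((↑) : ℤ → ℝ) *ᵥ ((n : ℝ) • x) =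
      (D.profileStat.submatrix rows id).map (↑) *ᵥ fun j => (M j : ℝ) := by
    rw [hrows, hrows, D.profileStat_mulVec_natCast_eq_iff.2 hM, mulVec_smul, hx.2]
    funext ⟨r, hr⟩
    rcases r with k | i
    · simp [rows, target, hn.classSize_eq]
    · fin_cases i
      · exact absurd rfl hr
      · simp [rows, target]
  obtain ⟨N, hNM, hdist⟩ := hK ((n : ℝ) • x) M (smul_nonneg n.cast_nonneg hx.1)
  rw [hdefect, sub_self, norm_zero, add_zero, mul_one] at hdist
  refine ⟨∑ j, N j * D.inWeight j, N, D.profileStat_mulVec_natCast_eq_iff.1 (funext fun r => ?_),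
    (dist_frequency hn.1 N x).trans_le (by gcongr)⟩
  by_cases hr : r = .inr 0
  · simp [hr, profileStat_mulVec]
  · rw [hrows, hrows, D.profileStat_mulVec_natCast_eq_iff.2 hM] at hNM
    refine (congrFun hNM ⟨r, hr⟩).trans ?_
    rcases r with k | i
    · rfl
    · fin_cases i
      exacts [absurd rfl hr, rfl]

theorem growthFilter_neBot {α : ℝ} (hα : (D.profilePolyhedron α).Nonempty) :
    (D.growthFilter α).NeBot := by
  obtain ⟨x, hx⟩ := hα
  obtain ⟨K, hK⟩ := D.exists_forall_exists_weight_profile_near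
  obtain ⟨m, hm⟩ := D.exists_forall_admissible_mul
  have hadm (i : ℕ) : D.Admissible (m * (i + 1)) := hm _ i.succ_pos
  choose w N hN hNx using fun i => hK hx (hadm i)
  have hn : Tendsto (fun i => m * (i + 1)) atTop atTop :=
    ((strictMono_mul_left_of_pos (Nat.pos_of_mul_pos_right (hadm 0).1)).comp
      (strictMono_id.add_const 1)).tendsto_atTop
  have hfreq : Tendsto (fun i => D.frequency (m * (i + 1)) (N i)) atTop (𝓝 x) :=
    tendsto_iff_dist_tendsto_zero.2 <| squeeze_zero (fun _ => dist_nonneg) hNx <|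
      (tendsto_natCast_atTop_atTop.comp hn).const_div_atTop K
  have hweight : Tendsto (fun i => (w i : ℝ) / (m * (i + 1) : ℕ)) atTop (𝓝 α) := by
    have hcont : Continuous fun y : D.Symbol → ℝ => ∑ j, y j * D.inWeight j := by fun_prop
    have h := (hcont.tendsto x).comp hfreq
    rw [(D.mem_profilePolyhedron_iff.1 hx).2.2.1] at h
    exact h.congr fun i =>
      (D.mem_profilePolyhedron_iff.1 (frequency_mem_profilePolyhedron (hadm i) (hN i))).2.2.1
  have hlim : Tendsto (fun i => (m * (i + 1), w i)) atTop (D.growthFilter α) :=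
    tendsto_inf.2 ⟨tendsto_inf.2 ⟨tendsto_comap_iff.2 hn, tendsto_comap_iff.2 hweight⟩,
      tendsto_principal.2 <| Eventually.of_forall fun i =>
        ⟨hadm i, (expNum_pos_iff (hadm i)).2 ⟨_, hN i⟩⟩⟩
  exact hlim.neBot

theorem isGrowthRate_maxExponent {α : ℝ} (hα : (D.profilePolyhedron α).Nonempty) :
    D.IsGrowthRate α (D.maxExponent α) :=
  ⟨D.growthFilter_neBot hα, D.tendsto_log_expNum_div hα⟩

end DGLDPC

end

noncomputable section

/-! ### Maximization over the weights of each type -/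

theorem negMulLog_sub_sub_eq_neg_mul_binEntropy {E l : ℝ} (hE : E ≠ 0) :
    Real.negMulLog E - Real.negMulLog l - Real.negMulLog (E - l) =
      -(E * Real.binEntropy (l / E)) := by
  have hl := Real.negMulLog_mul E (l / E)
  have hsub := Real.negMulLog_mul E (1 - l / E)
  rw [mul_div_cancel₀ l hE] at hl
  rw [mul_sub, mul_one, mul_div_cancel₀ l hE] at hsub
  rw [Real.binEntropy_eq_negMulLog_add_negMulLog_one_sub, hl, hsub]
  ring

namespace DGLDPC

variable {ι : Type*} [Fintype ι] {D : DGLDPC ι}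

/-- The part of a profile that belongs to the type-`t` VNs. -/
def vnPart (x : D.Symbol → ℝ) (t : ι) (s : D.VNSymbol t) : ℝ := x (.inl ⟨t, s⟩)

/-- The part of a profile that belongs to the CNs. -/
def cnPart (x : D.Symbol → ℝ) (s : D.CNSymbol) : ℝ := x (.inr s)

theorem mass_some (x : D.Symbol → ℝ) (t : ι) : D.mass x (some t) = ∑ s, vnPart x t s := by
  classical
  rw [mass, FunOnFinite.map_apply_apply, Finset.sum_filter, Fintype.sum_sum_type,
    Fintype.sum_sigma, Finset.sum_eq_single t]
  · simp [symbolClass, vnPart]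
  · intro t' _ ht'
    simp [symbolClass, ht']
  · simp

theorem mass_none (x : D.Symbol → ℝ) : D.mass x none = ∑ s, cnPart x s := by
  classical
  rw [mass, FunOnFinite.map_apply_apply, Finset.sum_filter, Fintype.sum_sum_type]
  simp [symbolClass, cnPart]

theorem sum_mul_inWeight (x : D.Symbol → ℝ) :
    ∑ j, x j * D.inWeight j = ∑ t, ∑ s : D.VNSymbol t, (s.inWeight : ℝ) * vnPart x t s := by
  simp [Fintype.sum_sigma, inWeight, vnPart, mul_comm]

theorem sum_mul_outWeight (x : D.Symbol → ℝ) :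
    ∑ j, x j * D.outWeight j = ∑ t, ∑ s : D.VNSymbol t, (s.outWeight : ℝ) * vnPart x t s := by
  simp [Fintype.sum_sigma, outWeight, vnPart, mul_comm]

theorem checkSum_eq (x : D.Symbol → ℝ) :
    D.checkSum x = ∑ s : D.CNSymbol, (s.weight : ℝ) * cnPart x s := by
  simp [checkSum, checkWeight, cnPart, mul_comm]

theorem exponent_eq {x : D.Symbol → ℝ} (hx : D.mass x none = D.cnRatio) :
    D.exponent x = ∑ t, weightedEntropy (D.vnMult t) (vnPart x t) +
      (weightedEntropy D.cnMult (cnPart x) -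
        Real.binEntropy (D.checkSum x * D.lamInt) / D.lamInt) := by
  have hl := D.lamInt_pos
  have hs : (0 : ℝ) < D.s := Nat.cast_pos.2 D.s_pos
  have hE : D.mass x none * D.s = 1 / D.lamInt := by
    rw [hx, cnRatio, rhoInt_eq]
    field_simp
  rw [exponent, hE, negMulLog_sub_sub_eq_neg_mul_binEntropy (one_div_pos.2 hl).ne']
  simp only [Fintype.sum_option, mass_none, mass_some, weightedEntropy, Fintype.sum_sum_type,
    Fintype.sum_sigma, Finset.sum_sub_distrib, div_div_eq_mul_div, div_one]
  simp only [vnPart, cnPart, symbolMult, vnMult, cnMult, Sum.elim_inl, Sum.elim_inr]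
  ring

theorem exists_feasible_of_mem_profilePolyhedron {α : ℝ} {x : D.Symbol → ℝ}
    (hx : x ∈ D.profilePolyhedron α) : ∃ p ∈ D.feasible α,
      (∀ t, vnPart x t ∈ stdPolyhedron (D.vnStat t) ![D.delta t, p.1 t, p.2 t]) ∧
        cnPart x ∈ stdPolyhedron D.cnStat ![D.cnRatio, ∑ t, p.2 t] := by
  obtain ⟨hx0, hmass, hin, hbalance⟩ := D.mem_profilePolyhedron_iff.1 hx
  rw [sum_mul_inWeight] at hin
  rw [sum_mul_outWeight, sub_eq_zero] at hbalance
  have hV (t : ι) : vnPart x t ∈ stdPolyhedron (D.vnStat t) ![D.delta t,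
      ∑ s : D.VNSymbol t, (s.inWeight : ℝ) * vnPart x t s,
      ∑ s : D.VNSymbol t, (s.outWeight : ℝ) * vnPart x t s] :=
    mem_stdPolyhedron_vnStat.2
      ⟨fun s => hx0 _, (mass_some x t).symm.trans (congrFun hmass _), rfl, rfl⟩
  have hC : cnPart x ∈ stdPolyhedron D.cnStat ![D.cnRatio,
      ∑ t, ∑ s : D.VNSymbol t, (s.outWeight : ℝ) * vnPart x t s] :=
    mem_stdPolyhedron_cnStat.2 ⟨fun s => hx0 _, (mass_none x).symm.trans (congrFun hmass _),
      (checkSum_eq x).symm.trans hbalance.symm⟩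
  exact ⟨(_, _), ⟨fun t => D.mem_vnRegion_of_mem_stdPolyhedron (hV t), hin,
    (D.mem_Icc_betaMax_iff.2 ⟨_, hC⟩).2⟩, hV, hC⟩

theorem mem_profilePolyhedron_of_parts {a b : ι → ℝ} {x : D.Symbol → ℝ}
    (hV : ∀ t, vnPart x t ∈ stdPolyhedron (D.vnStat t) ![D.delta t, a t, b t])
    (hC : cnPart x ∈ stdPolyhedron D.cnStat ![D.cnRatio, ∑ t, b t]) :
    x ∈ D.profilePolyhedron (∑ t, a t) := by
  simp only [mem_stdPolyhedron_vnStat] at hV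
  obtain ⟨hC0, hCmass, hCweight⟩ := mem_stdPolyhedron_cnStat.1 hC
  refine D.mem_profilePolyhedron_iff.2 ⟨?_, ?_, ?_, ?_⟩
  · rintro (⟨t, s⟩ | s)
    exacts [(hV t).1 s, hC0 s]
  · funext k
    rcases k with _ | t
    exacts [(mass_none x).trans hCmass, (mass_some x t).trans (hV t).2.1]
  · rw [sum_mul_inWeight]
    exact Finset.sum_congr rfl fun t _ => (hV t).2.2.1
  · rw [sum_mul_outWeight, checkSum_eq, hCweight, sub_eq_zero]
    exact Finset.sum_congr rfl fun t _ => (hV t).2.2.2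

theorem exponent_eq_of_parts {b : ℝ} {x : D.Symbol → ℝ}
    (hC : cnPart x ∈ stdPolyhedron D.cnStat ![D.cnRatio, b]) :
    D.exponent x = ∑ t, weightedEntropy (D.vnMult t) (vnPart x t) +
      (weightedEntropy D.cnMult (cnPart x) - Real.binEntropy (b * D.lamInt) / D.lamInt) := by
  obtain ⟨-, hmass, hweight⟩ := mem_stdPolyhedron_cnStat.1 hC
  rw [exponent_eq ((mass_none x).trans hmass), checkSum_eq, hweight]

theorem nonneg_of_mem_vnRegion {t : ι} {a b : ℝ} (h : (a, b) ∈ D.vnRegion t) : 0 ≤ b := by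
  obtain ⟨x, hx⟩ := D.mem_vnRegion_iff.1 h
  obtain ⟨hx0, -, -, rfl⟩ := mem_stdPolyhedron_vnStat.1 hx
  exact Finset.sum_nonneg fun s _ => mul_nonneg (Nat.cast_nonneg _) (hx0 s)

variable (D)

/-- The function that is maximized in the formula for the growth rate. -/
def objective (p : (ι → ℝ) × (ι → ℝ)) : ℝ := ∑ t, D.rateX t (p.1 t, p.2 t) + D.rateY (∑ t, p.2 t)

variable {D}

theorem exists_mem_profilePolyhedron_of_feasible {α : ℝ} {p : (ι → ℝ) × (ι → ℝ)}
    (hp : p ∈ D.feasible α) : ∃ x ∈ D.profilePolyhedron α, D.exponent x = D.objective p := by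
  obtain ⟨hregion, rfl, hβ⟩ := hp
  have hβ0 : 0 ≤ ∑ t, p.2 t := Finset.sum_nonneg fun t _ => nonneg_of_mem_vnRegion (hregion t)
  choose y hy hy_max using fun t => exists_eq_optimalValue (continuous_weightedEntropy (D.vnMult t))
    (D.stdPolyhedron_vnStat_subset_Iic (p.1 t) (p.2 t)) (D.mem_vnRegion_iff.1 (hregion t))
  obtain ⟨z, hz, hz_max⟩ := exists_eq_optimalValue (continuous_weightedEntropy D.cnMult)
    (D.stdPolyhedron_cnStat_subset_Iic _) (D.mem_Icc_betaMax_iff.1 ⟨hβ0, hβ⟩)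
  let x : D.Symbol → ℝ := Sum.elim (fun s => y s.1 s.2) z
  have hV (t : ι) : vnPart x t = y t := rfl
  have hC : cnPart x = z := rfl
  refine ⟨x, mem_profilePolyhedron_of_parts hy hz, ?_⟩
  rw [exponent_eq_of_parts hz, hC, hz_max]
  simp only [hV, hy_max]
  rfl

theorem exists_feasible_exponent_le {α : ℝ} {x : D.Symbol → ℝ} (hx : x ∈ D.profilePolyhedron α) :
    ∃ p ∈ D.feasible α, D.exponent x ≤ D.objective p := by
  obtain ⟨p, hp, hV, hC⟩ := exists_feasible_of_mem_profilePolyhedron hx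
  refine ⟨p, hp, ?_⟩
  rw [exponent_eq_of_parts hC]
  refine add_le_add (Finset.sum_le_sum fun t _ => ?_) (sub_le_sub_right ?_ _)
  · exact le_optimalValue (continuous_weightedEntropy _)
      (D.stdPolyhedron_vnStat_subset_Iic _ _) (hV t)
  · exact le_optimalValue (continuous_weightedEntropy _) (D.stdPolyhedron_cnStat_subset_Iic _) hC

theorem isGreatest_maxExponent {α : ℝ} (hα : (D.profilePolyhedron α).Nonempty) :
    IsGreatest (D.objective '' D.feasible α) (D.maxExponent α) := by
  have hle : ∀ p ∈ D.feasible α, D.objective p ≤ D.maxExponent α := fun p hp => by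
    obtain ⟨x, hx, hxp⟩ := exists_mem_profilePolyhedron_of_feasible hp
    exact hxp.symm.trans_le (D.exponent_le_maxExponent hx)
  obtain ⟨x, hx, hmax⟩ := D.exists_exponent_eq_maxExponent hα
  obtain ⟨p, hp, hxp⟩ := exists_feasible_exponent_le hx
  exact ⟨⟨p, hp, (hle p hp).antisymm (hmax.symm.trans_le hxp)⟩, Set.forall_mem_image.2 hle⟩

end DGLDPC

end

theorem proposition1 {ι : Type*} [Fintype ι] (D : DGLDPC ι) :
    -- existence and uniqueness of `z₀`
    (∀ β : ℝ, 0 < β → β < D.betaMax → ∃! z : ℝ, D.IsSaddleCN β z) ∧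
    -- existence and uniqueness of `(x₀, y₀)`
    (∀ (t : ι) (a b : ℝ), 0 < a → a < D.delta t * D.k t → D.lower t a < b → b < D.upper t a →
      ∃! p : ℝ × ℝ, D.IsSaddleVN t a b p) ∧
    -- degenerate VN types (such as repetition codes), where the two bounds coincide and
    -- `(x₀, y₀)` exists but is not unique
    (∀ (t : ι) (a b : ℝ), 0 < a → a < D.delta t * D.k t → D.lower t a = b → b = D.upper t a →
      ∃ p : ℝ × ℝ, D.IsSaddleVN t a b p) ∧
    -- `X t` and `Y` are given by the saddle points, and by continuity at those boundary points of
    -- their domains where there is no positive saddle point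
    ∃ (X : ι → ℝ × ℝ → ℝ) (Y : ℝ → ℝ),
      (∀ t, ContinuousOn (X t) (D.vnRegion t)) ∧
      (∀ (t : ι) (a b : ℝ) (p : ℝ × ℝ), D.IsSaddleVN t a b p → X t (a, b) = D.valX t a b p) ∧
      ContinuousOn Y (Set.Icc 0 D.betaMax) ∧
      (∀ β z : ℝ, D.IsSaddleCN β z → Y β = D.valY β z) ∧
      -- the growth rate is the constrained maximum
      ∀ α : ℝ, (D.feasible α).Nonempty →
        ∃ G : ℝ, D.IsGrowthRate α G ∧
          IsGreatest ((fun p : (ι → ℝ) × (ι → ℝ) =>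
            ∑ t, X t (p.1 t, p.2 t) + Y (∑ t, p.2 t)) '' D.feasible α) G := by
  refine ⟨fun β h0 h1 => ?_, fun t a b h0 h1 hl hu => ?_, fun t a b h0 h1 hl hu => ?_,
    D.rateX, D.rateY, D.continuousOn_rateX, fun t a b p h => D.rateX_eq_valX h,
    D.continuousOn_rateY, fun β z h => D.rateY_eq_valY h, fun α hα => ?_⟩
  · obtain ⟨z, hz⟩ := D.exists_isSaddleCN h0 h1
    exact ⟨z, hz, fun z' hz' => D.isSaddleCN_unique hz' hz⟩
  · obtain ⟨p, hp⟩ := D.exists_isSaddleVN h0 h1 (Or.inl ⟨hl, hu⟩)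
    exact ⟨p, hp, fun p' hp' => D.isSaddleVN_unique (hl.trans hu) hp' hp⟩
  · exact D.exists_isSaddleVN h0 h1 (Or.inr ⟨hl, hu⟩)
  · obtain ⟨p, hp⟩ := hα
    obtain ⟨x, hx, -⟩ := DGLDPC.exists_mem_profilePolyhedron_of_feasible hp
    exact ⟨D.maxExponent α, D.isGrowthRate_maxExponent ⟨x, hx⟩,
      DGLDPC.isGreatest_maxExponent ⟨x, hx⟩⟩
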